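/- **Setting.** Let $d\ge 1$, let $\Omega\subset\mathbb R^d$ be an open connected Lipschitz domain, $T>0$, and let $a_\epsilon=a_0$ in a measurable set $\Omega_\epsilon\subset\Omega$ and $a_\epsilon=1$ elsewhere, with $a_0>0$; put $b_\epsilon(v,w)=\int_\Omega a_\epsilon\nabla v\cdot\nabla w$. Let $u_\epsilon$ be the weak solution on $(0,T)$ of $\partial_{tt}u_\epsilon-\nabla\cdot(a_\epsilon\nabla u_\epsilon)=f$ with zero Dirichlet boundary values, $u_\epsilon(0)=u^0\in H^1_0(\Omega)$, $\partial_tu_\epsilon(0)=v^0\in L^2(\Omega)$ and $f\in L^2(0,T;L^2(\Omega))$. We write $L^p(X)=L^p(0,T;X)$, where $L^2$, $H^1_0$ as $X$ stand for $L^2(\Omega)$, $H^1_0(\Omega)$. Let $\mathcal T_H$ be a conforming, shape-regular, quasi-uniform axis-parallel rectangular mesh of $\Omega$ with mesh size $H$, and let $\mathcal T_h$ be a conforming shape-regular rectangular refinement of it such that $a_\epsilon$ is constant (a.e.) on each element of $\mathcal T_h$. Let $V_H$, $V_h$ be the spaces of functions in $H^1_0(\Omega)$ that are polynomials of coordinate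 degree at most one on each element of $\mathcal T_H$, respectively $\mathcal T_h$. For $K\in\mathcal T_H$ let $U_0(K)=K$ and let $U_m(K)$ be the union of all $K'\in\mathcal T_H$ that intersect $U_{m-1}(K)$. Let $I_H:H^1_0(\Omega)\to V_H$ be linear with $I_H\circ I_H=I_H$, let $W_h=\{w\in V_h: I_Hw=0\}$, and let $W_h(U)$ be the set of those $w\in W_h$ that vanish in $\Omega\setminus U$. For $v_H\in V_H$ let $\mathcal C_{h,m}(v_H)=\sum_{K\in\mathcal T_H}\mathcal C_{h,m}^K(v_H)$, where $\mathcal C_{h,m}^K(v_H)\in W_h(U_m(K))$ solves $$\int_{U_m(K)}a_\epsilon\nabla\mathcal C_{h,m}^K(v_H)\cdot\nabla w=-\int_Ka_\epsilon\nabla v_H\cdot\nabla w\qquad\text{for all } w\in W_h(U_m(K)).$$ Let $V_{H,m}^{ms}=(1+\mathcal C_{h,m})V_H$. Let $\pi_h$ and $\pi_{H,m}^{ms}$ be the $b_\epsilon$-orthogonal projections of $H^1_0(\Omega)$ onto $V_h$ and $V_{H,m}^{ms}$, and let $P_{H,m}^{ms}$ be the $L^2(\Omega)$-orthogonal projection onto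 $V_{H,m}^{ms}$. The semi-discrete approximation is $u_{H,m}^{ms}=(1+\mathcal C_{h,m})u_{H,m}$, where $u_{H,m}\in H^2(0,T;V_H)$ satisfies, for a.e. $t\in(0,T)$ and all $v_H\in V_H$, $$\bigl((1+\mathcal C_{h,m})\partial_{tt}u_{H,m},(1+\mathcal C_{h,m})v_H\bigr)_{L^2(\Omega)}+b_\epsilon\bigl(u_{H,m}^{ms},(1+\mathcal C_{h,m})v_H\bigr)=\bigl(f,(1+\mathcal C_{h,m})v_H\bigr)_{L^2(\Omega)},$$ with $u_{H,m}^{ms}(0)=\pi_{H,m}^{ms}u^0$ and $\partial_tu_{H,m}^{ms}(0)=v^0_{H,m}$. Assume that, with constants $C_I$ and $C_P$, $$\|\sqrt{a_\epsilon}\nabla I_Hv\|_{L^2(K)}\le C_I\|\sqrt{a_\epsilon}\nabla v\|_{L^2(U_1(K))},\qquad \|\sqrt{a_\epsilon}w\|_{L^2(K)}\le C_IH\|\sqrt{a_\epsilon}\nabla w\|_{L^2(U_1(K))},\qquad \|v\|_{L^2(\Omega)}\le C_P\|\sqrt{a_\epsilon}\nabla v\|_{L^2(\Omega)}$$ for all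 $v\in H^1_0(\Omega)$, $w\in W_h$ and $K\in\mathcal T_H$. **Theorem.** There are $\gamma\in(0,1)$, depending only on $\Omega$ (and $d$), the mesh regularity constants, $C_I$ and $C_P$, and $C>0$, depending only on these and on $T$ (so neither depends on $a_0$, $\Omega_\epsilon$, $\mathcal T_H$, $\mathcal T_h$, $H$, $h$, $m$ or the data and the solution), such that for all $m\ge1$ the following holds. (a) If $\partial_t^3u_\epsilon,\partial_tf\in L^\infty(L^2)$, $\partial_t^4u_\epsilon,\partial_{tt}f\in L^1(L^2)$, $\partial_tu_\epsilon\in L^\infty(H^1_0)$, $\partial_{tt}u_\epsilon\in L^1(H^1_0)$, and $v^0_{H,m}=\pi_{H,m}^{ms}v^0$, then $$\begin{aligned}&\|\partial_tu_\epsilon-\partial_tu_{H,m}^{ms}\|_{L^\infty(L^2)}+\|\sqrt{a_\epsilon}\nabla(u_\epsilon-u_{H,m}^{ms})\|_{L^\infty(L^2)}\\&\le C\Bigl[(H+m^{d/2}\gamma^m)\Bigl(\sum_{i=0}^1\|a_\epsilon^{-1/2}(\partial_t^{i+2}u_\epsilon-\partial_t^if)\|_{L^\infty(L^2)}+\|a_\epsilon^{-1/2}(\partial_t^4u_\epsilon-\partial_{tt}f)\|_{L^1(L^2)}\\&\qquad+\sum_{i=0}^1\|\sqrt{a_\epsilon}\nabla\partial_t^iu_\epsilon\|_{L^\infty(L^2)}+\|\sqrt{a_\epsilon}\nabla\partial_{tt}u_\epsilon\|_{L^1(L^2)}\Bigr)+e^1_{\rm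 disc}(h)\Bigr],\end{aligned}$$ where $e^1_{\rm disc}(h)=\|(1-\pi_h)\partial_tu_\epsilon\|_{L^\infty(L^2)}+\|\sqrt{a_\epsilon}\nabla(1-\pi_h)u_\epsilon\|_{L^\infty(L^2)}+\|(1-\pi_h)\partial_{tt}u_\epsilon\|_{L^\infty(L^2)}$. (b) If $\partial_{tt}u_\epsilon\in L^\infty(L^2)$, $\partial_t^3u_\epsilon,\partial_tf\in L^1(L^2)$, $\partial_tu_\epsilon\in L^1(H^1_0)$, and $v^0_{H,m}=P_{H,m}^{ms}v^0$, then $$\begin{aligned}\|u_\epsilon-u_{H,m}^{ms}\|_{L^\infty(L^2)}\le C\Bigl[&(H+m^{d/2}\gamma^m)\bigl(\|a_\epsilon^{-1/2}(\partial_{tt}u_\epsilon-f)\|_{L^\infty(L^2)}+\|a_\epsilon^{-1/2}(\partial_t^3u_\epsilon-\partial_tf)\|_{L^1(L^2)}\\&+\|\sqrt{a_\epsilon}\nabla u_\epsilon\|_{L^\infty(L^2)}+\|\sqrt{a_\epsilon}\nabla\partial_tu_\epsilon\|_{L^1(L^2)}\bigr)+e^2_{\rm disc}(h)\Bigr],\end{aligned}$$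 where $e^2_{\rm disc}(h)=\|(1-\pi_h)u_\epsilon\|_{L^\infty(L^2)}+\|(1-\pi_h)\partial_tu_\epsilon\|_{L^1(L^2)}$. -/

import Mathlib

open MeasureTheory Set
open scoped ENNReal ContDiff

noncomputable section

namespace WaveLOD

/-! ### Function spaces on the spatial domain -/

/-- The Euclidean space `ℝ^d`. -/
abbrev E (d : ℕ) := EuclideanSpace ℝ (Fin d)

/-- `L²(Ω)`. -/
abbrev L2 {d : ℕ} (Ω : Set (E d)) := Lp ℝ 2 (volume.restrict Ω)

/-- `L²(Ω; ℝ^d)`. -/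
abbrev L2Vec {d : ℕ} (Ω : Set (E d)) := Lp (E d) 2 (volume.restrict Ω)

/-- The pairs `(φ, ∇φ)` for test functions `φ ∈ C_c^∞(Ω)`, as elements of `L²(Ω) × L²(Ω; ℝ^d)`. -/
def testPairs {d : ℕ} (Ω : Set (E d)) : Set (WithLp 2 (L2 Ω × L2Vec Ω)) :=
  {p | ∃ φ : E d → ℝ, ContDiff ℝ ∞ φ ∧ HasCompactSupport φ ∧ tsupport φ ⊆ Ω ∧
    (p.fst =ᵐ[volume.restrict Ω] φ) ∧ (p.snd =ᵐ[volume.restrict Ω] gradient φ)}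

/-- The closure of `C_c^∞(Ω)` in the `H¹`-norm, as a space of pairs `(v, ∇v)`. -/
def h10Submodule {d : ℕ} (Ω : Set (E d)) : Submodule ℝ (WithLp 2 (L2 Ω × L2Vec Ω)) :=
  (Submodule.span ℝ (testPairs Ω)).topologicalClosure

/-- `H¹₀(Ω)`: the closure of `C_c^∞(Ω)` in the `H¹`-norm. An element is stored together with its
weak gradient, as a pair `(v, ∇v)`; the norm is `(‖v‖² + ‖∇v‖²)^{1/2}`. -/
def H10 {d : ℕ} (Ω : Set (E d)) : Type := h10Submodule Ω

instance {d : ℕ} (Ω : Set (E d)) : NormedAddCommGroup (H10 Ω) :=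
  inferInstanceAs (NormedAddCommGroup (h10Submodule Ω))

instance {d : ℕ} (Ω : Set (E d)) : InnerProductSpace ℝ (H10 Ω) :=
  inferInstanceAs (InnerProductSpace ℝ (h10Submodule Ω))

instance {d : ℕ} (Ω : Set (E d)) : CompleteSpace (H10 Ω) :=
  (Submodule.isClosed_topologicalClosure _).completeSpace_coe

/-- The embedding `H¹₀(Ω) → L²(Ω)`. -/
def val {d : ℕ} {Ω : Set (E d)} : H10 Ω →L[ℝ] L2 Ω :=
  (WithLp.fstL 2 ℝ (L2 Ω) (L2Vec Ω)).comp (h10Submodule Ω).subtypeL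

/-- The weak gradient `H¹₀(Ω) → L²(Ω; ℝ^d)`. -/
def grad {d : ℕ} {Ω : Set (E d)} : H10 Ω →L[ℝ] L2Vec Ω :=
  (WithLp.sndL 2 ℝ (L2 Ω) (L2Vec Ω)).comp (h10Submodule Ω).subtypeL

/-- `H⁻¹(Ω)`, the dual of `H¹₀(Ω)`. -/
abbrev Hneg1 {d : ℕ} (Ω : Set (E d)) := StrongDual ℝ (H10 Ω)

/-- The embedding `L²(Ω) → H⁻¹(Ω)`, `g ↦ (g, ·)`. -/
def toHneg1 {d : ℕ} {Ω : Set (E d)} (g : L2 Ω) : Hneg1 Ω := (innerSL ℝ g).comp val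

/-- The weighted norm `‖√w g‖_{L²(S ∩ Ω)}`. -/
def wnorm {d : ℕ} {Ω : Set (E d)} {F : Type*} [NormedAddCommGroup F] (w : E d → ℝ) (S : Set (E d))
    (g : Lp F 2 (volume.restrict Ω)) : ℝ :=
  √(∫ x in S, w x * ‖g x‖ ^ 2 ∂(volume.restrict Ω))

/-- The form `∫_{S ∩ Ω} a ∇v · ∇w`. -/
def formOn {d : ℕ} {Ω : Set (E d)} (a : E d → ℝ) (S : Set (E d)) (v w : H10 Ω) : ℝ :=
  ∫ x in S, a x * inner ℝ (grad v x) (grad w x) ∂(volume.restrict Ω)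

/-- `Ω` has a Lipschitz boundary: near every boundary point, and for a suitable direction `e`, it is
the set of points above the graph of a Lipschitz function of the variables orthogonal to `e`. -/
def HasLipschitzBoundary {d : ℕ} (Ω : Set (E d)) : Prop :=
  ∀ x ∈ frontier Ω, ∃ (e : E d) (r : ℝ) (L : NNReal) (g : E d → ℝ), ‖e‖ = 1 ∧ 0 < r ∧
    LipschitzWith L g ∧ (∀ (y : E d) (s : ℝ), g (y + s • e) = g y) ∧
    ∀ y ∈ Metric.ball x r, (y ∈ Ω ↔ g y < inner ℝ e y)

/-! ### Time-dependent functions -/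

/-- Lebesgue measure on the time interval `(0, T)`. -/
def timeMeasure (T : ℝ) : Measure ℝ := volume.restrict (Ioo 0 T)

/-- `w` is the weak time derivative of `v` on `(0, T)`, for Bochner integrable `v` and `w`. -/
def IsWeakTimeDeriv {X : Type*} [NormedAddCommGroup X] [NormedSpace ℝ X] (T : ℝ) (v w : ℝ → X) :
    Prop :=
  Integrable v (timeMeasure T) ∧ Integrable w (timeMeasure T) ∧
    ∀ φ : ℝ → ℝ, ContDiff ℝ ∞ φ → HasCompactSupport φ → tsupport φ ⊆ Ioo 0 T →
      ∫ t, deriv φ t • v t ∂(timeMeasure T) = -∫ t, φ t • w t ∂(timeMeasure T)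

/-- `v(0) = v₀`, in the sense of the continuous representative of `v` on `[0, T]`. -/
def HasInitialValue {X : Type*} [NormedAddCommGroup X] (T : ℝ) (v : ℝ → X) (v₀ : X) : Prop :=
  ∃ v' : ℝ → X, ContinuousOn v' (Icc 0 T) ∧ v' =ᵐ[timeMeasure T] v ∧ v' 0 = v₀

/-- `u` is a weak solution on `(0, T)` of `∂_tt u - ∇ · (a ∇u) = f` with homogeneous Dirichlet
boundary values, `u(0) = u₀` and `∂_t u(0) = v₀`. -/
def IsWeakSolution {d : ℕ} {Ω : Set (E d)} (T : ℝ) (a : E d → ℝ) (f : ℝ → L2 Ω) (u₀ : H10 Ω)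
    (v₀ : L2 Ω) (u : ℝ → H10 Ω) : Prop :=
  MemLp u 2 (timeMeasure T) ∧
  ∃ (u' : ℝ → L2 Ω) (u'' : ℝ → Hneg1 Ω),
    MemLp u' 2 (timeMeasure T) ∧ IsWeakTimeDeriv T (fun t => val (u t)) u' ∧
    MemLp u'' 2 (timeMeasure T) ∧ IsWeakTimeDeriv T (fun t => toHneg1 (u' t)) u'' ∧
    (∀ᵐ t ∂(timeMeasure T), ∀ v : H10 Ω,
      u'' t v + formOn a univ (u t) v = inner ℝ (f t) (val v)) ∧
    HasInitialValue T (fun t => val (u t)) (val u₀) ∧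
    HasInitialValue T (fun t => toHneg1 (u' t)) (toHneg1 v₀)

/-! ### Rectangular meshes and finite element spaces -/

/-- A nondegenerate axis-parallel rectangle (box). -/
structure Rect (d : ℕ) where
  /-- lower corner -/
  lo : Fin d → ℝ
  /-- upper corner -/
  hi : Fin d → ℝ
  lt : ∀ i, lo i < hi i

/-- The closed rectangle as a set. -/
def Rect.toSet {d : ℕ} (K : Rect d) : Set (E d) := {x | ∀ i, K.lo i ≤ x i ∧ x i ≤ K.hi i}

/-- `F` is a closed face of `K`, of any dimension (vertex, edge, ..., `K` itself). -/
def Rect.IsFace {d : ℕ} (K : Rect d) (F : Set (E d)) : Prop :=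
  ∃ l u : Fin d → ℝ, F = {x | ∀ i, l i ≤ x i ∧ x i ≤ u i} ∧
    ∀ i, (l i = K.lo i ∧ u i = K.hi i) ∨ (l i = K.lo i ∧ u i = K.lo i) ∨
      (l i = K.hi i ∧ u i = K.hi i)

/-- A finite conforming rectangular mesh of `Ω`: two elements are disjoint, or meet in a common
face. -/
structure RectMesh {d : ℕ} (Ω : Set (E d)) where
  /-- the elements -/
  cells : Finset (Rect d)
  cover : ⋃ K ∈ cells, K.toSet = closure Ω
  interior_subset : ∀ K ∈ cells, interior K.toSet ⊆ Ω
  conforming : ∀ K ∈ cells, ∀ K' ∈ cells, K ≠ K' → (K.toSet ∩ K'.toSet).Nonempty →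
    K.IsFace (K.toSet ∩ K'.toSet) ∧ K'.IsFace (K.toSet ∩ K'.toSet)

namespace RectMesh

variable {d : ℕ} {Ω : Set (E d)}

/-- The mesh size, the largest diameter of an element. -/
def size (𝒯 : RectMesh Ω) : ℝ := ⨆ K : {K // K ∈ 𝒯.cells}, Metric.diam K.1.toSet

/-- Shape regularity: the aspect ratio of the elements is at most `σ`. -/
def ShapeRegular (𝒯 : RectMesh Ω) (σ : ℝ) : Prop :=
  ∀ K ∈ 𝒯.cells, ∀ i j, K.hi i - K.lo i ≤ σ * (K.hi j - K.lo j)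

/-- Quasi-uniformity: all elements have comparable diameters. -/
def QuasiUniform (𝒯 : RectMesh Ω) (σ : ℝ) : Prop :=
  ∀ K ∈ 𝒯.cells, ∀ K' ∈ 𝒯.cells, Metric.diam K.toSet ≤ σ * Metric.diam K'.toSet

/-- The element patches `U_m(K)`. -/
def patch (𝒯 : RectMesh Ω) (K : Rect d) : ℕ → Set (E d)
  | 0 => K.toSet
  | m + 1 => {x | ∃ K' ∈ 𝒯.cells, (K'.toSet ∩ patch 𝒯 K m).Nonempty ∧ x ∈ K'.toSet}

/-- The space `Q₁(𝒯)` of functions that are, on every element, a polynomial of degree at most one in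
each coordinate. -/
def Q1 (𝒯 : RectMesh Ω) : Submodule ℝ (L2 Ω) where
  carrier := {g | ∀ K ∈ 𝒯.cells, ∃ p ∈ MvPolynomial.restrictDegree (Fin d) ℝ 1,
    ∀ᵐ x ∂(volume.restrict Ω), x ∈ K.toSet → g x = MvPolynomial.eval x p}
  zero_mem' := fun K _ => ⟨0, Submodule.zero_mem _, by
    filter_upwards [Lp.coeFn_zero ℝ 2 (volume.restrict Ω)] with x hx _
    rw [hx, map_zero, Pi.zero_apply]⟩
  add_mem' := fun {v w} hv hw K hK => by
    obtain ⟨p, hp, hvp⟩ := hv K hK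
    obtain ⟨q, hq, hwq⟩ := hw K hK
    refine ⟨p + q, Submodule.add_mem _ hp hq, ?_⟩
    filter_upwards [hvp, hwq, Lp.coeFn_add v w] with x h₁ h₂ h₃ hx
    rw [h₃, map_add, Pi.add_apply, h₁ hx, h₂ hx]
  smul_mem' := fun c v hv K hK => by
    obtain ⟨p, hp, hvp⟩ := hv K hK
    refine ⟨c • p, Submodule.smul_mem _ c hp, ?_⟩
    filter_upwards [hvp, Lp.coeFn_smul c v] with x h₁ h₃ hx
    rw [h₃, MvPolynomial.smul_eval, Pi.smul_apply, h₁ hx, smul_eq_mul]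

/-- The finite element space `Q₁(𝒯) ∩ H¹₀(Ω)`. -/
def V (𝒯 : RectMesh Ω) : Submodule ℝ (H10 Ω) := 𝒯.Q1.comap val.toLinearMap

end RectMesh

/-! ### The Localized Orthogonal Decomposition -/

/-- The Galerkin solution in `S`: the `z ∈ S` with `B(z, w) = ℓ(w)` for all `w ∈ S` (it is unique
for all the forms and spaces below; the value is `0` if there is none). -/
def galerkin {X : Type*} [Zero X] (B : X → X → ℝ) (S : Set X) (ℓ : X → ℝ) : X :=
  open Classical in
  if h : ∃ z ∈ S, ∀ w ∈ S, B z w = ℓ w then h.choose else 0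

/-- The two-valued coefficient `a_ε`, equal to `a₀` in `Ω_ε` and to `1` elsewhere. -/
def coefficient {d : ℕ} (a₀ : ℝ) (Ωε : Set (E d)) (x : E d) : ℝ :=
  open Classical in
  if x ∈ Ωε then a₀ else 1

/-- The data of the multiscale method on `Ω`: the coefficient, the coarse mesh `𝒯_H`, the fine
mesh `𝒯_h`, and the interpolation operator `I_H`. -/
structure LOD {d : ℕ} (Ω : Set (E d)) where
  /-- the value of the coefficient in `Ω_ε` -/
  a₀ : ℝ
  a₀_pos : 0 < a₀
  /-- the set `Ω_ε` -/
  Ωε : Set (E d)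
  Ωε_subset : Ωε ⊆ Ω
  measurable_Ωε : MeasurableSet Ωε
  /-- the coarse mesh `𝒯_H` -/
  coarse : RectMesh Ω
  /-- the fine mesh `𝒯_h` -/
  fine : RectMesh Ω
  refines : ∀ k ∈ fine.cells, ∃ K ∈ coarse.cells, k.toSet ⊆ K.toSet
  /-- the fine mesh resolves the variations of the coefficient -/
  resolves : ∀ k ∈ fine.cells, ∃ c : ℝ,
    ∀ᵐ x ∂(volume.restrict Ω), x ∈ k.toSet → coefficient a₀ Ωε x = c
  /-- the interpolation operator `I_H` -/
  interp : H10 Ω →ₗ[ℝ] coarse.V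
  interp_interp : ∀ v, interp (interp v : H10 Ω) = interp v

namespace LOD

variable {d : ℕ} {Ω : Set (E d)} (D : LOD Ω)

/-- The coefficient `a_ε`. -/
def a : E d → ℝ := coefficient D.a₀ D.Ωε

/-- The inverse coefficient `a_ε⁻¹`. -/
def aInv (x : E d) : ℝ := (D.a x)⁻¹

/-- The coarse mesh size `H`. -/
def H : ℝ := D.coarse.size

/-- `b_ε(v, w) = ∫_Ω a_ε ∇v · ∇w`. -/
def b (v w : H10 Ω) : ℝ := formOn D.a univ v w

/-- The energy norm `‖√a_ε ∇v‖_{L²(Ω)}`. -/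
def energyNorm (v : H10 Ω) : ℝ := wnorm D.a univ (grad v)

/-- The norm `‖a_ε^{-1/2} g‖_{L²(Ω)}`. -/
def invNorm (g : L2 Ω) : ℝ := wnorm D.aInv univ g

/-- The kernel `W_h` of `I_H` in the fine space `V_h`. -/
def W : Submodule ℝ (H10 Ω) := D.fine.V ⊓ LinearMap.ker D.interp

/-- `W_h(U)`, the functions of `W_h` that vanish in `Ω ∖ U`. -/
def WOn (U : Set (E d)) : Set (H10 Ω) :=
  {w | w ∈ D.W ∧ ∀ᵐ x ∂(volume.restrict Ω), x ∉ U → val w x = 0}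

/-- The localized element corrector `𝒞_{h,m}^K`. -/
def cellCorrector (m : ℕ) (K : Rect d) (v : H10 Ω) : H10 Ω :=
  galerkin (formOn D.a (D.coarse.patch K m)) (D.WOn (D.coarse.patch K m))
    (fun w => -formOn D.a K.toSet v w)

/-- The localized corrector `𝒞_{h,m}`. -/
def corrector (m : ℕ) (v : H10 Ω) : H10 Ω := ∑ K ∈ D.coarse.cells, D.cellCorrector m K v

/-- `v ↦ v + 𝒞_{h,m}(v)`. -/
def ms (m : ℕ) (v : H10 Ω) : H10 Ω := v + D.corrector m v

/-- The multiscale space `V_{H,m}^{ms}`. -/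
def Vms (m : ℕ) : Set (H10 Ω) := D.ms m '' (D.coarse.V : Set (H10 Ω))

/-- The elliptic (Ritz) projection `π_h` onto `V_h`. -/
def ritzFine (v : H10 Ω) : H10 Ω := galerkin D.b D.fine.V (D.b v)

/-- The elliptic projection `π_{H,m}^{ms}` onto `V_{H,m}^{ms}`. -/
def ritzMs (m : ℕ) (v : H10 Ω) : H10 Ω := galerkin D.b (D.Vms m) (D.b v)

/-- The `L²`-projection `P_{H,m}^{ms}` onto `V_{H,m}^{ms}`. -/
def l2Ms (m : ℕ) (g : L2 Ω) : H10 Ω :=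
  galerkin (fun z w : H10 Ω => inner ℝ (val z) (val w)) (D.Vms m) (fun w => inner ℝ g (val w))

/-- The weighted stability and approximation properties of `I_H`, with constant `C_I`. -/
def InterpStable (CI : ℝ) : Prop :=
  (∀ K ∈ D.coarse.cells, ∀ v : H10 Ω,
    wnorm D.a K.toSet (grad (D.interp v : H10 Ω)) ≤
      CI * wnorm D.a (D.coarse.patch K 1) (grad v)) ∧
  (∀ K ∈ D.coarse.cells, ∀ w ∈ D.W,
    wnorm D.a K.toSet (val w) ≤ CI * D.H * wnorm D.a (D.coarse.patch K 1) (grad w))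

/-- The weighted Poincaré inequality with constant `C_P`. -/
def WeightedPoincare (CP : ℝ) : Prop := ∀ v : H10 Ω, ‖val v‖ ≤ CP * D.energyNorm v

/-- `uH ∈ H²(0, T; V_H)` is the semi-discrete approximation with initial velocity `v0H`. -/
def IsSemidiscrete (T : ℝ) (m : ℕ) (f : ℝ → L2 Ω) (u₀ : H10 Ω) (v0H : H10 Ω)
    (uH : ℝ → H10 Ω) : Prop :=
  ∃ uH' uH'' : ℝ → H10 Ω,
    (∀ᵐ t ∂(timeMeasure T), uH t ∈ D.coarse.V ∧ uH' t ∈ D.coarse.V ∧ uH'' t ∈ D.coarse.V) ∧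
    MemLp uH 2 (timeMeasure T) ∧ MemLp uH' 2 (timeMeasure T) ∧ MemLp uH'' 2 (timeMeasure T) ∧
    IsWeakTimeDeriv T uH uH' ∧ IsWeakTimeDeriv T uH' uH'' ∧
    (∀ᵐ t ∂(timeMeasure T), ∀ vH ∈ D.coarse.V,
      inner ℝ (val (D.ms m (uH'' t))) (val (D.ms m vH)) + D.b (D.ms m (uH t)) (D.ms m vH) =
        inner ℝ (f t) (val (D.ms m vH))) ∧
    HasInitialValue T (fun t => D.ms m (uH t)) (D.ritzMs m u₀) ∧
    ∃ p : ℝ → H10 Ω, IsWeakTimeDeriv T (fun t => D.ms m (uH t)) p ∧ HasInitialValue T p v0H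

end LOD

/-- The Bochner norm `‖v‖_{L^p(0, T; X)}`, with values in `[0, ∞]`. -/
def bochnerNorm {X : Type*} [NormedAddCommGroup X] (T : ℝ) (p : ℝ≥0∞) (v : ℝ → X) : ℝ≥0∞ :=
  eLpNorm v p (timeMeasure T)

end WaveLOD

end

open WaveLOD

/-! The error is split through elliptic projections as (u - π_h u) + (π_h u - π_ms u) + (π_ms u -
u_ms). The first term is the fine-scale discretization error and is kept as it stands.

The second term is elliptic. At almost every time b(u, ·) = (f - ∂_tt u, ·), and this identity may
be differentiated in time (`formL_eq_of_deriv`). Put z = π_h u and v_H = I_H z, and let C be the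
corrector without localization. Then (1 + C)v_H is b-orthogonal to W_h, and w₀ = z - (1 + C)v_H lies
in W_h, so that b(w₀, w₀) = (f - ∂_tt u, w₀). The weighted approximation property of I_H on W_h
turns this into a factor H. Passing to the localized corrector costs an error that decays
exponentially in m, by Céa's lemma (`energyNorm_ritz_sub_le`).

The decay comes from hole filling. An element corrector is b-orthogonal to the functions of W_h that
vanish on its element; testing with a cut-off of the corrector itself bounds its energy outside a
patch by its energy in an annulus (`tail_le_annulus`). The cut-off has to stay in W_h: fine nodal
values are multiplied by a cutoff function, and then I_H is subtracted (`exists_cut`). Since the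
coefficient is constant on fine cells and every inequality used is weighted, the contrast does not
enter the constants. All this needs nodal values for V_h, whose elements are a priori only L²
classes in H¹₀; that vertex values are single valued, and zero off Ω, is `node_values`, and
`exists_nodal_mul` builds on it. The overlap of patches costs a power of m, which is absorbed into
the rate γ (`exists_rate`); of the factor m^(d/2) in the bound, only that it is at least one is
used.

The third term θ = π_ms u - u_ms stays in the multiscale space and starts from zero. In (a) its
velocity starts from zero too, and the energy method applies with source π_ms ∂_tt u - ∂_tt u. In
(b) the error equation is first integrated in time; the L²-projection removes the initial velocity,
and the source is only π_ms ∂_t u - ∂_t u. Both cases are instances of `energy_estimate`. By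
Poincaré's inequality the elliptic bound also controls these sources. -/

noncomputable section

namespace WaveLOD

/-! ### Weighted bilinear forms -/

section Weighted

set_option linter.unusedSectionVars false

variable {d : ℕ} {Ω : Set (E d)} {F : Type*} [NormedAddCommGroup F] [InnerProductSpace ℝ F]

/-- A bounded, nonnegative, measurable weight. -/
structure IsWeight (a : E d → ℝ) : Prop where
  measurable : Measurable a
  nonneg : ∀ x, 0 ≤ a x
  bdd : ∃ M, ∀ x, a x ≤ M

/-- The form `∫_{S ∩ Ω} a f · g`. -/
def wform (a : E d → ℝ) (S : Set (E d)) (f g : Lp F 2 (volume.restrict Ω)) : ℝ :=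
  ∫ x in S, a x * inner ℝ (f x) (g x) ∂(volume.restrict Ω)

theorem IsWeight.integrable {a : E d → ℝ} (ha : IsWeight a) (f g : Lp F 2 (volume.restrict Ω)) :
    Integrable (fun x => a x * inner ℝ (f x) (g x)) (volume.restrict Ω) := by
  obtain ⟨M, hM⟩ := ha.bdd
  refine (L2.integrable_inner (𝕜 := ℝ) f g).bdd_mul (c := M) ha.measurable.aestronglyMeasurable ?_
  exact Filter.Eventually.of_forall fun x => by
    rw [Real.norm_eq_abs, abs_of_nonneg (ha.nonneg x)]; exact hM x

theorem wform_symm (a : E d → ℝ) (S : Set (E d)) (f g : Lp F 2 (volume.restrict Ω)) :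
    wform a S f g = wform a S g f := by
  simp only [wform, real_inner_comm]

/-- `wform` as a bilinear form. -/
def IsWeight.bilin {a : E d → ℝ} (ha : IsWeight a) (S : Set (E d)) :
    LinearMap.BilinForm ℝ (Lp F 2 (volume.restrict Ω)) :=
  LinearMap.mk₂ ℝ (wform a S)
    (fun f f' g => by
      rw [wform, wform, wform, ← integral_add (ha.integrable f g).restrict
        (ha.integrable f' g).restrict]
      refine integral_congr_ae (ae_restrict_of_ae ?_)
      filter_upwards [Lp.coeFn_add f f'] with x hx
      rw [hx, Pi.add_apply, inner_add_left, mul_add])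
    (fun c f g => by
      rw [wform, wform, smul_eq_mul, ← integral_const_mul]
      refine integral_congr_ae (ae_restrict_of_ae ?_)
      filter_upwards [Lp.coeFn_smul c f] with x hx
      rw [hx, Pi.smul_apply, real_inner_smul_left]; ring)
    (fun f g g' => by
      rw [wform, wform, wform, ← integral_add (ha.integrable f g).restrict
        (ha.integrable f g').restrict]
      refine integral_congr_ae (ae_restrict_of_ae ?_)
      filter_upwards [Lp.coeFn_add g g'] with x hx
      rw [hx, Pi.add_apply, inner_add_right, mul_add])
    (fun c f g => by
      rw [wform, wform, smul_eq_mul, ← integral_const_mul]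
      refine integral_congr_ae (ae_restrict_of_ae ?_)
      filter_upwards [Lp.coeFn_smul c g] with x hx
      rw [hx, Pi.smul_apply, real_inner_smul_right]; ring)

@[simp]
theorem IsWeight.bilin_apply {a : E d → ℝ} (ha : IsWeight a) (S : Set (E d))
    (f g : Lp F 2 (volume.restrict Ω)) : ha.bilin S f g = wform a S f g := rfl

theorem IsWeight.wform_self_nonneg {a : E d → ℝ} (ha : IsWeight a) (S : Set (E d))
    (f : Lp F 2 (volume.restrict Ω)) : 0 ≤ wform a S f f :=
  integral_nonneg fun x => mul_nonneg (ha.nonneg x) real_inner_self_nonneg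

theorem wnorm_eq_sqrt (a : E d → ℝ) (S : Set (E d)) (f : Lp F 2 (volume.restrict Ω)) :
    wnorm a S f = √(wform a S f f) := by
  simp only [wnorm, wform, real_inner_self_eq_norm_sq]

theorem IsWeight.wnorm_sq {a : E d → ℝ} (ha : IsWeight a) (S : Set (E d))
    (f : Lp F 2 (volume.restrict Ω)) : wnorm a S f ^ 2 = wform a S f f := by
  rw [wnorm_eq_sqrt, Real.sq_sqrt (ha.wform_self_nonneg S f)]

theorem wnorm_nonneg (a : E d → ℝ) (S : Set (E d)) (f : Lp F 2 (volume.restrict Ω)) :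
    0 ≤ wnorm a S f := Real.sqrt_nonneg _

/-- Nonnegative symmetric bilinear forms satisfy the weighted Young inequality. -/
theorem young_of_nonneg {X : Type*} [AddCommGroup X] [Module ℝ X] (B : LinearMap.BilinForm ℝ X)
    (hs : ∀ x y, B x y = B y x) (hp : ∀ x, 0 ≤ B x x) {δ : ℝ} (hδ : 0 < δ) (x y : X) :
    2 * |B x y| ≤ δ⁻¹ * B x x + δ * B y y := by
  have h1 := hp (x + δ • y)
  have h2 := hp (x - δ • y)
  simp only [map_add, map_sub, map_smul, LinearMap.add_apply, LinearMap.sub_apply,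
    LinearMap.smul_apply, smul_eq_mul, hs y x] at h1 h2
  have e : δ⁻¹ * B x x + δ * B y y = δ⁻¹ * (B x x + δ * (δ * B y y)) := by field_simp
  rw [e, inv_mul_eq_div, le_div_iff₀ hδ]
  rcases abs_cases (B x y) with ⟨h, _⟩ | ⟨h, _⟩ <;> rw [h] <;> nlinarith

theorem two_mul_of_nonneg {X : Type*} [AddCommGroup X] [Module ℝ X] (B : LinearMap.BilinForm ℝ X)
    (hs : ∀ x y, B x y = B y x) (hp : ∀ x, 0 ≤ B x x) (x y : X) :
    B (x + y) (x + y) ≤ 2 * B x x + 2 * B y y := by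
  have h1 := hp (x - y)
  simp only [map_add, map_sub, LinearMap.add_apply, LinearMap.sub_apply, hs y x] at h1 ⊢
  linarith

theorem abs_le_sqrt_of_nonneg {X : Type*} [AddCommGroup X] [Module ℝ X]
    (B : LinearMap.BilinForm ℝ X) (hs : ∀ x y, B x y = B y x) (hp : ∀ x, 0 ≤ B x x) (x y : X) :
    |B x y| ≤ √(B x x) * √(B y y) := by
  rw [← Real.sqrt_mul (hp x)]
  refine Real.le_sqrt_of_sq_le ?_
  rw [sq_abs, sq]
  have := LinearMap.BilinForm.apply_mul_apply_le_of_forall_zero_le B hp x y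
  rwa [hs y x] at this

theorem sqrt_add_le_of_nonneg {X : Type*} [AddCommGroup X] [Module ℝ X]
    (B : LinearMap.BilinForm ℝ X) (hs : ∀ x y, B x y = B y x) (hp : ∀ x, 0 ≤ B x x) (x y : X) :
    √(B (x + y) (x + y)) ≤ √(B x x) + √(B y y) := by
  refine Real.sqrt_le_iff.2 ⟨by positivity, ?_⟩
  have h := (abs_le.1 (abs_le_sqrt_of_nonneg B hs hp x y)).2
  have h1 := Real.sq_sqrt (hp x)
  have h2 := Real.sq_sqrt (hp y)
  simp only [map_add, LinearMap.add_apply, hs y x]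
  nlinarith

theorem IsWeight.wform_le {a : E d → ℝ} (ha : IsWeight a) {M : ℝ} (hM : ∀ x, a x ≤ M)
    (f : Lp F 2 (volume.restrict Ω)) : wform a univ f f ≤ M * ‖f‖ ^ 2 := by
  rw [← real_inner_self_eq_norm_sq, L2.inner_def, ← integral_const_mul, wform,
    Measure.restrict_univ]
  refine integral_mono (ha.integrable f f) ((L2.integrable_inner (𝕜 := ℝ) f f).const_mul M) ?_
  exact fun x => mul_le_mul_of_nonneg_right (hM x) real_inner_self_nonneg

theorem IsWeight.le_wform {a : E d → ℝ} (ha : IsWeight a) {c : ℝ} (hc : ∀ x, c ≤ a x)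
    (f : Lp F 2 (volume.restrict Ω)) : c * ‖f‖ ^ 2 ≤ wform a univ f f := by
  rw [← real_inner_self_eq_norm_sq, L2.inner_def, ← integral_const_mul, wform,
    Measure.restrict_univ]
  refine integral_mono ((L2.integrable_inner (𝕜 := ℝ) f f).const_mul c) (ha.integrable f f) ?_
  exact fun x => mul_le_mul_of_nonneg_right (hc x) real_inner_self_nonneg

theorem wform_eq_zero {a : E d → ℝ} {S : Set (E d)}
    {f : Lp F 2 (volume.restrict Ω)} (hf : ∀ᵐ x ∂(volume.restrict Ω), x ∈ S → f x = 0)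
    (g : Lp F 2 (volume.restrict Ω)) : wform a S f g = 0 := by
  refine setIntegral_eq_zero_of_ae_eq_zero ?_
  filter_upwards [hf] with x h1 hx
  rw [h1 hx, inner_zero_left, mul_zero]

theorem IsWeight.ae_eq_zero {a : E d → ℝ} (ha : IsWeight a) (hpos : ∀ x, 0 < a x) {S : Set (E d)}
    (hS : MeasurableSet S) {f : Lp F 2 (volume.restrict Ω)} (hf : wform a S f f = 0) :
    ∀ᵐ x ∂(volume.restrict Ω), x ∈ S → f x = 0 := by
  have h := (setIntegral_eq_zero_iff_of_nonneg_ae (s := S)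
    (Filter.Eventually.of_forall fun x => mul_nonneg (ha.nonneg x) real_inner_self_nonneg)
    (ha.integrable f f).restrict).1 hf
  have h' := (ae_restrict_iff' hS).1 h
  filter_upwards [h'] with x hx hxS
  have := hx hxS
  simpa [(hpos x).ne'] using this

theorem IsWeight.wform_mono {a : E d → ℝ} (ha : IsWeight a) {S T : Set (E d)} (hST : S ⊆ T)
    (f : Lp F 2 (volume.restrict Ω)) : wform a S f f ≤ wform a T f f :=
  setIntegral_mono_set (ha.integrable f f).restrict
    (Filter.Eventually.of_forall fun x => mul_nonneg (ha.nonneg x) real_inner_self_nonneg)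
    hST.eventuallyLE

theorem IsWeight.wform_biUnion {a : E d → ℝ} (ha : IsWeight a) {ι : Type*} (s : Finset ι)
    (S : ι → Set (E d)) (hS : ∀ i ∈ s, MeasurableSet (S i))
    (hd : (s : Set ι).Pairwise fun i j => volume (S i ∩ S j) = 0)
    (f g : Lp F 2 (volume.restrict Ω)) :
    wform a (⋃ i ∈ s, S i) f g = ∑ i ∈ s, wform a (S i) f g := by
  classical
  induction s using Finset.induction_on with
  | empty => simp [wform]
  | insert i s hi ih =>
    rw [Finset.sum_insert hi, ← ih (fun j hj => hS j (Finset.mem_insert_of_mem hj))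
      (hd.mono (by simp)), Finset.set_biUnion_insert]
    refine setIntegral_union₀ ?_ (Finset.measurableSet_biUnion s fun j hj =>
      hS j (Finset.mem_insert_of_mem hj)).nullMeasurableSet
      (ha.integrable f g).integrableOn (ha.integrable f g).integrableOn
    refine le_antisymm ((Measure.restrict_apply_le _ _).trans ?_) bot_le
    rw [inter_iUnion₂]
    refine ((measure_biUnion_null_iff s.countable_toSet).2 fun j hj => ?_).le
    exact hd (by simp) (by simp [Finset.mem_coe.1 hj]) (by rintro rfl; exact hi hj)

theorem wform_of_null {a : E d → ℝ} {S : Set (E d)} (hS : volume S = 0)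
    (f g : Lp F 2 (volume.restrict Ω)) : wform a S f g = 0 := by
  have : (volume.restrict Ω).restrict S = 0 :=
    Measure.restrict_eq_zero.2 (le_antisymm ((Measure.restrict_apply_le _ _).trans hS.le) bot_le)
  rw [wform, this, integral_zero_measure]

/-- Splitting a set along a finite almost disjoint cover. -/
theorem IsWeight.wform_eq_sum_inter {a : E d → ℝ} (ha : IsWeight a) {ι : Type*} (s : Finset ι)
    (S : ι → Set (E d)) (hS : ∀ i ∈ s, MeasurableSet (S i))
    (hd : (s : Set ι).Pairwise fun i j => volume (S i ∩ S j) = 0) {U : Set (E d)}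
    (hU : MeasurableSet U) (hc : U ⊆ ⋃ i ∈ s, S i) (f g : Lp F 2 (volume.restrict Ω)) :
    wform a U f g = ∑ i ∈ s, wform a (U ∩ S i) f g := by
  have : U = ⋃ i ∈ s, U ∩ S i := by
    rw [← inter_iUnion₂]; exact (inter_eq_left.2 hc).symm
  conv_lhs => rw [this]
  refine ha.wform_biUnion s _ (fun i hi => hU.inter (hS i hi)) ?_ f g
  intro i hi j hj hij
  exact measure_mono_null (t := S i ∩ S j) (fun x hx => ⟨hx.1.2, hx.2.2⟩) (hd hi hj hij)

end Weighted

/-! ### The space `H¹₀(Ω)` -/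

section Sobolev

variable {d : ℕ} {Ω : Set (E d)}

theorem setIntegral_eq_integral_of_ae_eq {X : Type*} [MeasurableSpace X] {μ : Measure X}
    {S : Set X} {F G : X → ℝ} (h : F =ᵐ[μ.restrict S] G) (h0 : ∀ x, x ∉ S → G x = 0) :
    ∫ x in S, F x ∂μ = ∫ x, G x ∂μ := by
  rw [← setIntegral_eq_integral_of_forall_compl_eq_zero h0]
  exact integral_congr_ae h

theorem continuous_gradient {φ : E d → ℝ} (hφ : ContDiff ℝ ∞ φ) : Continuous (gradient φ) :=
  (InnerProductSpace.toDual ℝ (E d)).symm.continuous.comp (hφ.continuous_fderiv (by simp))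

theorem inner_gradient {φ : E d → ℝ} (x e : E d) :
    inner ℝ (gradient φ x) e = fderiv ℝ φ x e := by
  rw [gradient, InnerProductSpace.toDual_symm_apply]

theorem hasCompactSupport_gradient {φ : E d → ℝ} (hc : HasCompactSupport φ) :
    HasCompactSupport (gradient φ) :=
  hc.fderiv (𝕜 := ℝ) |>.comp_left (g := (InnerProductSpace.toDual ℝ (E d)).symm) (map_zero _)

/-- The pair `(φ, ∇φ)` of a test function. -/
theorem exists_testPair {φ : E d → ℝ} (hφ : ContDiff ℝ ∞ φ) (hc : HasCompactSupport φ)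
    (hs : tsupport φ ⊆ Ω) : ∃ p ∈ testPairs Ω, (p.fst =ᵐ[volume.restrict Ω] φ) ∧
      (p.snd =ᵐ[volume.restrict Ω] gradient φ) := by
  have h1 : MemLp φ 2 (volume.restrict Ω) :=
    (hφ.continuous.memLp_of_hasCompactSupport hc).restrict Ω
  have h2 : MemLp (gradient φ) 2 (volume.restrict Ω) :=
    ((continuous_gradient hφ).memLp_of_hasCompactSupport (hasCompactSupport_gradient hc)).restrict Ω
  exact ⟨WithLp.toLp 2 (h1.toLp φ, h2.toLp _), ⟨φ, hφ, hc, hs, h1.coeFn_toLp, h2.coeFn_toLp⟩,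
    h1.coeFn_toLp, h2.coeFn_toLp⟩

/-- The test pairs as a submodule. -/
def testSubmodule (Ω : Set (E d)) : Submodule ℝ (WithLp 2 (L2 Ω × L2Vec Ω)) where
  carrier := testPairs Ω
  zero_mem' := by
    refine ⟨0, contDiff_const, HasCompactSupport.zero, by simp [tsupport], ?_, ?_⟩
    · exact Lp.coeFn_zero ℝ 2 (volume.restrict Ω)
    · refine (Lp.coeFn_zero (E d) 2 (volume.restrict Ω)).trans (Filter.Eventually.of_forall ?_)
      intro x
      simp [gradient]
  add_mem' := by
    rintro p q ⟨φ, hφ, hc, hs, h1, h2⟩ ⟨ψ, hψ, hc', hs', h1', h2'⟩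
    refine ⟨φ + ψ, hφ.add hψ, hc.add hc', (tsupport_add φ ψ).trans (union_subset hs hs'), ?_, ?_⟩
    · exact (Lp.coeFn_add p.fst q.fst).trans (h1.add h1')
    · refine (Lp.coeFn_add p.snd q.snd).trans ((h2.add h2').trans (Filter.Eventually.of_forall ?_))
      intro x
      simp only [gradient]
      rw [fderiv_add (hφ.differentiable (by simp) x) (hψ.differentiable (by simp) x), map_add]
      rfl
  smul_mem' := by
    rintro c p ⟨φ, hφ, hc, hs, h1, h2⟩
    refine ⟨c • φ, contDiff_const.smul hφ, hc.smul_left (f := fun _ => c),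
      (tsupport_smul_subset_right (fun _ => c) φ).trans hs, ?_, ?_⟩
    · exact (Lp.coeFn_smul c p.fst).trans (h1.const_smul c)
    · refine (Lp.coeFn_smul c p.snd).trans ((h2.const_smul c).trans (Filter.Eventually.of_forall ?_))
      intro x
      simp only [gradient]
      rw [fderiv_const_smul (hφ.differentiable (by simp) x), map_smul]
      rfl

/-- Test pairs are already closed under linear combinations, so the span in the definition of H¹₀
adds nothing, and density statements may be checked on single test functions. -/
theorem span_testPairs (Ω : Set (E d)) : Submodule.span ℝ (testPairs Ω) = testSubmodule Ω :=
  Submodule.span_eq (testSubmodule Ω)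

/-- Density argument in reusable form: integration by parts and the translation estimate are both
closed conditions on the pair (v, ∇v), hence pass from test functions to H¹₀. -/
theorem h10_closed_property {P : WithLp 2 (L2 Ω × L2Vec Ω) → Prop} (hP : IsClosed {p | P p})
    (h : ∀ p ∈ testPairs Ω, P p) (v : H10 Ω) : P v.1 := by
  have hv : (v.1 : WithLp 2 (L2 Ω × L2Vec Ω)) ∈ closure (testPairs Ω) := by
    have := v.2
    change v.1 ∈ closure ((Submodule.span ℝ (testPairs Ω) : Submodule ℝ _) : Set _) at this
    rwa [span_testPairs] at this
  exact closure_minimal h hP hv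

/-- Weak differentiability of the functions in `H¹₀(Ω)`, extended by zero. -/
theorem integral_val_mul_fderiv (v : H10 Ω) {ψ : E d → ℝ} (hψ : ContDiff ℝ ∞ ψ)
    (hc : HasCompactSupport ψ) (e : E d) :
    ∫ x in Ω, val v x * fderiv ℝ ψ x e = -∫ x in Ω, inner ℝ (grad v x) e * ψ x := by
  have cψ := hψ.continuous
  have cψ' : Continuous (fun x => fderiv ℝ ψ x e) :=
    (hψ.continuous_fderiv (by simp)).clm_apply continuous_const
  have hcψ' : HasCompactSupport (fun x => fderiv ℝ ψ x e) := hc.fderiv_apply (𝕜 := ℝ) e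
  have m1 : MemLp (fun x => fderiv ℝ ψ x e) 2 (volume.restrict Ω) :=
    (cψ'.memLp_of_hasCompactSupport hcψ').restrict Ω
  have m2 : MemLp (fun x => ψ x • e) 2 (volume.restrict Ω) :=
    ((cψ.smul continuous_const).memLp_of_hasCompactSupport (hc.smul_right)).restrict Ω
  -- Both integrals together are the inner product with one fixed pair, which makes the identity a
  -- closed condition on v.
  have key : ∀ v : WithLp 2 (L2 Ω × L2Vec Ω),
      (∫ x in Ω, v.fst x * fderiv ℝ ψ x e) + ∫ x in Ω, inner ℝ (v.snd x) e * ψ x =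
        inner ℝ v (WithLp.toLp 2 (m1.toLp _, m2.toLp _)) := by
    intro v
    rw [WithLp.prod_inner_apply, L2.inner_def, L2.inner_def]
    congr 1
    · refine integral_congr_ae ?_
      filter_upwards [m1.coeFn_toLp] with x hx
      change _ = inner ℝ (v.fst x) (m1.toLp _ x)
      rw [hx]; simp [mul_comm]
    · refine integral_congr_ae ?_
      filter_upwards [m2.coeFn_toLp] with x hx
      change _ = inner ℝ (v.snd x) (m2.toLp _ x)
      rw [hx, real_inner_smul_right, mul_comm]
  rw [eq_neg_iff_add_eq_zero]
  refine (key v.1).trans ?_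
  refine h10_closed_property (P := fun p => inner ℝ p (WithLp.toLp 2 (m1.toLp _, m2.toLp _)) = (0:ℝ))
    (isClosed_eq (by fun_prop) continuous_const) ?_ v
  rintro p ⟨φ, hφ, hcφ, hs, h1, h2⟩
  rw [← key]
  have e1 : ∫ x in Ω, p.fst x * fderiv ℝ ψ x e = ∫ x, φ x * fderiv ℝ ψ x e := by
    refine setIntegral_eq_integral_of_ae_eq ?_ ?_
    · filter_upwards [h1] with x hx
      rw [hx]
    · intro x hx
      rw [image_eq_zero_of_notMem_tsupport fun h => hx (hs h), zero_mul]
  have e2 : ∫ x in Ω, inner ℝ (p.snd x) e * ψ x = ∫ x, fderiv ℝ φ x e * ψ x := by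
    refine setIntegral_eq_integral_of_ae_eq ?_ ?_
    · filter_upwards [h2] with x hx
      rw [hx, inner_gradient]
    · intro x hx
      have : fderiv ℝ φ x = 0 := by
        refine image_eq_zero_of_notMem_tsupport fun h => hx (hs (tsupport_fderiv_subset ℝ h))
      rw [this]; simp
  rw [e1, e2, integral_mul_fderiv_eq_neg_fderiv_mul_of_integrable, neg_add_cancel]
  · have : Continuous fun x => fderiv ℝ φ x e * ψ x :=
      ((hφ.continuous_fderiv (by simp)).clm_apply continuous_const).mul cψ
    exact this.integrable_of_hasCompactSupport hc.mul_left
  · exact (hφ.continuous.mul cψ').integrable_of_hasCompactSupport hcφ.mul_right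
  · exact (hφ.continuous.mul cψ).integrable_of_hasCompactSupport hcφ.mul_right
  · exact fun x _ => hφ.differentiable (by simp) x
  · exact fun x _ => hψ.differentiable (by simp) x

theorem integrable_inner_grad (v : H10 Ω) (e : E d) {ψ : E d → ℝ} (hψ : Continuous ψ)
    (hc : HasCompactSupport ψ) : IntegrableOn (fun x => ψ x * inner ℝ (grad v x) e) Ω := by
  have m2 : MemLp (fun x => ψ x • e) 2 (volume.restrict Ω) :=
    ((hψ.smul continuous_const).memLp_of_hasCompactSupport (hc.smul_right)).restrict Ω
  refine (L2.integrable_inner (𝕜 := ℝ) (grad v) (m2.toLp _)).congr ?_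
  filter_upwards [m2.coeFn_toLp] with x hx
  rw [hx, real_inner_smul_right]

/-- The weak gradient is the classical gradient where the function is smooth. -/
theorem grad_eq_gradient (v : H10 Ω) {U : Set (E d)} (hU : IsOpen U) (hUΩ : U ⊆ Ω) {f : E d → ℝ}
    (hf : ContDiff ℝ ∞ f) (h : ∀ᵐ x ∂(volume.restrict Ω), x ∈ U → val v x = f x) :
    ∀ᵐ x ∂(volume.restrict Ω), x ∈ U → grad v x = gradient f x := by
  have cg := continuous_gradient hf
  have hloc : LocallyIntegrable (grad v) (volume.restrict Ω) :=
    (Lp.memLp (grad v)).locallyIntegrable (by norm_num)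
  have hcoord : ∀ i : Fin d, ∀ᵐ x ∂(volume.restrict Ω), x ∈ U →
      inner ℝ (grad v x - gradient f x) (EuclideanSpace.single i (1:ℝ)) = 0 := by
    intro i
    set e := EuclideanSpace.single i (1:ℝ)
    have hli : LocallyIntegrable (fun x => inner ℝ (grad v x - gradient f x) e)
        (volume.restrict Ω) := by
      have h1 : LocallyIntegrable (fun x => inner ℝ (grad v x) e) (volume.restrict Ω) := by
        refine ((Lp.memLp (grad v)).inner_const e).locallyIntegrable (by norm_num)
      have h2 : LocallyIntegrable (fun x => inner ℝ (gradient f x) e) (volume.restrict Ω) :=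
        (cg.inner continuous_const).locallyIntegrable
      exact (h1.sub h2).congr (Filter.Eventually.of_forall fun x => by simp [inner_sub_left])
    -- Fundamental lemma of the calculus of variations: against a test function supported in U, both
    -- the weak and the classical derivative integrate by parts to the same integral, since v = f on
    -- U.
    refine hU.ae_eq_zero_of_integral_contDiff_smul_eq_zero (hli.locallyIntegrableOn U) ?_
    intro g hg hgc hgU
    have hw := integral_val_mul_fderiv v hg hgc e
    have e1 : ∫ x in Ω, val v x * fderiv ℝ g x e = ∫ x, f x * fderiv ℝ g x e := by
      refine setIntegral_eq_integral_of_ae_eq ?_ ?_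
      · filter_upwards [h] with x hx
        by_cases hxU : x ∈ U
        · rw [hx hxU]
        · have : fderiv ℝ g x = 0 := by
            refine image_eq_zero_of_notMem_tsupport fun h => hxU (hgU (tsupport_fderiv_subset ℝ h))
          simp [this]
      · intro x hx
        have : fderiv ℝ g x = 0 := by
          refine image_eq_zero_of_notMem_tsupport fun h =>
            hx (hUΩ (hgU (tsupport_fderiv_subset ℝ h)))
        simp [this]
    have cf' : Continuous fun x => fderiv ℝ f x e :=
      (hf.continuous_fderiv (by simp)).clm_apply continuous_const
    have cg' : Continuous fun x => fderiv ℝ g x e :=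
      (hg.continuous_fderiv (by simp)).clm_apply continuous_const
    have hcg' : HasCompactSupport (fun x => fderiv ℝ g x e) := hgc.fderiv_apply (𝕜 := ℝ) e
    have e2 : ∫ x, f x * fderiv ℝ g x e = -∫ x, fderiv ℝ f x e * g x := by
      refine integral_mul_fderiv_eq_neg_fderiv_mul_of_integrable ?_ ?_ ?_ ?_ ?_
      · exact (cf'.mul hg.continuous).integrable_of_hasCompactSupport hgc.mul_left
      · exact (hf.continuous.mul cg').integrable_of_hasCompactSupport hcg'.mul_left
      · exact (hf.continuous.mul hg.continuous).integrable_of_hasCompactSupport hgc.mul_left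
      · exact fun x _ => hf.differentiable (by simp) x
      · exact fun x _ => hg.differentiable (by simp) x
    have e3 : ∫ x, fderiv ℝ f x e * g x = ∫ x in Ω, fderiv ℝ f x e * g x := by
      rw [setIntegral_eq_integral_of_forall_compl_eq_zero]
      intro x hx
      rw [image_eq_zero_of_notMem_tsupport fun h => hx (hUΩ (hgU h)), mul_zero]
    have e4 : ∫ x in Ω, g x • inner ℝ (grad v x - gradient f x) e =
        (∫ x in Ω, inner ℝ (grad v x) e * g x) - ∫ x in Ω, fderiv ℝ f x e * g x := by
      rw [← integral_sub]
      · refine integral_congr_ae (Filter.Eventually.of_forall fun x => ?_)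
        simp only [inner_sub_left, inner_gradient, smul_eq_mul]; ring
      · exact (integrable_inner_grad v e hg.continuous hgc).congr
          (Filter.Eventually.of_forall fun x => mul_comm _ _)
      · exact ((cf'.mul hg.continuous).integrable_of_hasCompactSupport hgc.mul_left).restrict
    rw [e4, ← e3]
    rw [e1, e2, neg_inj] at hw
    rw [hw, sub_self]
  have hall := ae_all_iff.2 hcoord
  filter_upwards [hall] with x hx hxU
  rw [← sub_eq_zero]
  ext i
  have := hx i hxU
  simpa [EuclideanSpace.inner_single_right] using this

/-- The closure is taken in a space of pairs, so it needs proof that the second component is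
determined by the first. This is what makes the embedding into L² injective. -/
theorem grad_eq_zero_of_val (hΩ : IsOpen Ω) {v : H10 Ω} (h : val v = 0) : grad v = 0 := by
  have := grad_eq_gradient v hΩ subset_rfl (f := fun _ => (0:ℝ)) contDiff_const (by
    rw [h]
    filter_upwards [Lp.coeFn_zero ℝ 2 (volume.restrict Ω)] with x hx _
    exact hx)
  refine Lp.ext ?_
  filter_upwards [this, ae_restrict_mem hΩ.measurableSet, Lp.coeFn_zero (E d) 2 (volume.restrict Ω)]
    with x h1 h2 h3
  rw [h1 h2, h3]
  simp [gradient]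

theorem h10_ext {v w : H10 Ω} (h1 : val v = val w) (h2 : grad v = grad w) : v = w := by
  apply Subtype.ext
  exact WithLp.ofLp_injective 2 (Prod.ext h1 h2)

theorem val_injective (hΩ : IsOpen Ω) : Function.Injective (val : H10 Ω → L2 Ω) := by
  intro v w h
  have h0 : val (v - w) = 0 := by rw [map_sub, h, sub_self]
  have h1 := grad_eq_zero_of_val hΩ h0
  rw [map_sub, sub_eq_zero] at h1
  exact h10_ext h h1

theorem h10_norm_sq (v : H10 Ω) : ‖v‖ ^ 2 = ‖val v‖ ^ 2 + ‖grad v‖ ^ 2 :=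
  WithLp.prod_norm_sq_eq_of_L2 (v.1)

/-- `H¹₀(Ω)` is dense in `L²(Ω)`. -/
theorem eq_zero_of_inner_val (hΩ : IsOpen Ω) {g : L2 Ω} (h : ∀ v : H10 Ω, inner ℝ g (val v) = (0:ℝ)) :
    g = 0 := by
  have hloc : LocallyIntegrable g (volume.restrict Ω) :=
    (Lp.memLp g).locallyIntegrable (by norm_num)
  have := hΩ.ae_eq_zero_of_integral_contDiff_smul_eq_zero (hloc.locallyIntegrableOn Ω) (by
    intro φ hφ hc hs
    obtain ⟨p, hp, h1, -⟩ := exists_testPair hφ hc hs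
    have hp' : p ∈ h10Submodule Ω :=
      Submodule.le_topologicalClosure _ (Submodule.subset_span hp)
    have := h ⟨p, hp'⟩
    rw [L2.inner_def] at this
    rw [← this]
    refine integral_congr_ae ?_
    filter_upwards [h1] with x hx
    change φ x • g x = inner ℝ (g x) (p.fst x)
    rw [hx]; simp)
  refine Lp.ext ?_
  filter_upwards [this, ae_restrict_mem hΩ.measurableSet, Lp.coeFn_zero ℝ 2 (volume.restrict Ω)]
    with x h1 h2 h3
  rw [h1 h2, h3]; rfl

/-- This is density of H¹₀ in L². It allows an initial velocity that is attained only in H⁻¹ to be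
identified in L². -/
theorem toHneg1_injective (hΩ : IsOpen Ω) : Function.Injective (toHneg1 : L2 Ω → Hneg1 Ω) := by
  intro g g' h
  rw [← sub_eq_zero]
  refine eq_zero_of_inner_val hΩ fun v => ?_
  rw [inner_sub_left, sub_eq_zero]
  exact congrArg (fun L : Hneg1 Ω => L v) h

end Sobolev

/-! ### Translations and jumps -/

section Jump

variable {d : ℕ} {Ω : Set (E d)}

theorem setIntegral_shift (h : E d → ℝ) (B : Set (E d)) (e : E d) :
    ∫ x in B, h (x + e) = ∫ y in {y | y - e ∈ B}, h y := by
  have := (measurePreserving_add_right (volume : Measure (E d)) e).setIntegral_preimage_emb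
    (MeasurableEquiv.addRight e).measurableEmbedding h {y | y - e ∈ B}
  rw [← this]
  congr 2
  ext x; simp

theorem volume_shift (B : Set (E d)) (e : E d) : volume {y | y - e ∈ B} = volume B := by
  have : {y | y - e ∈ B} = (fun y => y + (-e)) ⁻¹' B := by
    ext y; simp [sub_eq_add_neg]
  rw [this, measure_preimage_add_right]

theorem measurableSet_shift {B : Set (E d)} (hB : MeasurableSet B) (e : E d) :
    MeasurableSet {y | y - e ∈ B} :=
  (measurable_id.sub_const e) hB

theorem volume_restrict_ne_top {Ω B : Set (E d)} (hBf : volume B ≠ ⊤) :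
    volume.restrict Ω B ≠ ⊤ :=
  ne_top_of_le_ne_top hBf (Measure.restrict_apply_le _ _)

/-- Translates of `H¹₀` functions, extended by zero, differ by the size of the gradient. -/
theorem abs_setIntegral_shift_sub_le (v : H10 Ω) {B : Set (E d)}
    (hB : MeasurableSet B) (hBf : volume B ≠ ⊤) {e : E d} (he : ‖e‖ ≤ 1) {t : ℝ} (ht : 0 ≤ t) :
    |(∫ x in {y | y - t • e ∈ B}, val v x ∂(volume.restrict Ω)) -
      ∫ x in B, val v x ∂(volume.restrict Ω)| ≤ t * √(volume.real B) * ‖grad v‖ := by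
  have hBs : ∀ s : ℝ, volume {y | y - s • e ∈ B} ≠ ⊤ := fun s => by rwa [volume_shift]
  have hms : ∀ s : ℝ, MeasurableSet {y | y - s • e ∈ B} := fun s => measurableSet_shift hB _
  have hcont : ∀ {S : Set (E d)}, MeasurableSet S → volume S ≠ ⊤ →
      Continuous fun f : L2 Ω => ∫ x in S, f x ∂(volume.restrict Ω) := by
    intro S hS hf
    have : (fun f : L2 Ω => ∫ x in S, f x ∂(volume.restrict Ω)) = fun f =>
        inner ℝ (indicatorConstLp 2 hS (volume_restrict_ne_top hf) (1:ℝ)) f := by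
      ext f; rw [L2.inner_indicatorConstLp_one]
    rw [this]; fun_prop
  -- Both sides are continuous in the pair (v, ∇v), so it suffices to treat test functions.
  refine h10_closed_property (P := fun p : WithLp 2 (L2 Ω × L2Vec Ω) =>
    |(∫ x in {y | y - t • e ∈ B}, p.fst x ∂(volume.restrict Ω)) -
      ∫ x in B, p.fst x ∂(volume.restrict Ω)| ≤ t * √(volume.real B) * ‖p.snd‖) ?_ ?_ v
  · refine isClosed_le ?_ ?_
    · have c1 : Continuous fun p : WithLp 2 (L2 Ω × L2Vec Ω) => p.fst :=
        (WithLp.fstL 2 ℝ (L2 Ω) (L2Vec Ω)).continuous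
      exact (((hcont (hms t) (hBs t)).comp c1).sub ((hcont hB hBf).comp c1)).abs
    · exact continuous_const.mul (WithLp.sndL 2 ℝ (L2 Ω) (L2Vec Ω)).continuous.norm
  · rintro p ⟨φ, hφ, hc, hs, h1, h2⟩
    have hφ0 : ∀ x, x ∉ Ω → φ x = 0 := fun x hx => image_eq_zero_of_notMem_tsupport fun h => hx (hs h)
    have hφ1 : ∀ x, x ∉ Ω → fderiv ℝ φ x e = 0 := fun x hx => by
      have : fderiv ℝ φ x = 0 :=
        image_eq_zero_of_notMem_tsupport fun h => hx (hs (tsupport_fderiv_subset ℝ h))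
      rw [this]; rfl
    have cφ' : Continuous fun x => fderiv ℝ φ x e :=
      (hφ.continuous_fderiv (by simp)).clm_apply continuous_const
    have restr : ∀ {S : Set (E d)} {F G : E d → ℝ}, MeasurableSet S →
        F =ᵐ[volume.restrict Ω] G → (∀ x, x ∉ Ω → G x = 0) →
        ∫ x in S, F x ∂(volume.restrict Ω) = ∫ x in S, G x := by
      intro S F G hS hFG hG
      rw [Measure.restrict_restrict hS, inter_comm, ← Measure.restrict_restrict₀']
      · refine setIntegral_eq_integral_of_ae_eq ?_ hG
        rw [Measure.restrict_restrict₀' hS.nullMeasurableSet, inter_comm,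
          ← Measure.restrict_restrict hS]
        exact ae_restrict_of_ae hFG
      · exact hS.nullMeasurableSet
    rw [restr (hms t) h1 hφ0, restr hB h1 hφ0, ← setIntegral_shift, ← integral_sub]
    -- The difference is the integral of the directional derivative along the segment. After
    -- exchanging the integrals, Cauchy–Schwarz on each translate of B gives the factor √|B|,
    -- uniformly in the shift.
    · have hftc : ∀ x, φ (x + t • e) - φ x = ∫ s in (0:ℝ)..t, fderiv ℝ φ (x + s • e) e := by
        intro x
        rw [intervalIntegral.integral_eq_sub_of_hasDerivAt (f := fun s => φ (x + s • e))]
        · simp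
        · intro s _
          have h1 : HasDerivAt (fun s : ℝ => x + s • e) e s := by
            simpa using ((hasDerivAt_id s).smul_const e).const_add x
          exact ((hφ.differentiable (by simp) _).hasFDerivAt).comp_hasDerivAt s h1
        · exact (cφ'.comp (by fun_prop)).intervalIntegrable _ _
      simp only [hftc]
      have hbound : ∃ C, ∀ x, ‖fderiv ℝ φ x e‖ ≤ C :=
        (hc.fderiv_apply (𝕜 := ℝ) e).exists_bound_of_continuous cφ'
      obtain ⟨C, hC⟩ := hbound
      have : IsFiniteMeasure (volume.restrict B) := ⟨by simpa using hBf.lt_top⟩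
      have hswap : ∫ x in B, (∫ s in (0:ℝ)..t, fderiv ℝ φ (x + s • e) e) =
          ∫ s in (0:ℝ)..t, ∫ x in B, fderiv ℝ φ (x + s • e) e := by
        simp only [intervalIntegral.integral_of_le ht]
        refine integral_integral_swap ?_
        refine Integrable.of_bound (C := C) ?_ (Filter.Eventually.of_forall fun z => hC _)
        exact (cφ'.comp (by fun_prop)).aestronglyMeasurable
      rw [hswap]
      have hb : ∀ s ∈ Set.uIoc 0 t, ‖∫ x in B, fderiv ℝ φ (x + s • e) e‖ ≤
          √(volume.real B) * ‖p.snd‖ := by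
        intro s _
        rw [setIntegral_shift (fun x => fderiv ℝ φ x e)]
        have h2' : (fun x => inner ℝ e (p.snd x)) =ᵐ[volume.restrict Ω] fun x => fderiv ℝ φ x e := by
          filter_upwards [h2] with x hx
          rw [hx, real_inner_comm, inner_gradient]
        rw [← restr (hms s) h2' hφ1, ← L2.inner_indicatorConstLp_eq_setIntegral_inner ℝ p.snd (hms s)
          e (volume_restrict_ne_top (hBs s))]
        refine (norm_inner_le_norm _ _).trans (mul_le_mul_of_nonneg_right ?_ (norm_nonneg _))
        rw [norm_indicatorConstLp (by norm_num) (by norm_num), Real.sqrt_eq_rpow]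
        have : (volume.restrict Ω).real {y | y - s • e ∈ B} ≤ volume.real B := by
          rw [measureReal_def, measureReal_def, ← volume_shift B (s • e)]
          exact ENNReal.toReal_mono (hBs s) (Measure.restrict_apply_le _ _)
        calc _ ≤ 1 * volume.real B ^ (1 / (2:ℝ)) := by
              refine mul_le_mul he ?_ (by positivity) zero_le_one
              norm_num only [ENNReal.toReal_ofNat]
              exact Real.rpow_le_rpow measureReal_nonneg this (by norm_num)
          _ = _ := one_mul _
      have := intervalIntegral.norm_integral_le_of_norm_le_const hb
      rw [Real.norm_eq_abs, sub_zero, abs_of_nonneg ht] at this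
      linarith
    · have : Integrable φ := hφ.continuous.integrable_of_hasCompactSupport hc
      exact (this.comp_add_right (t • e)).restrict
    · exact (hφ.continuous.integrable_of_hasCompactSupport hc).restrict

end Jump

/-! ### Membership in `H¹₀(Ω)` by approximation -/

section Membership

variable {d : ℕ} {Ω : Set (E d)}

/-- Bounded pointwise convergence suffices: by dominated convergence the limit pair is annihilated
by everything orthogonal to H¹₀, hence lies in this closed subspace. The limit G never has to be
identified as a gradient beforehand. -/
theorem exists_h10_of_tendsto (hfin : volume Ω ≠ ⊤) {φ : ℕ → E d → ℝ}
    (hφ : ∀ n, ContDiff ℝ ∞ (φ n)) (hc : ∀ n, HasCompactSupport (φ n))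
    (hs : ∀ n, tsupport (φ n) ⊆ Ω) {f : E d → ℝ} {G : E d → E d} {C : ℝ}
    (hb : ∀ n x, |φ n x| ≤ C) (hb' : ∀ n x, ‖gradient (φ n) x‖ ≤ C)
    (hf : ∀ᵐ x ∂(volume.restrict Ω), Filter.Tendsto (fun n => φ n x) Filter.atTop (nhds (f x)))
    (hG : ∀ᵐ x ∂(volume.restrict Ω),
      Filter.Tendsto (fun n => gradient (φ n) x) Filter.atTop (nhds (G x))) :
    ∃ v : H10 Ω, val v =ᵐ[volume.restrict Ω] f := by
  have : IsFiniteMeasure (volume.restrict Ω) := ⟨by simpa using hfin.lt_top⟩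
  have mf : AEStronglyMeasurable f (volume.restrict Ω) :=
    aestronglyMeasurable_of_tendsto_ae _ (fun n => (hφ n).continuous.aestronglyMeasurable) hf
  have mG : AEStronglyMeasurable G (volume.restrict Ω) :=
    aestronglyMeasurable_of_tendsto_ae _
      (fun n => (continuous_gradient (hφ n)).aestronglyMeasurable) hG
  have bf : ∀ᵐ x ∂(volume.restrict Ω), ‖f x‖ ≤ C := by
    filter_upwards [hf] with x hx
    exact le_of_tendsto hx.norm (Filter.Eventually.of_forall fun n => hb n x)
  have bG : ∀ᵐ x ∂(volume.restrict Ω), ‖G x‖ ≤ C := by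
    filter_upwards [hG] with x hx
    exact le_of_tendsto hx.norm (Filter.Eventually.of_forall fun n => hb' n x)
  have lf : MemLp f 2 (volume.restrict Ω) := MemLp.of_bound mf C bf
  have lG : MemLp G 2 (volume.restrict Ω) := MemLp.of_bound mG C bG
  set p : WithLp 2 (L2 Ω × L2Vec Ω) := WithLp.toLp 2 (lf.toLp f, lG.toLp G) with hp
  suffices p ∈ h10Submodule Ω from ⟨⟨p, this⟩, lf.coeFn_toLp⟩
  have : CompleteSpace (h10Submodule Ω) :=
    (Submodule.isClosed_topologicalClosure _).completeSpace_coe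
  -- A closed subspace is its own double orthogonal complement; testing with a fixed q reduces the
  -- claim to convergence of integrals against q.
  rw [← Submodule.orthogonal_orthogonal (h10Submodule Ω), Submodule.mem_orthogonal]
  intro q hq
  rw [WithLp.prod_inner_apply]
  choose P hP hP1 hP2 using fun n => exists_testPair (hφ n) (hc n) (hs n)
  have hzero : ∀ n, inner ℝ q (P n) = (0:ℝ) := fun n =>
    Submodule.inner_left_of_mem_orthogonal
      (Submodule.le_topologicalClosure _ (Submodule.subset_span (hP n))) hq
  have i1 : Integrable q.fst (volume.restrict Ω) := (Lp.memLp q.fst).integrable (by norm_num)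
  have i2 : Integrable q.snd (volume.restrict Ω) := (Lp.memLp q.snd).integrable (by norm_num)
  have t1 : Filter.Tendsto (fun n => ∫ x in Ω, inner ℝ (q.fst x) (φ n x)) Filter.atTop
      (nhds (∫ x in Ω, inner ℝ (q.fst x) (f x))) := by
    refine tendsto_integral_of_dominated_convergence (fun x => ‖q.fst x‖ * C) ?_
      (i1.norm.mul_const C) ?_ ?_
    · exact fun n => i1.aestronglyMeasurable.inner (hφ n).continuous.aestronglyMeasurable
    · exact fun n => Filter.Eventually.of_forall fun x => (norm_inner_le_norm _ _).trans
        (mul_le_mul_of_nonneg_left (hb n x) (norm_nonneg _))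
    · filter_upwards [hf] with x hx
      exact Filter.Tendsto.inner tendsto_const_nhds hx
  have t2 : Filter.Tendsto (fun n => ∫ x in Ω, inner ℝ (q.snd x) (gradient (φ n) x)) Filter.atTop
      (nhds (∫ x in Ω, inner ℝ (q.snd x) (G x))) := by
    refine tendsto_integral_of_dominated_convergence (fun x => ‖q.snd x‖ * C) ?_
      (i2.norm.mul_const C) ?_ ?_
    · exact fun n => i2.aestronglyMeasurable.inner (continuous_gradient (hφ n)).aestronglyMeasurable
    · exact fun n => Filter.Eventually.of_forall fun x => (norm_inner_le_norm _ _).trans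
        (mul_le_mul_of_nonneg_left (hb' n x) (norm_nonneg _))
    · filter_upwards [hG] with x hx
      exact Filter.Tendsto.inner tendsto_const_nhds hx
  have e1 : inner ℝ q.fst (lf.toLp f) = ∫ x in Ω, inner ℝ (q.fst x) (f x) := by
    rw [L2.inner_def]
    refine integral_congr_ae ?_
    filter_upwards [lf.coeFn_toLp] with x hx
    rw [hx]
  have e2 : inner ℝ q.snd (lG.toLp G) = ∫ x in Ω, inner ℝ (q.snd x) (G x) := by
    rw [L2.inner_def]
    refine integral_congr_ae ?_
    filter_upwards [lG.coeFn_toLp] with x hx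
    rw [hx]
  change inner ℝ q.fst (lf.toLp f) + inner ℝ q.snd (lG.toLp G) = (0:ℝ)
  rw [e1, e2]
  refine tendsto_nhds_unique (t1.add t2) (tendsto_const_nhds.congr fun n => ?_)
  rw [← hzero n, WithLp.prod_inner_apply, L2.inner_def, L2.inner_def]
  congr 1
  · refine integral_congr_ae ?_
    filter_upwards [hP1 n] with x hx
    exact congrArg _ hx
  · refine integral_congr_ae ?_
    filter_upwards [hP2 n] with x hx
    exact congrArg _ hx

end Membership

/-! ### Smooth approximation of piecewise linear functions -/

section OneDim

open Filter Topology

/-- A smooth approximation of `t ↦ max 0 t`, exact outside `(1/N, 2/N)`. -/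
def softPos (N t : ℝ) : ℝ := t * Real.smoothTransition (N * t - 1)

theorem softPos_of_le {N t : ℝ} (h : N * t ≤ 1) : softPos N t = 0 := by
  rw [softPos, Real.smoothTransition.zero_of_nonpos (by linarith), mul_zero]

theorem softPos_of_ge {N t : ℝ} (h : 2 ≤ N * t) : softPos N t = t := by
  rw [softPos, Real.smoothTransition.one_of_one_le (by linarith), mul_one]

theorem softPos_contDiff (N : ℝ) : ContDiff ℝ ∞ (softPos N) := by
  unfold softPos
  exact contDiff_id.mul (Real.smoothTransition.contDiff.comp (by fun_prop))

theorem softPos_mem {N t : ℝ} (hN : 0 < N) : 0 ≤ softPos N t ∧ softPos N t ≤ max 0 t := by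
  rcases le_total t 0 with h | h
  · rw [softPos_of_le (by nlinarith)]; simp
  · rw [max_eq_right h]
    exact ⟨mul_nonneg h (Real.smoothTransition.nonneg _),
      mul_le_of_le_one_right h (Real.smoothTransition.le_one _)⟩

/-- The bound is uniform in N although the transition has slope of order N: its derivative is
multiplied by t, and Nt lies in [1, 2] on the transition zone. -/
theorem exists_deriv_softPos_le : ∃ C : ℝ, 0 ≤ C ∧ ∀ N t : ℝ, 0 < N → |deriv (softPos N) t| ≤ C := by
  have hcd : Continuous (deriv Real.smoothTransition) :=
    (Real.smoothTransition.contDiff (n := 1)).continuous_deriv (by simp)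
  obtain ⟨M, hM⟩ := (isCompact_Icc (a := (0:ℝ)) (b := 1)).exists_bound_of_continuousOn
    hcd.continuousOn
  have hM0 : 0 ≤ M := (norm_nonneg _).trans (hM 0 (by simp))
  refine ⟨1 + 2 * M, by positivity, fun N t hN => ?_⟩
  have hd : HasDerivAt (softPos N) (1 * Real.smoothTransition (N * t - 1) +
      t * (deriv Real.smoothTransition (N * t - 1) * N)) t := by
    have h1 : HasDerivAt (fun t => N * t - 1) N t := by
      simpa using ((hasDerivAt_id t).const_mul N).sub_const 1
    have h2 : HasDerivAt Real.smoothTransition (deriv Real.smoothTransition (N * t - 1))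
        (N * t - 1) :=
      ((Real.smoothTransition.contDiff (n := 1)).differentiable (by simp) _).hasDerivAt
    have h3 : HasDerivAt (fun t => Real.smoothTransition (N * t - 1)) _ t :=
      HasDerivAt.comp (h₂ := Real.smoothTransition) (h := fun t => N * t - 1) t h2 h1
    exact (hasDerivAt_id t).mul h3
  have hval := hd.deriv
  by_cases hin : N * t - 1 ∈ Icc (0:ℝ) 1
  · rw [hval]
    have e : t * (deriv Real.smoothTransition (N * t - 1) * N) =
      (N * t) * deriv Real.smoothTransition (N * t - 1) := by ring
    rw [e, one_mul]
    refine (abs_add_le _ _).trans (add_le_add ?_ ?_)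
    · rw [abs_of_nonneg (Real.smoothTransition.nonneg _)]; exact Real.smoothTransition.le_one _
    · rw [abs_mul]
      refine mul_le_mul ?_ (hM _ hin) (abs_nonneg _) (by norm_num)
      rw [abs_le]; constructor <;> linarith [hin.1, hin.2]
  · rw [mem_Icc, not_and_or, not_le, not_le] at hin
    rcases hin with h | h
    · have : softPos N =ᶠ[𝓝 t] fun _ => 0 := by
        have : ∀ᶠ s in 𝓝 t, N * s - 1 < 0 :=
          (by fun_prop : Continuous fun s : ℝ => N * s - 1).continuousAt.eventually_lt
            continuousAt_const h
        filter_upwards [this] with s hs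
        exact softPos_of_le (by linarith)
      rw [this.deriv_eq]; simp; positivity
    · have : softPos N =ᶠ[𝓝 t] fun s => s := by
        have : ∀ᶠ s in 𝓝 t, 1 < N * s - 1 :=
          continuousAt_const.eventually_lt
            (by fun_prop : Continuous fun s : ℝ => N * s - 1).continuousAt h
        filter_upwards [this] with s hs
        exact softPos_of_ge (by linarith)
      rw [this.deriv_eq]; simp; linarith

/-- The piecewise linear ramp from `0` to `1` on `[0, 1]`. -/
def clamp (t : ℝ) : ℝ := max 0 (min t 1)

/-- A smooth approximation of `clamp`. -/
def softRamp (N t : ℝ) : ℝ := softPos N (1 - softPos N (1 - t))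

theorem softRamp_contDiff (N : ℝ) : ContDiff ℝ ∞ (softRamp N) :=
  (softPos_contDiff N).comp (contDiff_const.sub ((softPos_contDiff N).comp
    (contDiff_const.sub contDiff_id)))

/-- For 3 ≤ N the smoothing zones at the two kinks do not interfere: Nt ≤ 1 forces N(1 - t) ≥ 2,
where the inner smoothing is exact. This is why the index is shifted to n + 3 below. -/
theorem softRamp_of_le {N t : ℝ} (hN : 3 ≤ N) (h : N * t ≤ 1) : softRamp N t = 0 := by
  rw [softRamp, softPos_of_ge (t := 1 - t) (by linarith), sub_sub_cancel, softPos_of_le h]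

theorem softRamp_of_ge {N t : ℝ} (hN : 3 ≤ N) (h : N * (1 - t) ≤ 1) : softRamp N t = 1 := by
  rw [softRamp, softPos_of_le (t := 1 - t) h, sub_zero, softPos_of_ge (by linarith)]

theorem softRamp_of_mid {N t : ℝ} (h : 2 ≤ N * t) (h' : 2 ≤ N * (1 - t)) : softRamp N t = t := by
  rw [softRamp, softPos_of_ge (t := 1 - t) h', sub_sub_cancel, softPos_of_ge h]

theorem softRamp_mem {N : ℝ} (hN : 0 < N) (t : ℝ) : 0 ≤ softRamp N t ∧ softRamp N t ≤ 1 := by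
  refine ⟨(softPos_mem hN).1, (softPos_mem hN).2.trans (max_le zero_le_one ?_)⟩
  linarith [(softPos_mem (t := 1 - t) hN).1]

theorem exists_deriv_softRamp_le :
    ∃ C : ℝ, 0 ≤ C ∧ ∀ N t : ℝ, 0 < N → |deriv (softRamp N) t| ≤ C := by
  obtain ⟨C, hC, h⟩ := exists_deriv_softPos_le
  refine ⟨C * C, by positivity, fun N t hN => ?_⟩
  have hdiff : Differentiable ℝ (softPos N) := (softPos_contDiff N).differentiable (by simp)
  have h1 : HasDerivAt (fun t => 1 - softPos N (1 - t)) (-(deriv (softPos N) (1 - t) * (-1))) t := by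
    have h0 : HasDerivAt (fun t : ℝ => 1 - t) (-1) t := by
      simpa using (hasDerivAt_id t).const_sub 1
    exact ((hdiff _).hasDerivAt.comp t h0).const_sub 1
  have h2 : HasDerivAt (softRamp N) (deriv (softPos N) (1 - softPos N (1 - t)) *
      (-(deriv (softPos N) (1 - t) * (-1)))) t := (hdiff _).hasDerivAt.comp t h1
  rw [h2.deriv, abs_mul]
  refine mul_le_mul (h _ _ hN) ?_ (abs_nonneg _) hC
  simpa using h N (1 - t) hN

theorem eventually_le_natCast_mul {δ : ℝ} (hδ : 0 < δ) (c : ℝ) :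
    ∀ᶠ n : ℕ in atTop, c ≤ ((n : ℝ) + 3) * δ := by
  obtain ⟨n₀, hn₀⟩ := exists_nat_ge (c / δ)
  filter_upwards [eventually_ge_atTop n₀] with n hn
  have : (n₀ : ℝ) ≤ n := by exact_mod_cast hn
  rw [div_le_iff₀ hδ] at hn₀
  nlinarith

theorem tendsto_softRamp (t : ℝ) :
    Tendsto (fun n : ℕ => softRamp (n + 3) t) atTop (𝓝 (clamp t)) := by
  refine tendsto_const_nhds.congr' ?_
  rcases le_or_gt t 0 with h | h
  · refine Eventually.of_forall fun n => ?_
    have hn : (0:ℝ) ≤ n := n.cast_nonneg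
    beta_reduce
    rw [softRamp_of_le (by linarith) (by nlinarith), clamp, min_eq_left (by linarith),
      max_eq_left h]
  rcases le_or_gt 1 t with h' | h'
  · refine Eventually.of_forall fun n => ?_
    have hn : (0:ℝ) ≤ n := n.cast_nonneg
    beta_reduce
    rw [softRamp_of_ge (by linarith) (by nlinarith), clamp, min_eq_right h']; simp
  · filter_upwards [eventually_le_natCast_mul h 2,
      eventually_le_natCast_mul (sub_pos.2 h') 2] with n h1 h2
    rw [softRamp_of_mid h1 h2, clamp, min_eq_left h'.le, max_eq_right h.le]

/-- Away from the kinks the derivatives are eventually constant in n. Only the existence of the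
limit is needed, not its value. -/
theorem tendsto_deriv_softRamp {t : ℝ} (h0 : t ≠ 0) (h1 : t ≠ 1) :
    ∃ l, Tendsto (fun n : ℕ => deriv (softRamp (n + 3)) t) atTop (𝓝 l) := by
  rcases lt_or_gt_of_ne h0 with h | h
  · refine ⟨0, tendsto_const_nhds.congr' (Eventually.of_forall fun n => ?_)⟩
    have hn : (0:ℝ) ≤ n := n.cast_nonneg
    have : softRamp (n + 3) =ᶠ[𝓝 t] fun _ => 0 := by
      filter_upwards [eventually_lt_nhds h] with s hs
      exact softRamp_of_le (by linarith) (by nlinarith)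
    beta_reduce
    rw [this.deriv_eq]; simp
  rcases lt_or_gt_of_ne h1 with h' | h'
  · refine ⟨1, tendsto_const_nhds.congr' ?_⟩
    filter_upwards [eventually_le_natCast_mul (half_pos h) 2,
      eventually_le_natCast_mul (half_pos (sub_pos.2 h')) 2] with n h1 h2
    have hn : (0:ℝ) ≤ n := n.cast_nonneg
    have : softRamp (n + 3) =ᶠ[𝓝 t] fun s => s := by
      filter_upwards [eventually_gt_nhds (half_lt_self h),
        eventually_lt_nhds (show t < (1 + t) / 2 by linarith)] with s hs hs'
      refine softRamp_of_mid (h1.trans ?_) (h2.trans ?_) <;>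
        exact mul_le_mul_of_nonneg_left (by linarith) (by positivity)
    rw [this.deriv_eq]; simp
  · refine ⟨0, tendsto_const_nhds.congr' (Eventually.of_forall fun n => ?_)⟩
    have hn : (0:ℝ) ≤ n := n.cast_nonneg
    have : softRamp (n + 3) =ᶠ[𝓝 t] fun _ => 1 := by
      filter_upwards [eventually_gt_nhds h'] with s hs
      exact softRamp_of_ge (by linarith) (by nlinarith)
    beta_reduce
    rw [this.deriv_eq]; simp

/-- The piecewise linear hat function with nodes `α < β < γ`. -/
def hat (α β γ t : ℝ) : ℝ := clamp ((t - α) / (β - α)) - clamp ((t - β) / (γ - β))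

theorem clamp_of_nonpos {t : ℝ} (h : t ≤ 0) : clamp t = 0 := by
  rw [clamp, max_eq_left ((min_le_left _ _).trans h)]

theorem clamp_of_one_le {t : ℝ} (h : 1 ≤ t) : clamp t = 1 := by
  rw [clamp, min_eq_right h]; simp

theorem clamp_of_mem {t : ℝ} (h : 0 ≤ t) (h' : t ≤ 1) : clamp t = t := by
  rw [clamp, min_eq_left h', max_eq_right h]

theorem hat_left {α β γ t : ℝ} (h1 : α < β) (h2 : β < γ) (h : α ≤ t) (h' : t ≤ β) :
    hat α β γ t = (t - α) / (β - α) := by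
  have := sub_pos.2 h1
  rw [hat, clamp_of_mem (div_nonneg (by linarith) this.le) ((div_le_one this).2 (by linarith)),
    clamp_of_nonpos (div_nonpos_of_nonpos_of_nonneg (by linarith) (by linarith)), sub_zero]

theorem hat_right {α β γ t : ℝ} (h1 : α < β) (h2 : β < γ) (h : β ≤ t) (h' : t ≤ γ) :
    hat α β γ t = (γ - t) / (γ - β) := by
  have := sub_pos.2 h1
  have h3 := sub_pos.2 h2
  rw [hat, clamp_of_one_le ((one_le_div this).2 (by linarith)),
    clamp_of_mem (div_nonneg (by linarith) h3.le) ((div_le_one h3).2 (by linarith))]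
  field_simp; ring

theorem hat_eq_zero {α β γ t : ℝ} (h1 : α < β) (h2 : β < γ) (h : t ≤ α ∨ γ ≤ t) :
    hat α β γ t = 0 := by
  have := sub_pos.2 h1
  have h3 := sub_pos.2 h2
  rcases h with h | h
  · rw [hat, clamp_of_nonpos (div_nonpos_of_nonpos_of_nonneg (by linarith) (by linarith)),
      clamp_of_nonpos (div_nonpos_of_nonpos_of_nonneg (by linarith) (by linarith)), sub_zero]
  · rw [hat, clamp_of_one_le ((one_le_div this).2 (by linarith)),
      clamp_of_one_le ((one_le_div h3).2 (by linarith)), sub_self]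

/-- These are the properties that `exists_h10_of_tendsto` requires of each factor of a tensor
product: supports compactly inside the open interval, uniform bounds, and convergence off the three
nodes. -/
theorem exists_smooth_hat {α β γ : ℝ} (h1 : α < β) (h2 : β < γ) :
    ∃ (h : ℕ → ℝ → ℝ) (C : ℝ), 0 ≤ C ∧ (∀ n, ContDiff ℝ ∞ (h n)) ∧
      (∀ n, ∃ a b, α < a ∧ b < γ ∧ ∀ t, t ∉ Icc a b → h n t = 0) ∧ (∀ n t, |h n t| ≤ 1) ∧
      (∀ n t, |deriv (h n) t| ≤ C) ∧
      (∀ t, Tendsto (fun n => h n t) atTop (𝓝 (hat α β γ t))) ∧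
      ∀ t, t ≠ α → t ≠ β → t ≠ γ → ∃ l, Tendsto (fun n => deriv (h n) t) atTop (𝓝 l) := by
  have p1 := sub_pos.2 h1
  have p2 := sub_pos.2 h2
  obtain ⟨C, hC0, hC⟩ := exists_deriv_softRamp_le
  have hder : ∀ (n : ℕ) (t : ℝ), HasDerivAt (fun t => softRamp (n + 3) ((t - α) / (β - α)) -
      softRamp (n + 3) ((t - β) / (γ - β)))
      (deriv (softRamp (n + 3)) ((t - α) / (β - α)) * (β - α)⁻¹ -
        deriv (softRamp (n + 3)) ((t - β) / (γ - β)) * (γ - β)⁻¹) t := by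
    intro n t
    have hd : Differentiable ℝ (softRamp (n + 3)) :=
      (softRamp_contDiff (n + 3)).differentiable (by simp)
    have e : ∀ x y : ℝ, HasDerivAt (fun t => (t - x) / y) y⁻¹ t := fun x y => by
      simpa [one_div] using ((hasDerivAt_id t).sub_const x).div_const y
    exact (((hd _).hasDerivAt).comp t (e α (β - α))).sub
      (((hd _).hasDerivAt).comp t (e β (γ - β)))
  refine ⟨fun n t => softRamp (n + 3) ((t - α) / (β - α)) - softRamp (n + 3) ((t - β) / (γ - β)),
    C * (β - α)⁻¹ + C * (γ - β)⁻¹, by positivity, ?_, ?_, ?_, ?_, ?_, ?_⟩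
  · intro n
    exact ((softRamp_contDiff _).comp (by fun_prop)).sub ((softRamp_contDiff _).comp (by fun_prop))
  · intro n
    have hn : (0:ℝ) ≤ n := n.cast_nonneg
    have hn3 : (0:ℝ) < n + 3 := by linarith
    refine ⟨α + (β - α) / (n + 3), γ - (γ - β) / (n + 3), ?_, ?_, ?_⟩
    · have : 0 < (β - α) / (n + 3) := by positivity
      linarith
    · have : 0 < (γ - β) / (n + 3) := by positivity
      linarith
    · intro t ht
      rw [mem_Icc, not_and_or, not_le, not_le] at ht
      rcases ht with ht | ht
      · have hlt : t - α < (β - α) / (n + 3) := by linarith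
        rw [lt_div_iff₀ hn3] at hlt
        have htβ : t ≤ β := by nlinarith
        have a1 : ((n:ℝ) + 3) * ((t - α) / (β - α)) ≤ 1 := by
          rw [← mul_div_assoc, div_le_one p1]; linarith
        have a2 : ((n:ℝ) + 3) * ((t - β) / (γ - β)) ≤ 1 := by
          rw [← mul_div_assoc, div_le_one p2]; nlinarith
        beta_reduce
        rw [softRamp_of_le (by linarith) a1, softRamp_of_le (by linarith) a2, sub_zero]
      · have hlt : γ - t < (γ - β) / (n + 3) := by linarith
        rw [lt_div_iff₀ hn3] at hlt
        have htβ : β ≤ t := by nlinarith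
        have a1 : ((n:ℝ) + 3) * (1 - (t - α) / (β - α)) ≤ 1 := by
          rw [one_sub_div p1.ne', ← mul_div_assoc, div_le_one p1]; nlinarith
        have a2 : ((n:ℝ) + 3) * (1 - (t - β) / (γ - β)) ≤ 1 := by
          rw [one_sub_div p2.ne', ← mul_div_assoc, div_le_one p2]; nlinarith
        beta_reduce
        rw [softRamp_of_ge (by linarith) a1, softRamp_of_ge (by linarith) a2, sub_self]
  · intro n t
    have hn3 : (0:ℝ) < n + 3 := by positivity
    have m1 := softRamp_mem hn3 ((t - α) / (β - α))
    have m2 := softRamp_mem hn3 ((t - β) / (γ - β))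
    rw [abs_le]; constructor <;> linarith [m1.1, m1.2, m2.1, m2.2]
  · intro n t
    have hn3 : (0:ℝ) < n + 3 := by positivity
    rw [(hder n t).deriv]
    refine (abs_sub _ _).trans (add_le_add ?_ ?_) <;> rw [abs_mul]
    · rw [abs_of_pos (inv_pos.2 p1)]
      exact mul_le_mul_of_nonneg_right (hC _ _ hn3) (by positivity)
    · rw [abs_of_pos (inv_pos.2 p2)]
      exact mul_le_mul_of_nonneg_right (hC _ _ hn3) (by positivity)
  · exact fun t => (tendsto_softRamp _).sub (tendsto_softRamp _)
  · intro t ha hb hc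
    obtain ⟨l1, hl1⟩ := tendsto_deriv_softRamp (t := (t - α) / (β - α))
      (div_ne_zero (sub_ne_zero.2 ha) p1.ne') (by
        rw [Ne, div_eq_one_iff_eq p1.ne']; intro h; exact hb (by linarith))
    obtain ⟨l2, hl2⟩ := tendsto_deriv_softRamp (t := (t - β) / (γ - β))
      (div_ne_zero (sub_ne_zero.2 hb) p2.ne') (by
        rw [Ne, div_eq_one_iff_eq p2.ne']; intro h; exact hc (by linarith))
    refine ⟨l1 * (β - α)⁻¹ - l2 * (γ - β)⁻¹, ?_⟩
    simp only [(hder _ t).deriv]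
    exact (hl1.mul_const _).sub (hl2.mul_const _)

end OneDim

/-! ### Boxes and tensor products -/

section Tensor

open Filter Topology

variable {d : ℕ}

/-- The closed box with corners `l` and `u`. -/
def cbox (l u : Fin d → ℝ) : Set (E d) := {x | ∀ i, l i ≤ x i ∧ x i ≤ u i}

theorem isCompact_cbox (l u : Fin d → ℝ) : IsCompact (cbox l u) := by
  have : cbox l u = WithLp.toLp 2 '' Icc l u := by
    ext x
    simp only [cbox, mem_ofPred_eq, mem_image, mem_Icc, Pi.le_def]
    constructor
    · exact fun h => ⟨x.ofLp, ⟨fun i => (h i).1, fun i => (h i).2⟩, rfl⟩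
    · rintro ⟨y, ⟨h1, h2⟩, rfl⟩ i
      exact ⟨h1 i, h2 i⟩
  rw [this]
  exact isCompact_Icc.image (PiLp.continuous_toLp 2 _)

theorem volume_hyperplane (i : Fin d) (c : ℝ) : volume {x : E d | x i = c} = 0 := by
  have h := (PiLp.volume_preserving_ofLp (Fin d)).measure_preimage
    (s := {y : Fin d → ℝ | y i = c}) (by
      exact (measurableSet_eq_fun (measurable_pi_apply i) measurable_const).nullMeasurableSet)
  have h2 : volume {y : Fin d → ℝ | y i = c} = 0 := by
    rw [volume_pi]; exact Measure.pi_hyperplane (fun _ : Fin d => (volume : Measure ℝ)) i c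
  rw [h2] at h
  exact h

theorem hasFDerivAt_tensor {h : Fin d → ℝ → ℝ} (hh : ∀ i, ContDiff ℝ ∞ (h i)) (x : E d) :
    HasFDerivAt (fun x : E d => ∏ i, h i (x i))
      (∑ i, (∏ j ∈ Finset.univ.erase i, h j (x j)) •
        (deriv (h i) (x i) • (EuclideanSpace.proj i : E d →L[ℝ] ℝ))) x := by
  refine HasFDerivAt.finsetProd fun i _ => ?_
  have h1 : HasDerivAt (h i) (deriv (h i) (x i)) (x i) :=
    ((hh i).differentiable (by simp) _).hasDerivAt
  exact h1.comp_hasFDerivAt x (EuclideanSpace.proj i : E d →L[ℝ] ℝ).hasFDerivAt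

theorem gradient_tensor {h : Fin d → ℝ → ℝ} (hh : ∀ i, ContDiff ℝ ∞ (h i)) (x : E d) (k : Fin d) :
    gradient (fun x : E d => ∏ i, h i (x i)) x k =
      (∏ j ∈ Finset.univ.erase k, h j (x j)) * deriv (h k) (x k) := by
  have : gradient (fun x : E d => ∏ i, h i (x i)) x k =
      inner ℝ (gradient (fun x : E d => ∏ i, h i (x i)) x) (EuclideanSpace.single k (1:ℝ)) := by
    rw [EuclideanSpace.inner_single_right]; simp
  rw [this, inner_gradient, (hasFDerivAt_tensor hh x).fderiv, sum_apply,
    Finset.sum_eq_single k]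
  · simp
  · intro i _ hik
    simp [hik]
  · simp

theorem norm_le_of_coord {v : E d} {C : ℝ} (hC : 0 ≤ C) (h : ∀ i, |v i| ≤ C) : ‖v‖ ≤ √d * C := by
  rw [EuclideanSpace.norm_eq, ← Real.sqrt_sq hC, ← Real.sqrt_mul (by positivity)]
  refine Real.sqrt_le_sqrt ?_
  calc ∑ i, ‖v i‖ ^ 2 ≤ ∑ _i : Fin d, C ^ 2 :=
        Finset.sum_le_sum fun i _ => pow_le_pow_left₀ (norm_nonneg _) (h i) 2
    _ = d * C ^ 2 := by simp

theorem contDiff_tensor {h : Fin d → ℝ → ℝ} (hh : ∀ i, ContDiff ℝ ∞ (h i)) :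
    ContDiff ℝ ∞ (fun x : E d => ∏ i, h i (x i)) :=
  contDiff_prod fun i _ => (hh i).comp (EuclideanSpace.proj i : E d →L[ℝ] ℝ).contDiff

/-- Tensor products of hat functions supported in `Ω` belong to `H¹₀(Ω)`. -/
theorem exists_h10_hat {Ω : Set (E d)} (hfin : volume Ω ≠ ⊤) {α β γ : Fin d → ℝ}
    (h1 : ∀ i, α i < β i) (h2 : ∀ i, β i < γ i)
    (hsub : {x : E d | ∀ i, α i < x i ∧ x i < γ i} ⊆ Ω) :
    ∃ v : H10 Ω, val v =ᵐ[volume.restrict Ω] fun x => ∏ i, hat (α i) (β i) (γ i) (x i) := by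
  choose h C hC0 hcd hsupp hb hb' ht ht' using fun i => exists_smooth_hat (h1 i) (h2 i)
  have hzero : ∀ n, ∃ K : Set (E d), IsCompact K ∧ K ⊆ Ω ∧
      ∀ x, x ∉ K → ∏ i, h i n (x i) = 0 := by
    intro n
    choose a b ha hb hab using fun i => hsupp i n
    refine ⟨cbox a b, isCompact_cbox a b, fun x hx => hsub fun i =>
      ⟨(ha i).trans_le (hx i).1, (hx i).2.trans_lt (hb i)⟩, fun x hx => ?_⟩
    simp only [cbox, mem_ofPred_eq, not_forall] at hx
    obtain ⟨i, hi⟩ := hx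
    exact Finset.prod_eq_zero (Finset.mem_univ i) (hab i _ hi)
  choose K hK hKΩ hKz using hzero
  have hprod : ∀ n (s : Finset (Fin d)) (x : E d), |∏ i ∈ s, h i n (x i)| ≤ 1 := by
    intro n s x
    rw [Finset.abs_prod]
    exact Finset.prod_le_one (fun i _ => abs_nonneg _) fun i _ => hb i n _
  set M := ∑ i, C i
  have hM : ∀ i, C i ≤ M := fun i =>
    Finset.single_le_sum (f := C) (fun j _ => hC0 j) (Finset.mem_univ i)
  have hM0 : 0 ≤ M := Finset.sum_nonneg fun i _ => hC0 i
  -- The derivatives of the factors may fail to converge only on finitely many coordinate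
  -- hyperplanes, which are null.
  have hae : ∀ᵐ x ∂(volume.restrict Ω), ∀ i, x i ≠ α i ∧ x i ≠ β i ∧ x i ≠ γ i := by
    refine ae_restrict_of_ae (ae_all_iff.2 fun i => ?_)
    have hn : ∀ c : ℝ, ∀ᵐ x : E d, x i ≠ c := fun c => by
      rw [ae_iff]; simpa using volume_hyperplane i c
    filter_upwards [hn (α i), hn (β i), hn (γ i)] with x h1 h2 h3
    exact ⟨h1, h2, h3⟩
  have hlim : ∀ᵐ x ∂(volume.restrict Ω), ∃ g : E d,
      Tendsto (fun n => gradient (fun x : E d => ∏ i, h i n (x i)) x) atTop (𝓝 g) := by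
    filter_upwards [hae] with x hx
    choose l hl using fun i => ht' i (x i) (hx i).1 (hx i).2.1 (hx i).2.2
    refine ⟨WithLp.toLp 2 fun k => (∏ j ∈ Finset.univ.erase k,
      hat (α j) (β j) (γ j) (x j)) * l k, ?_⟩
    have : Tendsto (fun n => (gradient (fun x : E d => ∏ i, h i n (x i)) x).ofLp) atTop
        (𝓝 fun k => (∏ j ∈ Finset.univ.erase k, hat (α j) (β j) (γ j) (x j)) * l k) := by
      rw [tendsto_pi_nhds]
      intro k
      simp only [gradient_tensor fun i => hcd i _]
      exact (tendsto_finsetProd _ fun j _ => ht j (x j)).mul (hl k)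
    exact ((PiLp.continuous_toLp 2 _).tendsto _).comp this
  classical
  -- The candidate gradient is the pointwise limit wherever it exists; the default value 0 is taken
  -- on a null set only.
  refine exists_h10_of_tendsto hfin (φ := fun n x => ∏ i, h i n (x i))
    (G := fun x => if hx : ∃ g : E d, Tendsto
      (fun n => gradient (fun x : E d => ∏ i, h i n (x i)) x) atTop (𝓝 g) then hx.choose else 0)
    (C := max 1 (√d * M)) (fun n => contDiff_tensor fun i => hcd i n)
    (fun n => HasCompactSupport.intro (hK n) (hKz n)) ?_ ?_ ?_ ?_ ?_
  · intro n
    refine (closure_minimal ?_ (hK n).isClosed).trans (hKΩ n)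
    intro x hx
    by_contra hxK
    exact hx (hKz n x hxK)
  · exact fun n x => (hprod n _ x).trans (le_max_left _ _)
  · intro n x
    refine (norm_le_of_coord hM0 fun k => ?_).trans (le_max_right _ _)
    rw [gradient_tensor fun i => hcd i _, abs_mul]
    exact (mul_le_of_le_one_left (abs_nonneg _) (hprod n _ x)).trans ((hb' k n _).trans (hM k))
  · exact Eventually.of_forall fun x => tendsto_finsetProd _ fun i _ => ht i (x i)
  · filter_upwards [hlim] with x hx
    rw [dif_pos hx]
    exact hx.choose_spec

end Tensor

/-! ### Boxes -/

section Box

variable {d : ℕ}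

/-- The open box with corners `l` and `u`. -/
def obox (l u : Fin d → ℝ) : Set (E d) := {x | ∀ i, l i < x i ∧ x i < u i}

theorem continuous_coord (i : Fin d) : Continuous fun x : E d => x i :=
  (EuclideanSpace.proj i : E d →L[ℝ] ℝ).continuous

theorem isOpen_obox (l u : Fin d → ℝ) : IsOpen (obox l u) := by
  have : obox l u = ⋂ i, {x : E d | l i < x i ∧ x i < u i} := by ext x; simp [obox]
  rw [this]
  exact isOpen_iInter_of_finite fun i =>
    (isOpen_lt continuous_const (continuous_coord i)).inter
      (isOpen_lt (continuous_coord i) continuous_const)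

theorem measurableSet_cbox (l u : Fin d → ℝ) : MeasurableSet (cbox l u) :=
  (isCompact_cbox l u).measurableSet

theorem volume_real_obox {l u : Fin d → ℝ} (h : ∀ i, l i ≤ u i) :
    volume.real (obox l u) = ∏ i, (u i - l i) := by
  have e : obox l u = WithLp.ofLp ⁻¹' (Set.pi univ fun i => Ioo (l i) (u i)) := by
    ext x; simp [obox]
  rw [measureReal_def, e, (PiLp.volume_preserving_ofLp (Fin d)).measure_preimage
    (MeasurableSet.univ_pi fun i => measurableSet_Ioo).nullMeasurableSet, Real.volume_pi_Ioo_toReal h]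

theorem volume_real_cbox {l u : Fin d → ℝ} (h : ∀ i, l i ≤ u i) :
    volume.real (cbox l u) = ∏ i, (u i - l i) := by
  have e : cbox l u = WithLp.ofLp ⁻¹' (Icc l u) := by
    ext x; simp only [cbox, mem_ofPred_eq, mem_preimage, mem_Icc, Pi.le_def, forall_and]
  rw [measureReal_def, e, (PiLp.volume_preserving_ofLp (Fin d)).measure_preimage
    measurableSet_Icc.nullMeasurableSet, Real.volume_Icc_pi_toReal h]

theorem volume_obox_ne_top (l u : Fin d → ℝ) : volume (obox l u) ≠ ⊤ := by
  refine ne_top_of_le_ne_top (isCompact_cbox l u).measure_lt_top.ne (measure_mono ?_)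
  exact fun x hx i => ⟨(hx i).1.le, (hx i).2.le⟩

end Box

/-! ### Rectangles and their vertices. -/

namespace Rect

variable {d : ℕ} (K : Rect d)

theorem isCompact_toSet : IsCompact K.toSet := isCompact_cbox _ _

theorem measurableSet_toSet : MeasurableSet K.toSet := measurableSet_cbox _ _

theorem obox_subset_interior : obox K.lo K.hi ⊆ interior K.toSet :=
  interior_maximal (fun _ hx i => ⟨(hx i).1.le, (hx i).2.le⟩) (isOpen_obox _ _)

variable {K} in
theorem ext_of {K' : Rect d} (h : ∀ i, K.lo i = K'.lo i ∧ K.hi i = K'.hi i) : K = K' := by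
  cases K; cases K'
  congr
  · exact funext fun i => (h i).1
  · exact funext fun i => (h i).2

/-- The vertex of `K` selected by `τ` (`true` for the upper end). -/
def vertex (τ : Fin d → Bool) : E d := WithLp.toLp 2 fun i => if τ i then K.hi i else K.lo i

theorem vertex_apply (τ : Fin d → Bool) (i : Fin d) :
    K.vertex τ i = if τ i then K.hi i else K.lo i := rfl

theorem vertex_mem (τ : Fin d → Bool) : K.vertex τ ∈ K.toSet := by
  intro i
  have := K.lt i
  rw [vertex_apply]
  split_ifs <;> constructor <;> linarith

theorem vertex_injective : Function.Injective K.vertex := by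
  intro τ τ' h
  funext i
  have hi : K.vertex τ i = K.vertex τ' i := by rw [h]
  rw [vertex_apply, vertex_apply] at hi
  have := K.lt i
  cases h1 : τ i <;> cases h2 : τ' i <;> simp [h1, h2] at hi ⊢ <;> linarith

end Rect

/-! ### Conformity coordinate by coordinate, and the cells around a vertex. -/

namespace RectMesh

variable {d : ℕ} {Ω : Set (E d)} (𝒯 : RectMesh Ω)

/-- Two cells that meet agree, or only touch, in every coordinate. -/
theorem coord_cases {K K' : Rect d} (hK : K ∈ 𝒯.cells) (hK' : K' ∈ 𝒯.cells) {x : E d}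
    (hx : x ∈ K.toSet) (hx' : x ∈ K'.toSet) (i : Fin d) :
    (K.lo i = K'.lo i ∧ K.hi i = K'.hi i) ∨ K.hi i = K'.lo i ∨ K.lo i = K'.hi i := by
  by_cases hKK : K = K'
  · subst hKK; exact Or.inl ⟨rfl, rfl⟩
  have hlt := K.lt i
  have hlt' := K'.lt i
  -- The bounds of a box that represents the intersection are forced: moving only the i-th
  -- coordinate of the common point x reads off the i-th interval.
  have key : ∀ {l u : Fin d → ℝ}, K.toSet ∩ K'.toSet = {x | ∀ i, l i ≤ x i ∧ x i ≤ u i} →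
      l i = max (K.lo i) (K'.lo i) ∧ u i = min (K.hi i) (K'.hi i) := by
    intro l u hlu
    have hxl : x ∈ {x : E d | ∀ i, l i ≤ x i ∧ x i ≤ u i} := hlu ▸ ⟨hx, hx'⟩
    have hmod : ∀ s : ℝ, (WithLp.toLp 2 (Function.update x.ofLp i s) : E d) ∈ K.toSet ∩ K'.toSet ↔
        (l i ≤ s ∧ s ≤ u i) := by
      intro s
      rw [hlu]
      constructor
      · intro h
        simpa using h i
      · intro h j
        by_cases hj : j = i
        · subst hj; simpa using h
        · simpa [hj] using hxl j
    have hmod' : ∀ s : ℝ, (WithLp.toLp 2 (Function.update x.ofLp i s) : E d) ∈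
        K.toSet ∩ K'.toSet ↔ (max (K.lo i) (K'.lo i) ≤ s ∧ s ≤ min (K.hi i) (K'.hi i)) := by
      intro s
      constructor
      · intro h
        have h1 := h.1 i
        have h2 := h.2 i
        simp only [Function.update_self] at h1 h2
        exact ⟨max_le h1.1 h2.1, le_min h1.2 h2.2⟩
      · intro h
        constructor <;> intro j <;> by_cases hj : j = i
        · subst hj; simp only [Function.update_self]
          exact ⟨(le_max_left _ _).trans h.1, h.2.trans (min_le_left _ _)⟩
        · simpa [hj] using hx j
        · subst hj; simp only [Function.update_self]
          exact ⟨(le_max_right _ _).trans h.1, h.2.trans (min_le_right _ _)⟩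
        · simpa [hj] using hx' j
    have hiff : ∀ s : ℝ, (l i ≤ s ∧ s ≤ u i) ↔
        (max (K.lo i) (K'.lo i) ≤ s ∧ s ≤ min (K.hi i) (K'.hi i)) := fun s =>
      (hmod s).symm.trans (hmod' s)
    have hne := (hxl i).1.trans (hxl i).2
    have hne' : max (K.lo i) (K'.lo i) ≤ min (K.hi i) (K'.hi i) := by
      have := (hiff (x i)).1 (hxl i); exact this.1.trans this.2
    exact ⟨le_antisymm ((hiff _).2 ⟨le_rfl, hne'⟩).1 ((hiff _).1 ⟨le_rfl, hne⟩).1,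
      le_antisymm ((hiff _).1 ⟨hne, le_rfl⟩).2 ((hiff _).2 ⟨hne', le_rfl⟩).2⟩
  obtain ⟨⟨l, u, hlu, hf⟩, ⟨l', u', hlu', hf'⟩⟩ := 𝒯.conforming K hK K' hK' hKK ⟨x, hx, hx'⟩
  obtain ⟨e1, e2⟩ := key hlu
  obtain ⟨e1', e2'⟩ := key hlu'
  have a := hf i
  have a' := hf' i
  rw [e1, e2] at a
  rw [e1', e2'] at a'
  -- The i-th interval of the intersection is the full interval or an endpoint of each of the two
  -- cells; only equality and touching survive.
  rcases max_cases (K.lo i) (K'.lo i) with ⟨m1, _⟩ | ⟨m1, _⟩ <;>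
  rcases min_cases (K.hi i) (K'.hi i) with ⟨m2, _⟩ | ⟨m2, _⟩ <;> rw [m1, m2] at a a' <;>
  grind

theorem eq_of_mem_obox {K K' : Rect d} (hK : K ∈ 𝒯.cells) (hK' : K' ∈ 𝒯.cells) {x : E d}
    (hx : x ∈ obox K.lo K.hi) (hx' : x ∈ K'.toSet) : K = K' := by
  have hxK : x ∈ K.toSet := fun i => ⟨(hx i).1.le, (hx i).2.le⟩
  refine Rect.ext_of fun i => ?_
  rcases 𝒯.coord_cases hK hK' hxK hx' i with h | h | h
  · exact h
  · have := (hx i).2; have := (hx' i).1; linarith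
  · have := (hx i).1; have := (hx' i).2; linarith

/-- Distinct cells that meet differ in some coordinate, and there they only touch, so the
intersection lies in a hyperplane. -/
theorem volume_inter_eq_zero {K K' : Rect d} (hK : K ∈ 𝒯.cells) (hK' : K' ∈ 𝒯.cells)
    (hne : K ≠ K') : volume (K.toSet ∩ K'.toSet) = 0 := by
  by_cases hx : (K.toSet ∩ K'.toSet).Nonempty
  · obtain ⟨x, hx, hx'⟩ := hx
    have : ∃ i, ¬ (K.lo i = K'.lo i ∧ K.hi i = K'.hi i) := by
      by_contra h
      push Not at h
      exact hne (Rect.ext_of h)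
    obtain ⟨i, hi⟩ := this
    rcases (𝒯.coord_cases hK hK' hx hx' i).resolve_left hi with h | h
    · refine measure_mono_null ?_ (volume_hyperplane i (K.hi i))
      exact fun y hy => le_antisymm (hy.1 i).2 (h ▸ (hy.2 i).1)
    · refine measure_mono_null ?_ (volume_hyperplane i (K.lo i))
      exact fun y hy => le_antisymm (h ▸ (hy.2 i).2) (hy.1 i).1
  · rw [not_nonempty_iff_eq_empty.1 hx, measure_empty]

theorem pairwise_null :
    ((𝒯.cells : Set (Rect d))).Pairwise fun K K' => volume (K.toSet ∩ K'.toSet) = 0 :=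
  fun _ hK _ hK' hne => 𝒯.volume_inter_eq_zero hK hK' hne

theorem obox_subset {K : Rect d} (hK : K ∈ 𝒯.cells) : obox K.lo K.hi ⊆ Ω :=
  K.obox_subset_interior.trans (𝒯.interior_subset K hK)

theorem exists_cell {x : E d} (hx : x ∈ closure Ω) : ∃ K ∈ 𝒯.cells, x ∈ K.toSet := by
  rw [← 𝒯.cover] at hx
  simpa using hx

theorem cell_subset_closure {K : Rect d} (hK : K ∈ 𝒯.cells) : K.toSet ⊆ closure Ω := by
  rw [← 𝒯.cover]
  exact subset_biUnion_of_mem (u := fun K : Rect d => K.toSet) hK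

theorem volume_ne_top (𝒯 : RectMesh Ω) : volume Ω ≠ ⊤ := by
  have : IsCompact (closure Ω) := by
    rw [← 𝒯.cover]
    exact 𝒯.cells.isCompact_biUnion fun K _ => K.isCompact_toSet
  exact ne_top_of_le_ne_top this.measure_lt_top.ne (measure_mono subset_closure)

/-- `z` is a vertex of `K`. -/
def _root_.WaveLOD.Rect.IsVertex (K : Rect d) (z : E d) : Prop :=
  ∀ i, z i = K.lo i ∨ z i = K.hi i

theorem _root_.WaveLOD.Rect.IsVertex.mem {K : Rect d} {z : E d} (h : K.IsVertex z) :
    z ∈ K.toSet := by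
  intro i
  have := K.lt i
  rcases h i with h | h <;> constructor <;> linarith

theorem _root_.WaveLOD.Rect.isVertex_vertex (K : Rect d) (τ : Fin d → Bool) :
    K.IsVertex (K.vertex τ) := by
  intro i
  rw [Rect.vertex_apply]
  split_ifs <;> simp

/-- A cell containing a vertex of another cell has it as a vertex. -/
theorem isVertex_of_mem {K K' : Rect d} (hK : K ∈ 𝒯.cells) (hK' : K' ∈ 𝒯.cells) {z : E d}
    (hz : K.IsVertex z) (hz' : z ∈ K'.toSet) : K'.IsVertex z := by
  intro i
  rcases 𝒯.coord_cases hK hK' hz.mem hz' i with h | h | h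
  · rw [← h.1, ← h.2]; exact hz i
  · left; refine le_antisymm ?_ (hz' i).1
    rw [← h]; exact (hz.mem i).2
  · right; refine le_antisymm (hz' i).2 ?_
    rw [← h]; exact (hz.mem i).1

/-- `K` is the cell at its vertex `z` in the orthant of signs `s`. -/
def _root_.WaveLOD.Rect.AtOrthant (K : Rect d) (z : E d) (s : Fin d → Bool) : Prop :=
  ∀ i, z i = if s i then K.lo i else K.hi i

theorem _root_.WaveLOD.Rect.AtOrthant.isVertex {K : Rect d} {z : E d} {s : Fin d → Bool}
    (h : K.AtOrthant z s) : K.IsVertex z := by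
  intro i
  have := h i
  split_ifs at this <;> simp [this]

theorem _root_.WaveLOD.Rect.IsVertex.exists_orthant {K : Rect d} {z : E d} (h : K.IsVertex z) :
    ∃ s, K.AtOrthant z s := by
  classical
  refine ⟨fun i => decide (z i = K.lo i), fun i => ?_⟩
  rcases h i with h | h
  · simp [h]
  · simp [h]

/-- Cells at z on the same side of z in coordinate i cannot merely touch there. So the cells around
z share their widths side by side, and their union has a tensor-product structure; this is what
makes nodal functions products of hats. -/
theorem orthant_width {K K' : Rect d} (hK : K ∈ 𝒯.cells) (hK' : K' ∈ 𝒯.cells) {z : E d}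
    {s s' : Fin d → Bool} (h : K.AtOrthant z s) (h' : K'.AtOrthant z s') {i : Fin d}
    (hi : s i = s' i) : K.lo i = K'.lo i ∧ K.hi i = K'.hi i := by
  have h1 := h i
  have h2 := h' i
  have := K.lt i
  have := K'.lt i
  rw [hi] at h1
  rcases 𝒯.coord_cases hK hK' h.isVertex.mem h'.isVertex.mem i with a | a | a
  · exact a
  · split_ifs at h1 h2 <;> linarith
  · split_ifs at h1 h2 <;> linarith

theorem eq_of_orthant {K K' : Rect d} (hK : K ∈ 𝒯.cells) (hK' : K' ∈ 𝒯.cells) {z : E d}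
    {s : Fin d → Bool} (h : K.AtOrthant z s) (h' : K'.AtOrthant z s) : K = K' :=
  Rect.ext_of fun _ => 𝒯.orthant_width hK hK' h h' rfl

/-- The open orthant cube of side `ρ` at `z`. -/
def orthant (z : E d) (s : Fin d → Bool) (ρ : ℝ) : Set (E d) :=
  obox (fun i => if s i then z i else z i - ρ) (fun i => if s i then z i + ρ else z i)

-- The cells are finitely many and closed, so a small enough box around z meets only cells
-- containing z, and is narrower than every cell.
open Filter Topology in
theorem eventually_local (z : E d) : ∀ᶠ ρ in 𝓝[>] (0:ℝ), ∀ K ∈ 𝒯.cells,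
    (∀ i, ρ ≤ K.hi i - K.lo i) ∧ ∀ x ∈ K.toSet, (∀ i, |x i - z i| ≤ ρ) → z ∈ K.toSet := by
  rw [eventually_all_finset]
  intro K _
  refine Eventually.and ?_ ?_
  · rw [eventually_all]
    intro i
    have : (0:ℝ) < K.hi i - K.lo i := sub_pos.2 (K.lt i)
    exact eventually_nhdsWithin_of_eventually_nhds
      ((eventually_lt_nhds this).mono fun _ h => h.le)
  · by_cases hz : z ∈ K.toSet
    · exact Eventually.of_forall fun _ _ _ _ => hz
    · have : ∃ i, ¬ (K.lo i ≤ z i ∧ z i ≤ K.hi i) := by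
        by_contra h; push Not at h; exact hz h
      obtain ⟨i, hi⟩ := this
      rw [not_and_or, not_le, not_le] at hi
      rcases hi with hi | hi
      · filter_upwards [eventually_nhdsWithin_of_eventually_nhds
          (eventually_lt_nhds (sub_pos.2 hi))] with ρ hρ x hx hxz
        have := (abs_le.1 (hxz i)).2; have := (hx i).1; linarith
      · filter_upwards [eventually_nhdsWithin_of_eventually_nhds
          (eventually_lt_nhds (sub_pos.2 hi))] with ρ hρ x hx hxz
        have := (abs_le.1 (hxz i)).1; have := (hx i).2; linarith

theorem abs_le_of_mem_orthant {z x : E d} {s : Fin d → Bool} {ρ : ℝ}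
    (h : x ∈ orthant z s ρ) (i : Fin d) : |x i - z i| ≤ ρ := by
  have := h i
  beta_reduce at this
  rw [abs_le]
  split_ifs at this <;> constructor <;> linarith

/-- A cell near `z` that meets an orthant of `z` is the cell of that orthant. -/
theorem atOrthant_of_mem {K : Rect d} {z x : E d} {s : Fin d → Bool} {ρ : ℝ}
    (hz : K.IsVertex z) (hx : x ∈ orthant z s ρ) (hxK : x ∈ K.toSet) : K.AtOrthant z s := by
  intro i
  have h1 := hx i
  have h2 := hxK i
  beta_reduce at h1
  rcases hz i with h | h <;> split_ifs at h1 ⊢ <;> first | exact h | (exfalso; linarith)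

theorem orthant_subset {K : Rect d} {z : E d} {s : Fin d → Bool} {ρ : ℝ}
    (h : K.AtOrthant z s) (hρ : ∀ i, ρ ≤ K.hi i - K.lo i) : orthant z s ρ ⊆ obox K.lo K.hi := by
  intro x hx i
  have h1 := hx i
  have h2 := h i
  have h3 := hρ i
  beta_reduce at h1
  split_ifs at h1 h2 <;> constructor <;> linarith

end RectMesh

/-- Just below the graph there is an open set disjoint from Ω, so no boundary point is interior to
the closure. This excludes slits, and it is the only consequence of the Lipschitz condition that is
used. -/
theorem interior_closure_of_lipschitz {d : ℕ} {Ω : Set (E d)} (hΩ : IsOpen Ω)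
    (hL : HasLipschitzBoundary Ω) : interior (closure Ω) = Ω := by
  refine Subset.antisymm ?_ (hΩ.subset_interior_closure)
  intro x hx
  by_contra hxΩ
  have hxf : x ∈ frontier Ω := by
    rw [frontier, hΩ.interior_eq]
    exact ⟨interior_subset hx, hxΩ⟩
  obtain ⟨e, r, L, g, he, hr, hLip, hinv, hball⟩ := hL x hxf
  have hgx : inner ℝ e x ≤ g x := by
    by_contra h
    exact hxΩ ((hball x (Metric.mem_ball_self hr)).2 (not_le.1 h))
  have hopen : IsOpen (interior (closure Ω) ∩ Metric.ball x r) :=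
    isOpen_interior.inter Metric.isOpen_ball
  obtain ⟨ε, hε, hεs⟩ := Metric.isOpen_iff.1 hopen x ⟨hx, Metric.mem_ball_self hr⟩
  -- Moving against e lowers the height but not g, so y lies strictly below the graph while still
  -- inside the closure of Ω.
  set y := x - (ε / 2) • e with hy
  have hyx : dist y x < ε := by
    rw [hy, dist_eq_norm, sub_sub_cancel_left, norm_neg, norm_smul, he, mul_one, Real.norm_eq_abs,
      abs_of_pos (half_pos hε)]
    linarith
  have hyin := hεs hyx
  have hgy : g y = g x := by
    have := hinv y (ε / 2)
    rw [hy, sub_add_cancel] at this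
    rw [← this]
  have hlt : inner ℝ e y < g y := by
    rw [hgy, hy, inner_sub_right, real_inner_smul_right, real_inner_self_eq_norm_sq, he]
    linarith
  have hU : IsOpen ({y | inner ℝ e y < g y} ∩ Metric.ball x r) :=
    (isOpen_lt (by fun_prop) hLip.continuous).inter Metric.isOpen_ball
  obtain ⟨w, hw1, hw2⟩ := mem_closure_iff.1 (interior_subset hyin.1) _ hU ⟨hlt, hyin.2⟩
  exact absurd ((hball w hw1.2).1 hw2) (not_lt.2 (le_of_lt hw1.1))

/-! ### Full stars at interior vertices, missing orthants at the others. -/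

namespace RectMesh

variable {d : ℕ} {Ω : Set (E d)} (𝒯 : RectMesh Ω)

theorem exists_atOrthant_of_mem (hΩ : IsOpen Ω) {K₀ : Rect d} (hK₀ : K₀ ∈ 𝒯.cells) {z : E d}
    (hz : K₀.IsVertex z) (hzΩ : z ∈ Ω) (s : Fin d → Bool) :
    ∃ K ∈ 𝒯.cells, K.AtOrthant z s := by
  have hev : ∀ᶠ ρ in nhdsWithin (0:ℝ) (Ioi 0),
      (WithLp.toLp 2 fun i => if s i then z i + ρ / 2 else z i - ρ / 2 : E d) ∈ Ω := by
    refine eventually_nhdsWithin_of_eventually_nhds ?_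
    have hc : Continuous fun ρ : ℝ =>
        (WithLp.toLp 2 fun i => if s i then z i + ρ / 2 else z i - ρ / 2 : E d) := by
      refine (PiLp.continuous_toLp 2 _).comp (continuous_pi fun i => ?_)
      split_ifs <;> fun_prop
    refine hc.continuousAt.eventually (hΩ.mem_nhds ?_)
    simpa using hzΩ
  obtain ⟨ρ, ⟨h1, h2⟩, h3⟩ := ((𝒯.eventually_local z).and hev |>.and
    self_mem_nhdsWithin).exists
  have hρ : (0:ℝ) < ρ := h3
  obtain ⟨K, hK, hxK⟩ := 𝒯.exists_cell (subset_closure h2)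
  have hxo : (WithLp.toLp 2 fun i => if s i then z i + ρ / 2 else z i - ρ / 2 : E d) ∈
      orthant z s ρ := by
    intro i
    simp only
    split_ifs <;> constructor <;> linarith
  have hzK := (h1 K hK).2 _ hxK (abs_le_of_mem_orthant hxo)
  exact ⟨K, hK, atOrthant_of_mem (𝒯.isVertex_of_mem hK₀ hK hz hzK) hxo hxK⟩

/-- If all orthants at z were occupied, the cells would fill a neighbourhood of z and z would be
interior to the closure, hence in Ω. The missing orthant is where the zero boundary value is felt.
-/
theorem exists_not_atOrthant (hic : interior (closure Ω) = Ω) {z : E d}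
    (hzΩ : z ∉ Ω) : ∃ s : Fin d → Bool, ∀ K ∈ 𝒯.cells, ¬ K.AtOrthant z s := by
  classical
  by_contra! hall
  choose K hK hKs using hall
  obtain ⟨ρ, h1, h3⟩ := ((𝒯.eventually_local z).and self_mem_nhdsWithin).exists
  have hρ : (0:ℝ) < ρ := h3
  refine hzΩ ?_
  rw [← hic]
  have hsub : obox (fun i => z i - ρ) (fun i => z i + ρ) ⊆ closure Ω := by
    intro x hx
    set s : Fin d → Bool := fun i => decide (z i ≤ x i)
    refine 𝒯.cell_subset_closure (hK s) fun i => ?_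
    have a := hKs s i
    have b := (h1 _ (hK s)).1 i
    have c := hx i
    by_cases hi : z i ≤ x i
    · simp only [s, hi, decide_true, if_true] at a
      constructor <;> linarith
    · simp only [s, hi, decide_false, Bool.false_eq_true, if_false] at a
      push Not at hi
      constructor <;> linarith
  exact interior_maximal hsub (isOpen_obox _ _) fun i => ⟨by linarith, by linarith⟩

end RectMesh

/-! ### Continuity of piecewise continuous functions in `H¹₀(Ω)` at the nodes -/

namespace RectMesh

variable {d : ℕ} {Ω : Set (E d)} (𝒯 : RectMesh Ω)

open Filter Topology

/-- If the extension by zero of an `H¹₀` function has continuous representatives in two adjacent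
orthants at `z`, then their values at `z` agree. -/
theorem eq_of_adjacent (w : H10 Ω) {z : E d} {G G' : E d → ℝ} (hG : ContinuousAt G z)
    (hG' : ContinuousAt G' z) (hGc : Measurable G) (hGc' : Measurable G')
    {s : Fin d → Bool} {i : Fin d} (hi : s i = false) {ρ : ℝ}
    (hρ : 0 < ρ)
    (h : ∀ S ⊆ orthant z s ρ, MeasurableSet S →
      ∫ x in S, val w x ∂(volume.restrict Ω) = ∫ x in S, G x)
    (h' : ∀ S ⊆ orthant z (Function.update s i true) ρ, MeasurableSet S →
      ∫ x in S, val w x ∂(volume.restrict Ω) = ∫ x in S, G' x) : G z = G' z := by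
  by_contra hne
  set δ := |G' z - G z| with hδ
  have hδ0 : 0 < δ := abs_pos.2 (sub_ne_zero.2 (Ne.symm hne))
  have hev : ∀ᶠ x in 𝓝 z, ‖G x - G z‖ ≤ δ / 4 ∧ ‖G' x - G' z‖ ≤ δ / 4 := by
    have e1 := Metric.continuousAt_iff'.1 hG (δ / 4) (by positivity)
    have e2 := Metric.continuousAt_iff'.1 hG' (δ / 4) (by positivity)
    filter_upwards [e1, e2] with x h1 h2
    rw [dist_eq_norm] at h1 h2
    exact ⟨h1.le, h2.le⟩
  obtain ⟨ε, hε, hball⟩ := Metric.eventually_nhds_iff.1 hev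
  -- a coordinate radius inside both `ε` and `ρ`
  obtain ⟨r, hr0, hrρ, hrε⟩ : ∃ r : ℝ, 0 < r ∧ r ≤ ρ ∧ ∀ x : E d, (∀ j, |x j - z j| ≤ r) →
      dist x z < ε := by
    -- The factor √d converts a coordinate bound into a Euclidean one; adding one makes the
    -- inequality strict.
    refine ⟨min ρ (ε / (√d + 1)), by positivity, min_le_left _ _, fun x hx => ?_⟩
    rw [dist_eq_norm]
    have := norm_le_of_coord (v := x - z) (C := ε / (√d + 1)) (by positivity)
      (fun j => (hx j).trans (min_le_right _ _))
    refine this.trans_lt ?_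
    rw [mul_div_assoc', div_lt_iff₀ (by positivity)]
    nlinarith [Real.sqrt_nonneg (d:ℝ)]
  set c := ∏ _j ∈ Finset.univ.erase i, r with hc
  have hc0 : 0 < c := Finset.prod_pos fun _ _ => hr0
  -- A slab of thickness t on one side of the common face is translated by t across it. A jump δ
  -- changes the integral by at least δ/2 times the volume tc, while the translation estimate allows
  -- only t√(tc) times the gradient norm. Squaring gives the claim, which fails as t tends to 0.
  have key : ∀ t, 0 < t → t ≤ r → δ ^ 2 * c ≤ 4 * t * ‖grad w‖ ^ 2 := by
    intro t ht htr
    set e : E d := EuclideanSpace.single i 1 with he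
    have hen : ‖e‖ ≤ 1 := by simp [he]
    set lo : Fin d → ℝ := Function.update (fun j => if s j then z j else z j - r) i (z i - t) with hlo
    set hi' : Fin d → ℝ := Function.update (fun j => if s j then z j + r else z j) i (z i) with hhi
    set B := obox lo hi' with hB
    have hBm : MeasurableSet B := (isOpen_obox _ _).measurableSet
    have hlohi : ∀ j, lo j ≤ hi' j := by
      intro j
      by_cases hj : j = i
      · subst hj; simp [hlo, hhi]; linarith
      · simp only [hlo, hhi, Function.update_of_ne hj]; split_ifs <;> linarith
    have hvol : volume.real B = t * c := by
      rw [hB, volume_real_obox hlohi, ← Finset.mul_prod_erase _ _ (Finset.mem_univ i)]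
      congr 1
      · simp [hlo, hhi]
      · refine Finset.prod_congr rfl fun j hj => ?_
        have hj := Finset.ne_of_mem_erase hj
        simp only [hlo, hhi, Function.update_of_ne hj]; split_ifs <;> ring
    have hBin : B ⊆ orthant z s r := by
      intro x hx j
      have := hx j
      by_cases hj : j = i
      · subst hj; simp [hlo, hhi, hi] at this ⊢; constructor <;> linarith
      · simpa only [hlo, hhi, Function.update_of_ne hj] using this
    set B' := {y : E d | y - t • e ∈ B} with hB'
    have hB'in : B' ⊆ orthant z (Function.update s i true) r := by
      intro x hx j
      have := hx j
      by_cases hj : j = i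
      · subst hj; simp [hlo, hhi, he] at this ⊢; constructor <;> linarith
      · simpa [hlo, hhi, Function.update_of_ne hj, he, hj] using this
    have hB'm : MeasurableSet B' := measurableSet_shift hBm _
    have hB'f : volume B' ≠ ⊤ := by rw [hB', volume_shift]; exact volume_obox_ne_top _ _
    have hmono : ∀ s', orthant z s' r ⊆ orthant z s' ρ := by
      intro s' x hx j
      have := hx j
      beta_reduce at this ⊢
      split_ifs at this ⊢ <;> constructor <;> linarith
    have hjump := abs_setIntegral_shift_sub_le w hBm (volume_obox_ne_top _ _) hen ht.le
    rw [h' B' (hB'in.trans (hmono _)) hB'm, h B (hBin.trans (hmono _)) hBm] at hjump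
    have hnear : ∀ {s' : Fin d → Bool} {S : Set (E d)} {F : E d → ℝ}, S ⊆ orthant z s' r →
        MeasurableSet S → volume S ≠ ⊤ → Measurable F →
        (∀ x, dist x z < ε → ‖F x - F z‖ ≤ δ / 4) →
        |(∫ x in S, F x) - F z * volume.real S| ≤ δ / 4 * volume.real S := by
      intro s' S F hS hSm hSf hF hFz
      have hb : ∀ x ∈ S, ‖F x - F z‖ ≤ δ / 4 := fun x hx =>
        hFz x (hrε x (abs_le_of_mem_orthant (hS hx)))
      have hint : IntegrableOn (fun x => F x - F z) S := by
        refine IntegrableOn.of_bound hSf.lt_top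
          (hF.sub_const _).aestronglyMeasurable (δ / 4) ?_
        exact (ae_restrict_iff' hSm).2 (Eventually.of_forall hb)
      have hcint : IntegrableOn (fun _ => F z) S := integrableOn_const hSf
      have : (∫ x in S, F x) - F z * volume.real S = ∫ x in S, (F x - F z) := by
        have e1 : ∫ x in S, F x = ∫ x in S, ((F x - F z) + F z) := by simp
        rw [e1, integral_add hint hcint, setIntegral_const, smul_eq_mul]; ring
      rw [this]
      exact norm_setIntegral_le_of_norm_le_const hSf.lt_top hb
    have n1 := hnear hBin hBm (volume_obox_ne_top _ _) hGc fun x hx => (hball hx).1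
    have n2 := hnear hB'in hB'm hB'f hGc' fun x hx => (hball hx).2
    have hBB : volume.real B' = volume.real B := by
      rw [measureReal_def, measureReal_def, hB', volume_shift]
    rw [hBB] at n2
    set V := volume.real B with hV
    have hVpos : 0 < V := by rw [hvol]; positivity
    have hmain : δ / 2 * V ≤ t * √V * ‖grad w‖ := by
      have : δ * V = |(G' z - G z) * V| := by rw [abs_mul, abs_of_pos hVpos]
      have htri : |(G' z - G z) * V| ≤ |(∫ x in B', G' x) - ∫ x in B, G x| +
          (δ / 4 * V + δ / 4 * V) := by
        have : (G' z - G z) * V = ((∫ x in B', G' x) - ∫ x in B, G x) +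
            (-((∫ x in B', G' x) - G' z * V) + ((∫ x in B, G x) - G z * V)) := by ring
        rw [this]
        refine (abs_add_le _ _).trans (add_le_add le_rfl ((abs_add_le _ _).trans ?_))
        rw [abs_neg]
        exact add_le_add n2 n1
      linarith
    have hsq := Real.sq_sqrt hVpos.le
    have hs0 : 0 < √V := Real.sqrt_pos.2 hVpos
    have h2 : δ / 2 * √V ≤ t * ‖grad w‖ := by
      have : (δ / 2 * √V) * √V ≤ (t * ‖grad w‖) * √V := by nlinarith
      exact le_of_mul_le_mul_right this hs0
    have h3 : (δ / 2 * √V) ^ 2 ≤ (t * ‖grad w‖) ^ 2 := pow_le_pow_left₀ (by positivity) h2 2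
    rw [mul_pow, hsq, hvol] at h3
    have h4 : t * (δ ^ 2 * c) ≤ t * (4 * t * ‖grad w‖ ^ 2) := by nlinarith
    exact le_of_mul_le_mul_left h4 ht
  have hlim : Tendsto (fun t : ℝ => 4 * t * ‖grad w‖ ^ 2) (𝓝[>] 0) (𝓝 0) := by
    have : Tendsto (fun t : ℝ => 4 * t * ‖grad w‖ ^ 2) (𝓝 0) (𝓝 (4 * 0 * ‖grad w‖ ^ 2)) :=
      (by fun_prop : Continuous fun t : ℝ => 4 * t * ‖grad w‖ ^ 2).tendsto 0
    simpa using this.mono_left nhdsWithin_le_nhds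
  have : δ ^ 2 * c ≤ 0 := by
    refine ge_of_tendsto hlim ?_
    filter_upwards [self_mem_nhdsWithin,
      eventually_nhdsWithin_of_eventually_nhds (eventually_lt_nhds hr0)] with t h1 h2
    exact key t h1 h2.le
  have : 0 < δ ^ 2 * c := by positivity
  linarith

/-- Continuous local representatives of an `H¹₀` function agree at common vertices, and vanish at
vertices outside `Ω`. -/
theorem node_values (hic : interior (closure Ω) = Ω) (w : H10 Ω) {P : Rect d → E d → ℝ}
    (hP : ∀ K ∈ 𝒯.cells, Continuous (P K))
    (hw : ∀ K ∈ 𝒯.cells, ∀ᵐ x ∂(volume.restrict Ω), x ∈ K.toSet → val w x = P K x)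
    {K : Rect d} (hK : K ∈ 𝒯.cells) {z : E d} (hz : K.IsVertex z) :
    (∀ K' ∈ 𝒯.cells, z ∈ K'.toSet → P K z = P K' z) ∧ (z ∉ Ω → P K z = 0) := by
  classical
  -- An orthant without a cell carries the zero function: there the extension of w by zero is meant.
  set G : (Fin d → Bool) → E d → ℝ := fun s =>
    if h : ∃ K ∈ 𝒯.cells, K.AtOrthant z s then P h.choose else fun _ => 0 with hGdef
  have hGcell : ∀ {s K}, K ∈ 𝒯.cells → K.AtOrthant z s → G s = P K := by
    intro s K hK hs
    have h : ∃ K ∈ 𝒯.cells, K.AtOrthant z s := ⟨K, hK, hs⟩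
    simp only [hGdef, dif_pos h]
    rw [𝒯.eq_of_orthant h.choose_spec.1 hK h.choose_spec.2 hs]
  have hGcont : ∀ s, Continuous (G s) := by
    intro s
    by_cases h : ∃ K ∈ 𝒯.cells, K.AtOrthant z s
    · obtain ⟨K, hK, hs⟩ := h
      rw [hGcell hK hs]; exact hP K hK
    · simp only [hGdef, dif_neg h]; exact continuous_const
  obtain ⟨ρ, hloc, hρ⟩ := ((𝒯.eventually_local z).and self_mem_nhdsWithin).exists
  have hrep : ∀ s, ∀ S ⊆ orthant z s ρ, MeasurableSet S →
      ∫ x in S, val w x ∂(volume.restrict Ω) = ∫ x in S, G s x := by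
    intro s S hS hSm
    rw [Measure.restrict_restrict hSm]
    by_cases h : ∃ K ∈ 𝒯.cells, K.AtOrthant z s
    · obtain ⟨K, hK, hs⟩ := h
      have hSK : S ⊆ obox K.lo K.hi := hS.trans (orthant_subset hs (hloc K hK).1)
      have hSΩ : S ⊆ Ω := hSK.trans (𝒯.obox_subset hK)
      rw [inter_eq_left.2 hSΩ, hGcell hK hs]
      refine integral_congr_ae ?_
      have h1 := ae_restrict_of_ae_restrict_of_subset hSΩ (hw K hK)
      filter_upwards [h1, ae_restrict_mem hSm] with x h2 h3
      exact h2 fun i => ⟨(hSK h3 i).1.le, (hSK h3 i).2.le⟩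
    · have hempty : S ∩ Ω = ∅ := by
        rw [eq_empty_iff_forall_notMem]
        rintro x ⟨hxS, hxΩ⟩
        obtain ⟨K', hK', hxK'⟩ := 𝒯.exists_cell (subset_closure hxΩ)
        have hzK' := (hloc K' hK').2 x hxK' (abs_le_of_mem_orthant (hS hxS))
        exact h ⟨K', hK', atOrthant_of_mem (𝒯.isVertex_of_mem hK hK' hz hzK') (hS hxS) hxK'⟩
      rw [hempty]
      simp only [hGdef, dif_neg h]
      simp
  have hstep : ∀ s i, s i = false → G s z = G (Function.update s i true) z := fun s i hi =>
    eq_of_adjacent w (hGcont _).continuousAt (hGcont _).continuousAt (hGcont _).measurable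
      (hGcont _).measurable hi hρ (hrep s) (hrep _)
  have hupd : ∀ s i b, G s z = G (Function.update s i b) z := by
    intro s i b
    cases hb : b <;> cases hs : s i
    · rw [← hs, Function.update_eq_self]
    · rw [hstep (Function.update s i false) i (by simp), Function.update_idem, ← hs,
        Function.update_eq_self]
    · exact hstep s i hs
    · rw [← hs, Function.update_eq_self]
  -- Any two orthants are joined by flipping one sign at a time, each flip being a pair of adjacent
  -- orthants.
  have hall : ∀ (S : Finset (Fin d)) s s', (∀ i ∉ S, s i = s' i) → G s z = G s' z := by
    intro S
    induction S using Finset.induction_on with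
    | empty => intro s s' h; rw [funext fun i => h i (by simp)]
    | insert i S _ ih =>
      intro s s' h
      rw [hupd s i (s' i)]
      refine ih _ _ fun j hj => ?_
      by_cases hji : j = i
      · subst hji; simp
      · rw [Function.update_of_ne hji]; exact h j (by simp [hji, hj])
  have hconst : ∀ s s', G s z = G s' z := fun s s' => hall Finset.univ s s' (by simp)
  obtain ⟨s, hs⟩ := hz.exists_orthant
  refine ⟨fun K' hK' hz' => ?_, fun hzΩ => ?_⟩
  · obtain ⟨s', hs'⟩ := (𝒯.isVertex_of_mem hK hK' hz hz').exists_orthant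
    rw [← hGcell hK hs, ← hGcell hK' hs', hconst s s']
  · obtain ⟨s', hs'⟩ := 𝒯.exists_not_atOrthant hic hzΩ
    rw [← hGcell hK hs, hconst s s']
    have : ¬ ∃ K ∈ 𝒯.cells, K.AtOrthant z s' := by push Not; exact hs'
    simp only [hGdef, dif_neg this]

end RectMesh

/-! ### Multilinear shape functions -/

namespace Rect

variable {d : ℕ} (K : Rect d)

/-- The univariate shape functions of `K`. -/
def shape1 (b : Bool) (i : Fin d) (t : ℝ) : ℝ :=
  if b then (t - K.lo i) / (K.hi i - K.lo i) else (K.hi i - t) / (K.hi i - K.lo i)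

/-- The multilinear shape function of `K` at the vertex `τ`. -/
def shape (τ : Fin d → Bool) (x : E d) : ℝ := ∏ i, K.shape1 (τ i) i (x i)

/-- The multilinear function with values `c` at the vertices. -/
def multilin (c : (Fin d → Bool) → ℝ) (x : E d) : ℝ := ∑ τ, c τ * K.shape τ x

theorem shape1_contDiff (b : Bool) (i : Fin d) : ContDiff ℝ ∞ (K.shape1 b i) := by
  unfold shape1
  cases b
  · simp only [Bool.false_eq_true, if_false]; fun_prop
  · simp only [if_true]; fun_prop

theorem shape_contDiff (τ : Fin d → Bool) : ContDiff ℝ ∞ (K.shape τ) :=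
  contDiff_tensor (h := fun i => K.shape1 (τ i) i) fun i => K.shape1_contDiff _ i

theorem multilin_contDiff (c : (Fin d → Bool) → ℝ) : ContDiff ℝ ∞ (K.multilin c) :=
  ContDiff.sum fun τ _ => contDiff_const.mul (K.shape_contDiff τ)

theorem shape1_vertex (b b' : Bool) (i : Fin d) :
    K.shape1 b i (if b' then K.hi i else K.lo i) = if b = b' then 1 else 0 := by
  have h : K.hi i - K.lo i ≠ 0 := (sub_pos.2 (K.lt i)).ne'
  cases b <;> cases b' <;> simp [shape1, h]

theorem shape_vertex (τ τ' : Fin d → Bool) : K.shape τ (K.vertex τ') = if τ = τ' then 1 else 0 := by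
  simp only [shape, vertex_apply, shape1_vertex]
  rw [Finset.prod_ite_zero]
  simp [funext_iff]

theorem multilin_vertex (c : (Fin d → Bool) → ℝ) (τ : Fin d → Bool) :
    K.multilin c (K.vertex τ) = c τ := by
  simp [multilin, shape_vertex]

/-- Polynomials of coordinate degree at most one are determined by their vertex values. -/
theorem eval_eq_multilin {p : MvPolynomial (Fin d) ℝ}
    (hp : p ∈ MvPolynomial.restrictDegree (Fin d) ℝ 1) (x : E d) :
    MvPolynomial.eval x p = K.multilin (fun τ => MvPolynomial.eval (K.vertex τ) p) x := by
  -- Each factor of a monomial has degree at most one in its variable and so equals its linear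
  -- interpolant; expanding the product of the interpolants gives the sum over the vertices.
  have hmono : ∀ s ∈ p.support, ∏ i, x i ^ s i =
      ∑ τ, (∏ i, K.vertex τ i ^ s i) * K.shape τ x := by
    intro s hs
    have hle := (MvPolynomial.mem_restrictDegree _ _ _).1 hp s hs
    have h1 : ∀ i, x i ^ s i = ∑ b : Bool,
        (if b then K.hi i else K.lo i) ^ s i * K.shape1 b i (x i) := by
      intro i
      have h : K.hi i - K.lo i ≠ 0 := (sub_pos.2 (K.lt i)).ne'
      have := hle i
      rw [Fintype.sum_bool]
      interval_cases s i <;> simp [shape1] <;> field_simp <;> ring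
    simp only [h1]
    rw [Finset.prod_univ_sum]
    simp only [Fintype.piFinset_univ, Finset.prod_mul_distrib]
    rfl
  simp only [multilin, MvPolynomial.eval_eq', Finset.sum_mul]
  rw [Finset.sum_comm]
  refine Finset.sum_congr rfl fun s hs => ?_
  simp only [mul_assoc]
  rw [← Finset.mul_sum, ← hmono s hs]

/-- The shape functions as polynomials. -/
def shapePoly (τ : Fin d → Bool) : MvPolynomial (Fin d) ℝ :=
  ∏ i, if τ i then MvPolynomial.C (K.hi i - K.lo i)⁻¹ * (MvPolynomial.X i - MvPolynomial.C (K.lo i))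
    else MvPolynomial.C (K.hi i - K.lo i)⁻¹ * (MvPolynomial.C (K.hi i) - MvPolynomial.X i)

theorem eval_shapePoly (τ : Fin d → Bool) (x : E d) :
    MvPolynomial.eval x (K.shapePoly τ) = K.shape τ x := by
  rw [shapePoly, map_prod, shape]
  refine Finset.prod_congr rfl fun i _ => ?_
  cases τ i <;> simp [shape1, div_eq_inv_mul]

theorem shapePoly_mem (τ : Fin d → Bool) :
    K.shapePoly τ ∈ MvPolynomial.restrictDegree (Fin d) ℝ 1 := by
  rw [MvPolynomial.mem_restrictDegree]
  intro s hs j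
  refine (MvPolynomial.degreeOf_le_iff.1 ?_ s hs)
  refine (MvPolynomial.degreeOf_prod_le j _ _).trans ?_
  have hX : ∀ i, MvPolynomial.degreeOf j (MvPolynomial.X i : MvPolynomial (Fin d) ℝ) =
      if j = i then 1 else 0 := fun i => MvPolynomial.degreeOf_X j i
  have hbound : ∀ i ∈ Finset.univ, MvPolynomial.degreeOf j (if τ i then
      MvPolynomial.C (K.hi i - K.lo i)⁻¹ * (MvPolynomial.X i - MvPolynomial.C (K.lo i))
    else MvPolynomial.C (K.hi i - K.lo i)⁻¹ * (MvPolynomial.C (K.hi i) - MvPolynomial.X i)) ≤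
      if j = i then 1 else 0 := by
    intro i _
    split_ifs with h1 h2 h2
    all_goals
      refine (MvPolynomial.degreeOf_C_mul_le _ _ _).trans ((MvPolynomial.degreeOf_sub_le _ _ _).trans ?_)
      rw [hX, MvPolynomial.degreeOf_C]
      simp [h2]
  refine (Finset.sum_le_sum hbound).trans ?_
  simp

end Rect

/-! ### The nodal basis -/

namespace RectMesh

variable {d : ℕ} {Ω : Set (E d)} (𝒯 : RectMesh Ω)

theorem ae_not_mem_inter : ∀ᵐ x : E d, ∀ K ∈ 𝒯.cells, ∀ K' ∈ 𝒯.cells, K ≠ K' →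
    x ∉ K.toSet ∩ K'.toSet := by
  rw [Filter.eventually_all_finset]
  intro K hK
  rw [Filter.eventually_all_finset]
  intro K' hK'
  by_cases h : K = K'
  · exact Filter.Eventually.of_forall fun x hx => absurd h hx
  · have := 𝒯.volume_inter_eq_zero hK hK' h
    filter_upwards [measure_eq_zero_iff_ae_notMem.1 this] with x hx _
    exact hx

/-- The nodal basis function at an interior vertex. -/
theorem exists_nodal_basis (hΩ : IsOpen Ω) (hic : interior (closure Ω) = Ω) {K₀ : Rect d}
    (hK₀ : K₀ ∈ 𝒯.cells) {z : E d} (hz : K₀.IsVertex z) (hzΩ : z ∈ Ω) :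
    ∃ v : H10 Ω, ∀ K ∈ 𝒯.cells,
      (∀ τ, z = K.vertex τ → ∀ᵐ x ∂(volume.restrict Ω), x ∈ K.toSet → val v x = K.shape τ x) ∧
      (z ∉ K.toSet → ∀ᵐ x ∂(volume.restrict Ω), x ∈ K.toSet → val v x = 0) := by
  have hex := 𝒯.exists_atOrthant_of_mem hΩ hK₀ hz hzΩ
  choose k hk hks using hex
  -- The cells in the all-positive and all-negative orthants provide the outer nodes of the hats; by
  -- `orthant_width` all other cells at z use the same ones.
  set kp := k fun _ => true
  set km := k fun _ => false
  have hp : ∀ i, z i = kp.lo i := fun i => by simpa using hks (fun _ => true) i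
  have hm : ∀ i, z i = km.hi i := fun i => by simpa using hks (fun _ => false) i
  have h1 : ∀ i, km.lo i < z i := fun i => by rw [hm i]; exact km.lt i
  have h2 : ∀ i, z i < kp.hi i := fun i => by rw [hp i]; exact kp.lt i
  have hcell : ∀ {K s}, K ∈ 𝒯.cells → K.AtOrthant z s → ∀ i,
      (s i = true → K.lo i = z i ∧ K.hi i = kp.hi i) ∧
      (s i = false → K.lo i = km.lo i ∧ K.hi i = z i) := by
    intro K s hK hs i
    constructor <;> intro hi
    · have := 𝒯.orthant_width hK (hk fun _ => true) hs (hks fun _ => true) (i := i) hi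
      rw [this.1, this.2]; exact ⟨(hp i).symm, rfl⟩
    · have := 𝒯.orthant_width hK (hk fun _ => false) hs (hks fun _ => false) (i := i) hi
      rw [this.1, this.2]; exact ⟨rfl, (hm i).symm⟩
  have hstar : ∀ x : E d, (∀ i, km.lo i < x i ∧ x i < kp.hi i) → ∃ K ∈ 𝒯.cells,
      x ∈ K.toSet ∧ z ∈ K.toSet := by
    intro x hx
    refine ⟨k fun i => decide (z i ≤ x i), hk _, fun i => ?_, (hks _).isVertex.mem⟩
    obtain ⟨c1, c2⟩ := hcell (hk _) (hks fun i => decide (z i ≤ x i)) i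
    by_cases hi : z i ≤ x i
    · obtain ⟨a, b⟩ := c1 (by simpa using hi)
      rw [a, b]; exact ⟨hi, (hx i).2.le⟩
    · obtain ⟨a, b⟩ := c2 (by simpa using hi)
      rw [a, b]; exact ⟨(hx i).1.le, (not_le.1 hi).le⟩
  have hsub : {x : E d | ∀ i, km.lo i < x i ∧ x i < kp.hi i} ⊆ Ω := by
    have : {x : E d | ∀ i, km.lo i < x i ∧ x i < kp.hi i} ⊆ interior (closure Ω) := by
      refine interior_maximal (fun x hx => ?_) (isOpen_obox _ _)
      obtain ⟨K, hK, hxK, -⟩ := hstar x hx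
      exact 𝒯.cell_subset_closure hK hxK
    rwa [hic] at this
  obtain ⟨v, hv⟩ := exists_h10_hat 𝒯.volume_ne_top h1 h2 hsub
  refine ⟨v, fun K hK => ⟨fun τ hτ => ?_, fun hzK => ?_⟩⟩
  · filter_upwards [hv] with x hx hxK
    rw [hx, Rect.shape]
    refine Finset.prod_congr rfl fun i _ => ?_
    have hs : K.AtOrthant z fun i => !(τ i) := by
      intro j
      rw [hτ, Rect.vertex_apply]
      cases h : τ j <;> simp [h]
    obtain ⟨c1, c2⟩ := hcell hK hs i
    have hxi := hxK i
    cases hτi : τ i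
    · obtain ⟨a, b⟩ := c1 (by simp [hτi])
      rw [a, b] at hxi
      rw [hat_right (h1 i) (h2 i) hxi.1 hxi.2, Rect.shape1, a, b]; simp
    · obtain ⟨a, b⟩ := c2 (by simp [hτi])
      rw [a, b] at hxi
      rw [hat_left (h1 i) (h2 i) hxi.1 hxi.2, Rect.shape1, a, b]; simp
  · filter_upwards [hv, ae_restrict_of_ae 𝒯.ae_not_mem_inter] with x hx hxn hxK
    rw [hx]
    by_cases hxs : ∀ i, km.lo i < x i ∧ x i < kp.hi i
    · obtain ⟨K', hK', hxK', hzK'⟩ := hstar x hxs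
      have hne : K ≠ K' := by rintro rfl; exact hzK hzK'
      exact absurd ⟨hxK, hxK'⟩ (hxn K hK K' hK' hne)
    · push Not at hxs
      obtain ⟨i, hi⟩ := hxs
      refine Finset.prod_eq_zero (Finset.mem_univ i) (hat_eq_zero (h1 i) (h2 i) ?_)
      by_cases h : km.lo i < x i
      · exact Or.inr (hi h)
      · exact Or.inl (not_lt.1 h)

open Classical in
/-- The nodal basis functions, zero where there is none. -/
def basis (z : E d) : H10 Ω :=
  if h : ∃ v : H10 Ω, ∀ K ∈ 𝒯.cells,
      (∀ τ, z = K.vertex τ → ∀ᵐ x ∂(volume.restrict Ω), x ∈ K.toSet → val v x = K.shape τ x) ∧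
      (z ∉ K.toSet → ∀ᵐ x ∂(volume.restrict Ω), x ∈ K.toSet → val v x = 0)
  then h.choose else 0

open Classical in
/-- The interior vertices of the mesh. -/
def nodes : Finset (E d) :=
  (𝒯.cells.biUnion fun K => Finset.univ.image K.vertex).filter (· ∈ Ω)

theorem mem_nodes {z : E d} : z ∈ 𝒯.nodes ↔ (∃ K ∈ 𝒯.cells, ∃ τ, K.vertex τ = z) ∧ z ∈ Ω := by
  simp [nodes]

theorem basis_spec (hΩ : IsOpen Ω) (hic : interior (closure Ω) = Ω) {z : E d} (hz : z ∈ 𝒯.nodes)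
    {K : Rect d} (hK : K ∈ 𝒯.cells) :
    (∀ τ, z = K.vertex τ → ∀ᵐ x ∂(volume.restrict Ω), x ∈ K.toSet →
      val (𝒯.basis z) x = K.shape τ x) ∧
    (z ∉ K.toSet → ∀ᵐ x ∂(volume.restrict Ω), x ∈ K.toSet → val (𝒯.basis z) x = 0) := by
  obtain ⟨⟨K₀, hK₀, τ, rfl⟩, hzΩ⟩ := 𝒯.mem_nodes.1 hz
  have h := 𝒯.exists_nodal_basis hΩ hic hK₀ (K₀.isVertex_vertex τ) hzΩ
  rw [basis, dif_pos h]
  exact h.choose_spec K hK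

theorem _root_.WaveLOD.Rect.IsVertex.exists_vertex {K : Rect d} {z : E d} (h : K.IsVertex z) :
    ∃ τ, z = K.vertex τ := by
  classical
  refine ⟨fun i => decide (z i = K.hi i), ?_⟩
  ext i
  rw [Rect.vertex_apply]
  rcases h i with h | h
  · have := (K.lt i).ne
    simp [h, this]
  · simp [h]

theorem basis_mem (hΩ : IsOpen Ω) (hic : interior (closure Ω) = Ω) {z : E d} (hz : z ∈ 𝒯.nodes) :
    𝒯.basis z ∈ 𝒯.V := by
  intro K hK
  obtain ⟨b1, b2⟩ := 𝒯.basis_spec hΩ hic hz hK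
  by_cases hzK : z ∈ K.toSet
  · obtain ⟨⟨K₀, hK₀, τ₀, hτ₀⟩, hzΩ⟩ := 𝒯.mem_nodes.1 hz
    obtain ⟨τ, hτ⟩ :=
      (𝒯.isVertex_of_mem hK₀ hK (hτ₀ ▸ K₀.isVertex_vertex τ₀) hzK).exists_vertex
    refine ⟨K.shapePoly τ, K.shapePoly_mem τ, ?_⟩
    filter_upwards [b1 τ hτ] with x hx hxK
    rw [K.eval_shapePoly]
    exact hx hxK
  · refine ⟨0, Submodule.zero_mem _, ?_⟩
    filter_upwards [b2 hzK] with x hx hxK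
    rw [map_zero]
    exact hx hxK

theorem coeFn_sum {ι F : Type*} [NormedAddCommGroup F] {X : Type*} [MeasurableSpace X]
    {μ : Measure X} {p : ℝ≥0∞} (s : Finset ι) (f : ι → Lp F p μ) :
    ⇑(∑ i ∈ s, f i) =ᵐ[μ] fun x => ∑ i ∈ s, f i x := by
  classical
  induction s using Finset.induction_on with
  | empty =>
    simp only [Finset.sum_empty]
    exact Lp.coeFn_zero F p μ
  | insert i s hi ih =>
    rw [Finset.sum_insert hi]
    filter_upwards [Lp.coeFn_add (f i) (∑ j ∈ s, f j), ih] with x h1 h2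
    rw [h1, Pi.add_apply, h2, Finset.sum_insert hi]

/-- The vertex values on `K` of a function that is multilinear on `K`. -/
def IsVertexValues (v : H10 Ω) (K : Rect d) (c : (Fin d → Bool) → ℝ) : Prop :=
  ∀ᵐ x ∂(volume.restrict Ω), x ∈ K.toSet → val v x = K.multilin c x

theorem exists_vertexValues {v : H10 Ω} (hv : v ∈ 𝒯.V) {K : Rect d} (hK : K ∈ 𝒯.cells) :
    ∃ c, IsVertexValues v K c := by
  obtain ⟨p, hp, h⟩ := hv K hK
  refine ⟨fun τ => MvPolynomial.eval (K.vertex τ) p, ?_⟩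
  filter_upwards [h] with x hx hxK
  rw [← K.eval_eq_multilin hp]
  exact hx hxK

/-- Multiplication of the nodal values by an arbitrary function. -/
theorem exists_nodal_mul (hΩ : IsOpen Ω) (hic : interior (closure Ω) = Ω) {w : H10 Ω}
    (hw : w ∈ 𝒯.V) (η : E d → ℝ) :
    ∃ w' ∈ Submodule.span ℝ (𝒯.basis '' 𝒯.nodes), ∃ c : Rect d → (Fin d → Bool) → ℝ,
      ∀ K ∈ 𝒯.cells, IsVertexValues w K (c K) ∧
        IsVertexValues w' K fun τ => η (K.vertex τ) * c K τ := by
  classical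
  choose c hc using fun K : {K // K ∈ 𝒯.cells} => 𝒯.exists_vertexValues hw K.2
  set C : Rect d → (Fin d → Bool) → ℝ := fun K => if h : K ∈ 𝒯.cells then c ⟨K, h⟩ else 0 with hC
  have hCK : ∀ K ∈ 𝒯.cells, IsVertexValues w K (C K) := by
    intro K hK
    simp only [hC, dif_pos hK]
    exact hc ⟨K, hK⟩
  have hnode : ∀ K ∈ 𝒯.cells, ∀ z, K.IsVertex z →
      (∀ K' ∈ 𝒯.cells, z ∈ K'.toSet → K.multilin (C K) z = K'.multilin (C K') z) ∧
        (z ∉ Ω → K.multilin (C K) z = 0) := fun K hK z hz =>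
    𝒯.node_values hic w (P := fun K => K.multilin (C K))
      (fun K _ => (K.multilin_contDiff _).continuous) hCK hK hz
  -- The nodal value at z is read off from an arbitrary cell containing z; `node_values` shows that
  -- the choice does not matter.
  set N : E d → ℝ := fun z => if h : ∃ K ∈ 𝒯.cells, z ∈ K.toSet then
    h.choose.multilin (C h.choose) z else 0 with hN
  have hNK : ∀ K ∈ 𝒯.cells, ∀ τ, N (K.vertex τ) = C K τ := by
    intro K hK τ
    have h : ∃ K' ∈ 𝒯.cells, K.vertex τ ∈ K'.toSet := ⟨K, hK, K.vertex_mem τ⟩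
    simp only [hN, dif_pos h]
    rw [← (hnode K hK _ (K.isVertex_vertex τ)).1 _ h.choose_spec.1 h.choose_spec.2,
      K.multilin_vertex]
  refine ⟨∑ z ∈ 𝒯.nodes, (η z * N z) • 𝒯.basis z, ?_, C, fun K hK => ⟨hCK K hK, ?_⟩⟩
  · exact Submodule.sum_mem _ fun z hz => Submodule.smul_mem _ _
      (Submodule.subset_span ⟨z, hz, rfl⟩)
  · have hval : val (∑ z ∈ 𝒯.nodes, (η z * N z) • 𝒯.basis z) =
        ∑ z ∈ 𝒯.nodes, (η z * N z) • val (𝒯.basis z) := by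
      rw [map_sum]; simp only [map_smul]
    rw [IsVertexValues, hval]
    have e1 := coeFn_sum 𝒯.nodes fun z => (η z * N z) • val (𝒯.basis z)
    have e2 : ∀ᵐ x ∂(volume.restrict Ω), ∀ z ∈ 𝒯.nodes,
        ((η z * N z) • val (𝒯.basis z) : L2 Ω) x = (η z * N z) * val (𝒯.basis z) x := by
      rw [Filter.eventually_all_finset]
      intro z _
      filter_upwards [Lp.coeFn_smul (η z * N z) (val (𝒯.basis z))] with x hx
      rw [hx]; rfl
    have e3 : ∀ᵐ x ∂(volume.restrict Ω), ∀ z ∈ 𝒯.nodes, x ∈ K.toSet →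
        (∀ τ, z = K.vertex τ → val (𝒯.basis z) x = K.shape τ x) ∧
          (z ∉ K.toSet → val (𝒯.basis z) x = 0) := by
      rw [Filter.eventually_all_finset]
      intro z hz
      obtain ⟨b1, b2⟩ := 𝒯.basis_spec hΩ hic hz hK
      have b1' : ∀ᵐ x ∂(volume.restrict Ω), ∀ τ, z = K.vertex τ → x ∈ K.toSet →
          val (𝒯.basis z) x = K.shape τ x := by
        rw [Filter.eventually_all]
        intro τ
        by_cases h : z = K.vertex τ
        · filter_upwards [b1 τ h] with x hx _
          exact hx
        · exact Filter.Eventually.of_forall fun _ h' => absurd h' h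
      by_cases hzK : z ∈ K.toSet
      · filter_upwards [b1'] with x hx hxK
        exact ⟨fun τ hτ => hx τ hτ hxK, fun h => absurd hzK h⟩
      · filter_upwards [b1', b2 hzK] with x hx hx2 hxK
        exact ⟨fun τ hτ => hx τ hτ hxK, fun _ => hx2 hxK⟩
    filter_upwards [e1, e2, e3] with x h1 h2 h3 hxK
    rw [h1, Finset.sum_congr rfl h2, Rect.multilin]
    -- Vertices outside Ω carry no basis function, but there the vertex values of w vanish, so these
    -- terms may be dropped.
    have hR : ∑ τ, η (K.vertex τ) * C K τ * K.shape τ x =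
        ∑ τ ∈ Finset.univ.filter (fun τ => K.vertex τ ∈ 𝒯.nodes),
          η (K.vertex τ) * N (K.vertex τ) * val (𝒯.basis (K.vertex τ)) x := by
      rw [Finset.sum_filter]
      refine Finset.sum_congr rfl fun τ _ => ?_
      split_ifs with hτ
      · rw [hNK K hK, (h3 _ hτ hxK).1 τ rfl]
      · have : K.vertex τ ∉ Ω := fun h => hτ (𝒯.mem_nodes.2 ⟨⟨K, hK, τ, rfl⟩, h⟩)
        have h0 := (hnode K hK _ (K.isVertex_vertex τ)).2 this
        rw [K.multilin_vertex] at h0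
        rw [h0]; ring
    rw [hR, ← Finset.sum_image (f := fun z => η z * N z * val (𝒯.basis z) x)
      (K.vertex_injective.injOn)]
    symm
    refine Finset.sum_subset ?_ ?_
    · intro z hz
      simp only [Finset.mem_image, Finset.mem_filter] at hz
      obtain ⟨τ, ⟨-, h⟩, rfl⟩ := hz
      exact h
    · intro z hz hz'
      have hzK : z ∉ K.toSet := by
        intro hzK
        obtain ⟨⟨K₀, hK₀, τ₀, hτ₀⟩, -⟩ := 𝒯.mem_nodes.1 hz
        obtain ⟨τ, hτ⟩ :=
          (𝒯.isVertex_of_mem hK₀ hK (hτ₀ ▸ K₀.isVertex_vertex τ₀) hzK).exists_vertex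
        refine hz' ?_
        simp only [Finset.mem_image, Finset.mem_filter]
        exact ⟨τ, ⟨Finset.mem_univ _, hτ ▸ hz⟩, hτ.symm⟩
      rw [(h3 z hz hxK).2 hzK, mul_zero]

theorem ext_on_cells (hΩ : IsOpen Ω) {v w : H10 Ω} (h : ∀ K ∈ 𝒯.cells,
    ∀ᵐ x ∂(volume.restrict Ω), x ∈ K.toSet → val v x = val w x) : v = w := by
  refine val_injective hΩ (Lp.ext ?_)
  have h' := (Filter.eventually_all_finset 𝒯.cells).2 h
  filter_upwards [h', ae_restrict_mem hΩ.measurableSet] with x hx hxΩ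
  obtain ⟨K, hK, hxK⟩ := 𝒯.exists_cell (subset_closure hxΩ)
  exact hx K hK hxK

/-- Multiplying the nodal values by the constant 1 reproduces the function on every cell, and the
result is a combination of nodal functions by construction. -/
theorem V_le_span (hΩ : IsOpen Ω) (hic : interior (closure Ω) = Ω) :
    𝒯.V ≤ Submodule.span ℝ (𝒯.basis '' 𝒯.nodes) := by
  intro w hw
  obtain ⟨w', hw', c, hc⟩ := 𝒯.exists_nodal_mul hΩ hic hw fun _ => 1
  have : w = w' := by
    refine 𝒯.ext_on_cells hΩ fun K hK => ?_
    filter_upwards [(hc K hK).1, (hc K hK).2] with x h1 h2 hxK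
    rw [h1 hxK, h2 hxK]; simp
  rwa [this]

theorem span_le_V (hΩ : IsOpen Ω) (hic : interior (closure Ω) = Ω) :
    Submodule.span ℝ (𝒯.basis '' 𝒯.nodes) ≤ 𝒯.V := by
  rw [Submodule.span_le]
  rintro _ ⟨z, hz, rfl⟩
  exact 𝒯.basis_mem hΩ hic hz

theorem finiteDimensional_V (hΩ : IsOpen Ω) (hic : interior (closure Ω) = Ω) :
    FiniteDimensional ℝ 𝒯.V := by
  have : FiniteDimensional ℝ (Submodule.span ℝ (𝒯.basis '' 𝒯.nodes)) :=
    FiniteDimensional.span_of_finite ℝ (𝒯.nodes.finite_toSet.image _)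
  exact Submodule.finiteDimensional_of_le (𝒯.V_le_span hΩ hic)

end RectMesh

/-! ### Inverse estimates on a cell -/

section Quadratic

theorem integral_quadratic (α β γ : ℝ) :
    ∫ s in (0:ℝ)..1, (α + β * s + γ * s ^ 2) = α + β / 2 + γ / 3 := by
  have hd : ∀ s ∈ Set.uIcc (0:ℝ) 1, HasDerivAt (fun s => α * s + β / 2 * s ^ 2 + γ / 3 * s ^ 3)
      (α + β * s + γ * s ^ 2) s := by
    intro s _
    have h1 := (hasDerivAt_id s).const_mul α
    have h2 := (hasDerivAt_pow 2 s).const_mul (β / 2)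
    have h3 := (hasDerivAt_pow 3 s).const_mul (γ / 3)
    refine ((h1.add h2).add h3).congr_deriv ?_
    norm_num; ring
  rw [intervalIntegral.integral_eq_sub_of_hasDerivAt hd
    ((by fun_prop : Continuous fun s : ℝ => α + β * s + γ * s ^ 2).intervalIntegrable _ _)]
  norm_num

theorem setIntegral_cbox_prod {d : ℕ} (l u : Fin d → ℝ) (f : Fin d → ℝ → ℝ) :
    ∫ x in cbox l u, ∏ i, f i (x i) = ∏ i, ∫ t in Icc (l i) (u i), f i t := by
  have e : cbox l u = (MeasurableEquiv.toLp 2 (Fin d → ℝ)).symm ⁻¹'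
      (Set.pi univ fun i => Icc (l i) (u i)) := by
    ext x
    simp only [mem_preimage, mem_pi, mem_univ, true_implies, mem_Icc]
    rfl
  have h := (PiLp.volume_preserving_ofLp (Fin d)).setIntegral_preimage_emb
    (MeasurableEquiv.toLp 2 (Fin d → ℝ)).symm.measurableEmbedding (fun y => ∏ i, f i (y i))
    (Set.pi univ fun i => Icc (l i) (u i))
  rw [e]
  refine Eq.trans h ?_
  rw [volume_pi, Measure.restrict_pi_pi, integral_fintype_prod_eq_prod]

end Quadratic

namespace Rect

variable {d : ℕ} (K : Rect d)

/-- The functions biorthogonal to `shape1`. -/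
def dual1 (b : Bool) (i : Fin d) (t : ℝ) : ℝ :=
  if b then 6 * ((t - K.lo i) / (K.hi i - K.lo i)) - 2
  else 4 - 6 * ((t - K.lo i) / (K.hi i - K.lo i))

theorem integral_shape1_mul_dual1 (b b' : Bool) (i : Fin d) :
    ∫ t in Icc (K.lo i) (K.hi i), K.shape1 b i t * K.dual1 b' i t =
      if b = b' then K.hi i - K.lo i else 0 := by
  have hw : 0 < K.hi i - K.lo i := sub_pos.2 (K.lt i)
  rw [integral_Icc_eq_integral_Ioc, ← intervalIntegral.integral_of_le (K.lt i).le]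
  have key : ∀ α β γ : ℝ, (∀ t, K.shape1 b i t * K.dual1 b' i t =
      (fun s => α + β * s + γ * s ^ 2) (t / (K.hi i - K.lo i) - K.lo i / (K.hi i - K.lo i))) →
      ∫ t in (K.lo i)..(K.hi i), K.shape1 b i t * K.dual1 b' i t =
        (K.hi i - K.lo i) * (α + β / 2 + γ / 3) := by
    intro α β γ h
    rw [intervalIntegral.integral_congr (fun t _ => h t),
      intervalIntegral.integral_comp_div_sub (fun s => α + β * s + γ * s ^ 2) hw.ne']
    rw [sub_self, ← sub_div, div_self hw.ne', integral_quadratic, smul_eq_mul]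
  cases b <;> cases b'
  -- The coefficients are those of the products of 1 - s or s with 4 - 6s or 6s - 2, here (1 - s)(4
  -- - 6s).
  · rw [key 4 (-10) 6]
    · norm_num
    · intro t; simp only [shape1, dual1, Bool.false_eq_true, if_false]; field_simp; ring
  · rw [key (-2) 8 (-6)]
    · norm_num
    · intro t; simp only [shape1, dual1, Bool.false_eq_true, if_false, if_true]; field_simp; ring
  · rw [key 0 4 (-6)]
    · norm_num
    · intro t; simp only [shape1, dual1, Bool.false_eq_true, if_false, if_true]; field_simp; ring
  · rw [key 0 (-2) 6]
    · norm_num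
    · intro t; simp only [shape1, dual1, if_true]; field_simp; ring

theorem abs_dual1_le (b : Bool) {i : Fin d} {t : ℝ} (h : K.lo i ≤ t ∧ t ≤ K.hi i) :
    |K.dual1 b i t| ≤ 4 := by
  have hw : 0 < K.hi i - K.lo i := sub_pos.2 (K.lt i)
  have h0 : 0 ≤ (t - K.lo i) / (K.hi i - K.lo i) := div_nonneg (by linarith) hw.le
  have h1 : (t - K.lo i) / (K.hi i - K.lo i) ≤ 1 := (div_le_one hw).2 (by linarith)
  rw [abs_le]
  cases b
  · simp only [dual1, Bool.false_eq_true, if_false]; constructor <;> linarith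
  · simp only [dual1, if_true]; constructor <;> linarith

theorem shape1_mem (b : Bool) {i : Fin d} {t : ℝ} (h : K.lo i ≤ t ∧ t ≤ K.hi i) :
    |K.shape1 b i t| ≤ 1 := by
  have hw : 0 < K.hi i - K.lo i := sub_pos.2 (K.lt i)
  rw [abs_le]
  cases b
  · simp only [shape1, Bool.false_eq_true, if_false]
    rw [le_div_iff₀ hw, div_le_iff₀ hw]; constructor <;> linarith
  · simp only [shape1, if_true]
    rw [le_div_iff₀ hw, div_le_iff₀ hw]; constructor <;> linarith

theorem continuous_dual1 (b : Bool) (i : Fin d) : Continuous (K.dual1 b i) := by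
  unfold dual1
  cases b
  · simp only [Bool.false_eq_true, if_false]; fun_prop
  · simp only [if_true]; fun_prop

/-- Vertex values are bounded by the `L²` norm. -/
theorem volume_mul_sq_le (c : (Fin d → Bool) → ℝ) (τ : Fin d → Bool) :
    volume.real K.toSet * c τ ^ 2 ≤ 16 ^ d * ∫ x in K.toSet, K.multilin c x ^ 2 := by
  set ψ : E d → ℝ := fun x => ∏ i, K.dual1 (τ i) i (x i) with hψ
  have hcψ : Continuous ψ :=
    continuous_finsetProd _ fun i _ => (K.continuous_dual1 _ i).comp (continuous_coord i)
  have hcm : Continuous (K.multilin c) := (K.multilin_contDiff c).continuous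
  have int : ∀ {f : E d → ℝ}, Continuous f → IntegrableOn f K.toSet := fun hf =>
    hf.continuousOn.integrableOn_compact K.isCompact_toSet
  have hvol : volume.real K.toSet = ∏ i, (K.hi i - K.lo i) :=
    volume_real_cbox fun i => (K.lt i).le
  have hdual : ∫ x in K.toSet, K.multilin c x * ψ x = c τ * volume.real K.toSet := by
    have e : ∀ x, K.multilin c x * ψ x =
        ∑ τ', c τ' * ∏ i, K.shape1 (τ' i) i (x i) * K.dual1 (τ i) i (x i) := by
      intro x
      simp only [multilin, shape, hψ, Finset.sum_mul, Finset.prod_mul_distrib, mul_assoc]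
    have hone : ∀ τ' : Fin d → Bool, ∫ x in K.toSet, ∏ i, K.shape1 (τ' i) i (x i) * K.dual1 (τ i) i (x i) =
        ∏ i, if τ' i = τ i then K.hi i - K.lo i else 0 := fun τ' =>
      (setIntegral_cbox_prod K.lo K.hi fun i t => K.shape1 (τ' i) i t * K.dual1 (τ i) i t).trans
        (by simp only [integral_shape1_mul_dual1])
    simp only [e]
    rw [integral_finsetSum]
    · simp only [integral_const_mul, hone]
      rw [hvol, Finset.sum_eq_single τ]
      · simp
      · intro τ' _ hne
        obtain ⟨i, hi⟩ := Function.ne_iff.1 hne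
        rw [Finset.prod_eq_zero (Finset.mem_univ i) (by simp [hi]), mul_zero]
      · simp
    · intro τ' _
      refine int (continuous_const.mul (continuous_finsetProd _ fun i _ => ?_))
      exact ((K.shape1_contDiff _ i).continuous.comp (continuous_coord i)).mul
        ((K.continuous_dual1 _ i).comp (continuous_coord i))
  have hψ2 : ∫ x in K.toSet, ψ x ^ 2 ≤ 16 ^ d * volume.real K.toSet := by
    have hb : ∀ x ∈ K.toSet, ψ x ^ 2 ≤ 16 ^ d := by
      intro x hx
      rw [← sq_abs, hψ, Finset.abs_prod]
      have : ∏ i, |K.dual1 (τ i) i (x i)| ≤ ∏ _i : Fin d, (4:ℝ) :=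
        Finset.prod_le_prod (fun _ _ => abs_nonneg _) fun i _ => K.abs_dual1_le _ (hx i)
      calc _ ≤ (∏ _i : Fin d, (4:ℝ)) ^ 2 :=
            pow_le_pow_left₀ (Finset.prod_nonneg fun _ _ => abs_nonneg _) this 2
        _ = 16 ^ d := by simp [← pow_mul, mul_comm d 2]; rw [pow_mul]; norm_num
    calc ∫ x in K.toSet, ψ x ^ 2 ≤ ∫ _x in K.toSet, (16:ℝ) ^ d :=
          setIntegral_mono_on (int (hcψ.pow 2)) (int continuous_const) K.measurableSet_toSet hb
      _ = 16 ^ d * volume.real K.toSet := by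
          rw [setIntegral_const, smul_eq_mul, mul_comm]
  -- Cauchy–Schwarz through a nonnegative square: the dual function ψ picks out the vertex value,
  -- and its squared norm is at most 16^d times the volume because each factor is bounded by 4. This
  -- μ minimizes the resulting upper bound.
  set μ := c τ / 16 ^ d with hμ
  have hnn : 0 ≤ ∫ x in K.toSet, (K.multilin c x - μ * ψ x) ^ 2 := integral_nonneg fun x => sq_nonneg _
  have hexp : ∫ x in K.toSet, (K.multilin c x - μ * ψ x) ^ 2 =
      (∫ x in K.toSet, K.multilin c x ^ 2) - 2 * μ * (∫ x in K.toSet, K.multilin c x * ψ x) +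
        μ ^ 2 * ∫ x in K.toSet, ψ x ^ 2 := by
    rw [← integral_const_mul, ← integral_const_mul, ← integral_sub, ← integral_add]
    · refine integral_congr_ae (Filter.Eventually.of_forall fun x => ?_)
      simp only; ring
    · exact (int (hcm.pow 2)).sub (int (continuous_const.mul (hcm.mul hcψ)))
    · exact int (continuous_const.mul (hcψ.pow 2))
    · exact int (hcm.pow 2)
    · exact int (continuous_const.mul (hcm.mul hcψ))
  rw [hexp, hdual] at hnn
  have h16 : (0:ℝ) < 16 ^ d := by positivity
  have hμc : c τ = μ * 16 ^ d := by rw [hμ]; field_simp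
  have := mul_le_mul_of_nonneg_left hψ2 (sq_nonneg μ)
  rw [hμc] at hnn ⊢
  nlinarith

/-- The gradient of a multilinear function. -/
theorem norm_gradient_multilin_le (c : (Fin d → Bool) → ℝ) {Λ : ℝ}
    (hΛ : ∀ i, (K.hi i - K.lo i)⁻¹ ≤ Λ) (hΛ0 : 0 ≤ Λ) {x : E d} (hx : x ∈ K.toSet) :
    ‖gradient (K.multilin c) x‖ ≤ √d * (Λ * ∑ τ, |c τ|) := by
  refine norm_le_of_coord (mul_nonneg hΛ0 (Finset.sum_nonneg fun _ _ => abs_nonneg _)) fun i => ?_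
  have hg : gradient (K.multilin c) x i = ∑ τ, c τ * gradient (K.shape τ) x i := by
    have e : ∀ f : E d → ℝ, gradient f x i = fderiv ℝ f x (EuclideanSpace.single i (1:ℝ)) := by
      intro f
      rw [← inner_gradient, EuclideanSpace.inner_single_right]; simp
    simp only [e]
    have hd : HasFDerivAt (K.multilin c) (∑ τ, c τ • fderiv ℝ (K.shape τ) x) x := by
      refine HasFDerivAt.fun_sum fun τ _ => ?_
      exact (((K.shape_contDiff τ).differentiable (by simp) x).hasFDerivAt).const_mul (c τ)
    rw [hd.fderiv, sum_apply]
    simp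
  rw [hg, Finset.mul_sum]
  refine (Finset.abs_sum_le_sum_abs _ _).trans (Finset.sum_le_sum fun τ _ => ?_)
  rw [abs_mul, mul_comm]
  refine mul_le_mul_of_nonneg_right ?_ (abs_nonneg _)
  have : gradient (K.shape τ) x i = _ :=
    gradient_tensor (h := fun i => K.shape1 (τ i) i) (fun i => K.shape1_contDiff _ i) x i
  rw [this, abs_mul, Finset.abs_prod]
  have h1 : ∏ j ∈ Finset.univ.erase i, |K.shape1 (τ j) j (x j)| ≤ 1 :=
    Finset.prod_le_one (fun _ _ => abs_nonneg _) fun j _ => K.shape1_mem _ (hx j)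
  have hw : 0 < K.hi i - K.lo i := sub_pos.2 (K.lt i)
  have h2 : |deriv (K.shape1 (τ i) i) (x i)| = (K.hi i - K.lo i)⁻¹ := by
    cases hb : τ i
    · have : HasDerivAt (K.shape1 false i) (-1 / (K.hi i - K.lo i)) (x i) := by
        have := ((hasDerivAt_id (x i)).const_sub (K.hi i)).div_const (K.hi i - K.lo i)
        refine this.congr_of_eventuallyEq (Filter.Eventually.of_forall fun t => ?_)
        simp [shape1]
      rw [this.deriv, abs_div, abs_of_pos hw]; simp
    · have : HasDerivAt (K.shape1 true i) (1 / (K.hi i - K.lo i)) (x i) := by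
        have := ((hasDerivAt_id (x i)).sub_const (K.lo i)).div_const (K.hi i - K.lo i)
        refine this.congr_of_eventuallyEq (Filter.Eventually.of_forall fun t => ?_)
        simp [shape1]
      rw [this.deriv, abs_div, abs_of_pos hw]; simp
  rw [h2]
  exact (mul_le_of_le_one_left (by positivity) h1).trans (hΛ i)

theorem volume_sdiff_obox : volume (K.toSet \ obox K.lo K.hi) = 0 := by
  refine measure_mono_null (t := ⋃ i : Fin d, ({x : E d | x i = K.lo i} ∪ {x : E d | x i = K.hi i})) ?_ ?_
  · rintro x ⟨hx, hx'⟩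
    simp only [obox, mem_ofPred_eq, not_forall, not_and_or, not_lt] at hx'
    obtain ⟨i, hi⟩ := hx'
    refine mem_iUnion.2 ⟨i, ?_⟩
    rcases hi with hi | hi
    · exact Or.inl (le_antisymm hi (hx i).1)
    · exact Or.inr (le_antisymm (hx i).2 hi)
  · rw [measure_iUnion_null_iff]
    intro i
    rw [measure_union_null_iff]
    exact ⟨volume_hyperplane i _, volume_hyperplane i _⟩

end Rect

/-! ### Gradients on cells and stability of nodal multiplication. -/

namespace RectMesh

variable {d : ℕ} {Ω : Set (E d)} (𝒯 : RectMesh Ω)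

theorem restrict_cell {K : Rect d} (hK : K ∈ 𝒯.cells) :
    (volume.restrict Ω).restrict K.toSet = volume.restrict K.toSet := by
  rw [Measure.restrict_restrict K.measurableSet_toSet]
  refine Measure.restrict_congr_set ?_
  rw [ae_eq_set]
  refine ⟨measure_mono_null (t := ∅) (fun x hx => hx.2 hx.1.1) measure_empty, ?_⟩
  exact measure_mono_null (t := K.toSet \ obox K.lo K.hi) (fun x hx => ⟨hx.1, fun h => hx.2 ⟨hx.1, 𝒯.obox_subset hK h⟩⟩)
    K.volume_sdiff_obox

theorem grad_of_vertexValues {K : Rect d} (hK : K ∈ 𝒯.cells) {v : H10 Ω}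
    {c : (Fin d → Bool) → ℝ} (h : IsVertexValues v K c) :
    ∀ᵐ x ∂(volume.restrict Ω), x ∈ K.toSet → grad v x = gradient (K.multilin c) x := by
  have h1 := grad_eq_gradient v (isOpen_obox K.lo K.hi) (𝒯.obox_subset hK) (K.multilin_contDiff c)
    (by
      filter_upwards [h] with x hx hxo
      exact hx fun i => ⟨(hxo i).1.le, (hxo i).2.le⟩)
  have h2 : ∀ᵐ x ∂(volume.restrict Ω), x ∉ K.toSet \ obox K.lo K.hi :=
    ae_restrict_of_ae (measure_eq_zero_iff_ae_notMem.1 K.volume_sdiff_obox)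
  filter_upwards [h1, h2] with x h1 h2 hxK
  refine h1 ?_
  by_contra h
  exact h2 ⟨hxK, h⟩

/-- Stability of the multiplication of nodal values on a cell. -/
theorem wform_nodal_mul_le {a : E d → ℝ} {K : Rect d} (hK : K ∈ 𝒯.cells) {α : ℝ} (hα : 0 ≤ α)
    (ha : ∀ᵐ x ∂(volume.restrict Ω), x ∈ K.toSet → a x = α) {v w : H10 Ω}
    {c η : (Fin d → Bool) → ℝ} (hv : IsVertexValues v K c)
    (hw : IsVertexValues w K fun τ => η τ * c τ) (hη : ∀ τ, |η τ| ≤ 1) {θ Λ : ℝ}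
    (hθ : ∀ τ τ', |η τ - η τ'| ≤ θ) (hΛ : ∀ i, (K.hi i - K.lo i)⁻¹ ≤ Λ) (hΛ0 : 0 ≤ Λ) :
    wform a K.toSet (grad w) (grad w) ≤ 2 * wform a K.toSet (grad v) (grad v) +
      2 * d * 64 ^ d * (θ * Λ) ^ 2 * wform a K.toSet (val v) (val v) := by
  have hθ0 : 0 ≤ θ := (abs_nonneg _).trans (hθ (fun _ => true) fun _ => true)
  -- On one cell the coefficient is a constant factor of every term, so its value does not enter the
  -- stability constant.
  have conv : ∀ {F : Type} [NormedAddCommGroup F] [InnerProductSpace ℝ F]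
      (f : Lp F 2 (volume.restrict Ω)) (g : E d → F),
      (∀ᵐ x ∂(volume.restrict Ω), x ∈ K.toSet → f x = g x) →
      wform a K.toSet f f = α * ∫ x in K.toSet, ‖g x‖ ^ 2 := by
    intro F _ _ f g hfg
    rw [wform, ← integral_const_mul, ← 𝒯.restrict_cell hK]
    refine setIntegral_congr_ae K.measurableSet_toSet ?_
    filter_upwards [ha, hfg] with x h1 h2 hx
    rw [h1 hx, h2 hx, real_inner_self_eq_norm_sq]
  have hcg : ∀ c, Continuous (gradient (K.multilin c)) := fun c =>
    continuous_gradient (K.multilin_contDiff c)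
  rw [conv _ _ (𝒯.grad_of_vertexValues hK hv), conv _ _ (𝒯.grad_of_vertexValues hK hw), conv _ _ hv]
  set η₀ := η fun _ => true
  -- Freezing the multiplier at one vertex leaves a multiple of the original gradient, plus a
  -- multilinear remainder whose vertex values are small by the oscillation θ; each derivative costs
  -- at most Λ.
  set e : (Fin d → Bool) → ℝ := fun τ => (η τ - η₀) * c τ with he
  have hsplit : ∀ x, gradient (K.multilin fun τ => η τ * c τ) x =
      η₀ • gradient (K.multilin c) x + gradient (K.multilin e) x := by
    intro x
    have hm : (K.multilin fun τ => η τ * c τ) = η₀ • K.multilin c + K.multilin e := by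
      ext y
      simp only [Rect.multilin, Pi.add_apply, Pi.smul_apply, smul_eq_mul, Finset.mul_sum,
        ← Finset.sum_add_distrib, he]
      exact Finset.sum_congr rfl fun τ _ => by ring
    have d1 := (K.multilin_contDiff c).differentiable (by simp) x
    have d2 := (K.multilin_contDiff e).differentiable (by simp) x
    rw [hm, gradient, fderiv_add (d1.const_smul η₀) d2, fderiv_const_smul d1, map_add, map_smul]
    rfl
  have hcard : ∑ τ, |e τ| ≤ θ * ∑ τ, |c τ| := by
    rw [Finset.mul_sum]
    refine Finset.sum_le_sum fun τ _ => ?_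
    rw [he, abs_mul]
    exact mul_le_mul_of_nonneg_right (hθ _ _) (abs_nonneg _)
  have hsq : (∑ τ, |c τ|) ^ 2 ≤ 2 ^ d * ∑ τ, c τ ^ 2 := by
    have := sq_sum_le_card_mul_sum_sq (s := Finset.univ) (f := fun τ => |c τ|)
    simpa using this
  set B := 2 * d * Λ ^ 2 * θ ^ 2 * (2 ^ d * ∑ τ, c τ ^ 2) with hB
  have hpt : ∀ x ∈ K.toSet, ‖gradient (K.multilin fun τ => η τ * c τ) x‖ ^ 2 ≤
      2 * ‖gradient (K.multilin c) x‖ ^ 2 + B := by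
    intro x hx
    have h1 := K.norm_gradient_multilin_le e hΛ hΛ0 hx
    have h2 : ‖gradient (K.multilin e) x‖ ≤ √d * (Λ * (θ * ∑ τ, |c τ|)) :=
      h1.trans (by gcongr)
    have h3 : ‖gradient (K.multilin e) x‖ ^ 2 ≤ d * Λ ^ 2 * θ ^ 2 * (2 ^ d * ∑ τ, c τ ^ 2) := by
      calc _ ≤ (√d * (Λ * (θ * ∑ τ, |c τ|))) ^ 2 := pow_le_pow_left₀ (norm_nonneg _) h2 2
        _ = d * Λ ^ 2 * θ ^ 2 * (∑ τ, |c τ|) ^ 2 := by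
            rw [mul_pow, Real.sq_sqrt (Nat.cast_nonneg d)]; ring
        _ ≤ _ := by gcongr
    have h4 : ‖η₀ • gradient (K.multilin c) x‖ ≤ ‖gradient (K.multilin c) x‖ := by
      rw [norm_smul]
      exact mul_le_of_le_one_left (norm_nonneg _) (hη _)
    rw [hsplit]
    have h5 := norm_add_le (η₀ • gradient (K.multilin c) x) (gradient (K.multilin e) x)
    have h6 : ‖η₀ • gradient (K.multilin c) x + gradient (K.multilin e) x‖ ^ 2 ≤
        (‖gradient (K.multilin c) x‖ + ‖gradient (K.multilin e) x‖) ^ 2 :=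
      pow_le_pow_left₀ (norm_nonneg _) (h5.trans (by linarith)) 2
    nlinarith [sq_nonneg (‖gradient (K.multilin c) x‖ - ‖gradient (K.multilin e) x‖)]
  have int : ∀ {f : E d → ℝ}, Continuous f → IntegrableOn f K.toSet := fun hf =>
    hf.continuousOn.integrableOn_compact K.isCompact_toSet
  have i1 : IntegrableOn (fun x => 2 * ‖gradient (K.multilin c) x‖ ^ 2) K.toSet :=
    int (continuous_const.mul ((hcg _).norm.pow 2))
  have i2 : IntegrableOn (fun _ : E d => B) K.toSet := int continuous_const
  have hint : ∫ x in K.toSet, ‖gradient (K.multilin fun τ => η τ * c τ) x‖ ^ 2 ≤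
      2 * (∫ x in K.toSet, ‖gradient (K.multilin c) x‖ ^ 2) + B * volume.real K.toSet := by
    calc _ ≤ ∫ x in K.toSet, (2 * ‖gradient (K.multilin c) x‖ ^ 2 + B) :=
          setIntegral_mono_on (int ((hcg _).norm.pow 2)) (i1.add i2)
            K.measurableSet_toSet hpt
      _ = _ := by
          rw [integral_add i1 i2, integral_const_mul, setIntegral_const, smul_eq_mul, mul_comm B]
  have hvals : (∑ τ, c τ ^ 2) * volume.real K.toSet ≤
      2 ^ d * (16 ^ d * ∫ x in K.toSet, K.multilin c x ^ 2) := by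
    rw [Finset.sum_mul]
    calc ∑ τ, c τ ^ 2 * volume.real K.toSet
        ≤ ∑ _τ : Fin d → Bool, 16 ^ d * ∫ x in K.toSet, K.multilin c x ^ 2 :=
          Finset.sum_le_sum fun τ _ => by rw [mul_comm]; exact K.volume_mul_sq_le c τ
      _ = _ := by simp
  have hBv : B * volume.real K.toSet ≤
      2 * d * 64 ^ d * (θ * Λ) ^ 2 * ∫ x in K.toSet, ‖K.multilin c x‖ ^ 2 := by
    -- One factor 2^d comes from Cauchy–Schwarz over the vertices, the other from summing the vertex
    -- bounds, and 16^d from the inverse estimate.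
    have e1 : (64:ℝ) ^ d = 2 ^ d * (2 ^ d * 16 ^ d) := by
      rw [← mul_pow, ← mul_pow]; norm_num
    calc B * volume.real K.toSet = 2 * d * (θ * Λ) ^ 2 * 2 ^ d *
          ((∑ τ, c τ ^ 2) * volume.real K.toSet) := by rw [hB]; ring
      _ ≤ 2 * d * (θ * Λ) ^ 2 * 2 ^ d *
          (2 ^ d * (16 ^ d * ∫ x in K.toSet, K.multilin c x ^ 2)) := by gcongr
      _ = _ := by simp only [Real.norm_eq_abs, sq_abs]; rw [e1]; ring
  have := mul_le_mul_of_nonneg_left (hint.trans (add_le_add le_rfl hBv)) hα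
  linarith

end RectMesh

/-! ### Layers of cells -/

namespace RectMesh

variable {d : ℕ} {Ω : Set (E d)} (𝒯 : RectMesh Ω)

/-- The cells of the patch `U_n(K)`. -/
def near (K : Rect d) : ℕ → Finset (Rect d)
  | 0 => {K}
  | n + 1 => @Finset.filter _ (fun K' => ∃ K'' ∈ near K n, (K''.toSet ∩ K'.toSet).Nonempty)
      (Classical.decPred _) 𝒯.cells

theorem mem_near_zero {K K' : Rect d} : K' ∈ 𝒯.near K 0 ↔ K' = K := by simp [near]

theorem mem_near_succ {K K' : Rect d} {n : ℕ} : K' ∈ 𝒯.near K (n + 1) ↔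
    K' ∈ 𝒯.cells ∧ ∃ K'' ∈ 𝒯.near K n, (K''.toSet ∩ K'.toSet).Nonempty := by
  rw [near]
  exact @Finset.mem_filter _ _ (Classical.decPred _) _ _

theorem near_subset {K : Rect d} (hK : K ∈ 𝒯.cells) (n : ℕ) : 𝒯.near K n ⊆ 𝒯.cells := by
  intro K' hK'
  cases n with
  | zero => rw [𝒯.mem_near_zero.1 hK']; exact hK
  | succ n => exact (𝒯.mem_near_succ.1 hK').1

theorem self_inter_nonempty (K : Rect d) : (K.toSet ∩ K.toSet).Nonempty :=
  ⟨K.vertex fun _ => true, K.vertex_mem _, K.vertex_mem _⟩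

theorem near_subset_succ {K : Rect d} (hK : K ∈ 𝒯.cells) (n : ℕ) :
    𝒯.near K n ⊆ 𝒯.near K (n + 1) := fun K' hK' =>
  𝒯.mem_near_succ.2 ⟨𝒯.near_subset hK n hK', K', hK', self_inter_nonempty K'⟩

theorem near_mono {K : Rect d} (hK : K ∈ 𝒯.cells) {m n : ℕ} (h : m ≤ n) :
    𝒯.near K m ⊆ 𝒯.near K n := by
  induction h with
  | refl => exact subset_rfl
  | step _ ih => exact ih.trans (𝒯.near_subset_succ hK _)

theorem mem_near_self {K : Rect d} (hK : K ∈ 𝒯.cells) (n : ℕ) : K ∈ 𝒯.near K n :=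
  𝒯.near_mono hK (Nat.zero_le n) (𝒯.mem_near_zero.2 rfl)

theorem mem_near_trans {K K' K'' : Rect d} {m n : ℕ}
    (h1 : K' ∈ 𝒯.near K m) (h2 : K'' ∈ 𝒯.near K' n) : K'' ∈ 𝒯.near K (m + n) := by
  induction n generalizing K'' with
  | zero => rw [𝒯.mem_near_zero.1 h2]; exact h1
  | succ n ih =>
    obtain ⟨hc, L, hL, hLK⟩ := 𝒯.mem_near_succ.1 h2
    exact 𝒯.mem_near_succ.2 ⟨hc, L, ih hL, hLK⟩

theorem mem_near_comm {K K' : Rect d} (hK : K ∈ 𝒯.cells) {n : ℕ} (h : K' ∈ 𝒯.near K n) :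
    K ∈ 𝒯.near K' n := by
  induction n generalizing K' with
  | zero => rw [𝒯.mem_near_zero.1 h]; exact 𝒯.mem_near_zero.2 rfl
  | succ n ih =>
    obtain ⟨hc, L, hL, hLK⟩ := 𝒯.mem_near_succ.1 h
    have h1 : L ∈ 𝒯.near K' 1 := 𝒯.mem_near_succ.2 ⟨𝒯.near_subset hK n hL, K',
      𝒯.mem_near_zero.2 rfl, by rwa [inter_comm]⟩
    rw [add_comm]
    exact 𝒯.mem_near_trans h1 (ih hL)

theorem mem_near_one {K K' : Rect d} (hK' : K' ∈ 𝒯.cells)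
    (h : (K.toSet ∩ K'.toSet).Nonempty) : K' ∈ 𝒯.near K 1 :=
  𝒯.mem_near_succ.2 ⟨hK', K, 𝒯.mem_near_zero.2 rfl, h⟩

theorem patch_eq (K : Rect d) (n : ℕ) : 𝒯.patch K n = ⋃ K' ∈ 𝒯.near K n, K'.toSet := by
  induction n with
  | zero => simp [patch, near]
  | succ n ih =>
    ext x
    simp only [patch, mem_ofPred_eq, mem_iUnion, exists_prop, mem_near_succ, ih]
    constructor
    · rintro ⟨K', hK', ⟨y, hy, hy'⟩, hx⟩
      simp only [mem_iUnion, exists_prop] at hy'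
      obtain ⟨K'', hK'', hyK''⟩ := hy'
      exact ⟨K', ⟨hK', K'', hK'', y, hyK'', hy⟩, hx⟩
    · rintro ⟨K', ⟨hK', K'', hK'', y, hy, hy'⟩, hx⟩
      refine ⟨K', hK', ⟨y, hy', ?_⟩, hx⟩
      simp only [mem_iUnion, exists_prop]
      exact ⟨K'', hK'', hy⟩

/-- Used after cutting off, where the energy on a cell is bounded by the energy on a patch around
it; the number of cells is a crude but sufficient bound for the overlap. -/
theorem sum_near_near_le {K : Rect d} {f : Rect d → ℝ} (hf : ∀ K, 0 ≤ f K)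
    (m n : ℕ) : ∑ K' ∈ 𝒯.near K m, ∑ K'' ∈ 𝒯.near K' n, f K'' ≤
      (𝒯.near K m).card * ∑ K'' ∈ 𝒯.near K (m + n), f K'' := by
  rw [← nsmul_eq_mul]
  refine Finset.sum_le_card_nsmul _ _ _ fun K' hK' => ?_
  exact Finset.sum_le_sum_of_subset_of_nonneg (fun K'' h => 𝒯.mem_near_trans hK' h)
    fun _ _ _ => hf _

/-- Double counting over the cells. -/
theorem sum_sum_near_le {f : Rect d → ℝ} (hf : ∀ K, 0 ≤ f K) (n : ℕ) {N : ℝ}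
    (hN : ∀ K ∈ 𝒯.cells, ((𝒯.near K n).card : ℝ) ≤ N) :
    ∑ K ∈ 𝒯.cells, ∑ K' ∈ 𝒯.near K n, f K' ≤ N * ∑ K ∈ 𝒯.cells, f K := by
  classical
  have h1 : ∀ K ∈ 𝒯.cells, ∑ K' ∈ 𝒯.near K n, f K' =
      ∑ K' ∈ 𝒯.cells, if K ∈ 𝒯.near K' n then f K' else 0 := by
    intro K hK
    rw [← Finset.sum_filter]
    refine Finset.sum_congr ?_ fun _ _ => rfl
    ext K'
    rw [Finset.mem_filter]
    exact ⟨fun h => ⟨𝒯.near_subset hK n h, 𝒯.mem_near_comm hK h⟩,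
      fun h => 𝒯.mem_near_comm h.1 h.2⟩
  rw [Finset.sum_congr rfl h1, Finset.sum_comm, Finset.mul_sum]
  refine Finset.sum_le_sum fun K' hK' => ?_
  rw [← Finset.sum_filter, Finset.sum_const, nsmul_eq_mul]
  refine mul_le_mul_of_nonneg_right (le_trans ?_ (hN K' hK')) (hf K')
  exact_mod_cast Finset.card_le_card fun K hK => (Finset.mem_filter.1 hK).2

/-! ### The cutoff function -/

/-- Distances within a cell, relative to its widths, transfer to neighbouring cells. -/
theorem exists_transfer {K₀ K L : Rect d} (hK₀ : K₀ ∈ 𝒯.cells) (hK : K ∈ 𝒯.cells)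
    (hL : L ∈ 𝒯.cells) {x y : E d} (hx₀ : x ∈ K₀.toSet) (hx : x ∈ K.toSet) (hy : y ∈ K.toSet)
    (hyL : y ∈ L.toSet) {r : ℝ} (hr0 : 0 ≤ r) (hr : r < 1)
    (h : ∀ i, |x i - y i| ≤ r * (K.hi i - K.lo i)) :
    ∃ y' ∈ K₀.toSet, y' ∈ L.toSet ∧ ∀ i, |x i - y' i| ≤ r * (K₀.hi i - K₀.lo i) := by
  classical
  -- In the coordinates where K₀ and K only touch, x lies on the common face. Since r < 1, y does
  -- not reach the opposite face of K, so keeping the coordinate of x there does not lead out of L.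
  set y' : E d := WithLp.toLp 2 fun i =>
    if K₀.lo i = K.lo i ∧ K₀.hi i = K.hi i then y i else x i with hy'
  have happ : ∀ i, y' i = if K₀.lo i = K.lo i ∧ K₀.hi i = K.hi i then y i else x i := fun i => rfl
  refine ⟨y', fun i => ?_, fun i => ?_, fun i => ?_⟩
  · rw [happ]
    split_ifs with hi
    · rw [hi.1, hi.2]; exact hy i
    · exact hx₀ i
  · rw [happ]
    split_ifs with hi
    · exact hyL i
    · have c1 := (𝒯.coord_cases hK₀ hK hx₀ hx i).resolve_left hi
      have c2 := 𝒯.coord_cases hK hL hy hyL i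
      have b := abs_le.1 (h i)
      have := K.lt i
      have := hx i
      have := hx₀ i
      have := hy i
      have := hyL i
      have hrw : r * (K.hi i - K.lo i) < K.hi i - K.lo i := by nlinarith
      rcases c2 with c2 | c2 | c2
      · rw [← c2.1, ← c2.2]; exact hx i
      · rcases c1 with c1 | c1 <;> constructor <;> linarith [b.1, b.2]
      · rcases c1 with c1 | c1 <;> constructor <;> linarith [b.1, b.2]
  · rw [happ]
    split_ifs with hi
    · rw [hi.1, hi.2]; exact h i
    · rw [sub_self, abs_zero]
      exact mul_nonneg hr0 (sub_nonneg.2 (K₀.lt i).le)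

/-- The admissible relative distances from `x` to the cells of `A`. -/
def cutoffSet (A : Finset (Rect d)) (x : E d) : Set ℝ :=
  insert 1 {r | 0 ≤ r ∧ ∃ K ∈ 𝒯.cells, ∃ L ∈ A, ∃ y, x ∈ K.toSet ∧ y ∈ K.toSet ∧ y ∈ L.toSet ∧
    ∀ i, |x i - y i| ≤ r * (K.hi i - K.lo i)}

/-- A function that vanishes on the cells of `A`, equals one on the cells that do not touch `A`,
and varies on the scale of the mesh. -/
def cutoff (A : Finset (Rect d)) (x : E d) : ℝ := sInf (𝒯.cutoffSet A x)

theorem cutoffSet_nonneg {A : Finset (Rect d)} {x : E d} {r : ℝ} (hr : r ∈ 𝒯.cutoffSet A x) :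
    0 ≤ r := by
  rcases hr with rfl | hr
  · exact zero_le_one
  · exact hr.1

theorem cutoffSet_bddBelow (A : Finset (Rect d)) (x : E d) : BddBelow (𝒯.cutoffSet A x) :=
  ⟨0, fun _ hr => 𝒯.cutoffSet_nonneg hr⟩

theorem cutoff_nonneg (A : Finset (Rect d)) (x : E d) : 0 ≤ 𝒯.cutoff A x :=
  le_csInf ⟨1, mem_insert _ _⟩ fun _ hr => 𝒯.cutoffSet_nonneg hr

theorem cutoff_le_one (A : Finset (Rect d)) (x : E d) : 𝒯.cutoff A x ≤ 1 :=
  csInf_le (𝒯.cutoffSet_bddBelow A x) (mem_insert _ _)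

theorem cutoff_eq_zero {A : Finset (Rect d)} (hA : A ⊆ 𝒯.cells) {K : Rect d} (hK : K ∈ A) {x : E d}
    (hx : x ∈ K.toSet) : 𝒯.cutoff A x = 0 := by
  refine le_antisymm (csInf_le (𝒯.cutoffSet_bddBelow A x) ?_) (𝒯.cutoff_nonneg A x)
  exact Or.inr ⟨le_rfl, K, hA hK, K, hK, x, hx, hx, hx, by simp⟩

/-- A relative distance below 1 could be transferred to K₀ and would exhibit a common point of K₀
and a cell of A. -/
theorem cutoff_eq_one {A : Finset (Rect d)} (hA : A ⊆ 𝒯.cells) {K₀ : Rect d} (hK₀ : K₀ ∈ 𝒯.cells)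
    (hd : ∀ L ∈ A, K₀.toSet ∩ L.toSet = ∅) {x : E d} (hx₀ : x ∈ K₀.toSet) :
    𝒯.cutoff A x = 1 := by
  refine le_antisymm (𝒯.cutoff_le_one A x) (le_csInf ⟨1, mem_insert _ _⟩ ?_)
  rintro r (rfl | ⟨hr0, K, hK, L, hL, y, hx, hy, hyL, h⟩)
  · exact le_rfl
  · by_contra hr
    obtain ⟨y', h1, h2, -⟩ := 𝒯.exists_transfer hK₀ hK (hA hL) hx₀ hx hy hyL hr0 (not_le.1 hr) h
    exact (Set.eq_empty_iff_forall_notMem.1 (hd L hL)) y' ⟨h1, h2⟩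

/-- Transfer places the nearest competitor in the cell that contains both points, where the triangle
inequality applies. Distances are measured within single cells and in units of their widths, so the
shape of Ω plays no role. -/
theorem cutoff_le_add {A : Finset (Rect d)} (hA : A ⊆ 𝒯.cells) {K₀ : Rect d} (hK₀ : K₀ ∈ 𝒯.cells)
    {x x' : E d} (hx₀ : x ∈ K₀.toSet) (hx₀' : x' ∈ K₀.toSet) {θ : ℝ} (hθ : 0 ≤ θ)
    (h : ∀ i, |x' i - x i| ≤ θ * (K₀.hi i - K₀.lo i)) :
    𝒯.cutoff A x' ≤ 𝒯.cutoff A x + θ := by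
  rw [← sub_le_iff_le_add]
  refine le_csInf ⟨1, mem_insert _ _⟩ fun r hr => ?_
  rw [sub_le_iff_le_add]
  rcases lt_or_ge r 1 with hr1 | hr1
  · rcases hr with rfl | ⟨hr0, K, hK, L, hL, y, hx, hy, hyL, hr⟩
    · exact absurd hr1 (lt_irrefl _)
    · obtain ⟨y', h1, h2, h3⟩ := 𝒯.exists_transfer hK₀ hK (hA hL) hx₀ hx hy hyL hr0 hr1 hr
      refine csInf_le (𝒯.cutoffSet_bddBelow A x') (Or.inr ⟨by positivity, K₀, hK₀, L, hL, y',
        hx₀', h1, h2, fun i => ?_⟩)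
      have := abs_sub_le (x' i) (x i) (y' i)
      have := h i
      have := h3 i
      linarith
  · exact (𝒯.cutoff_le_one A x').trans (by linarith)

theorem abs_cutoff_sub_le {A : Finset (Rect d)} (hA : A ⊆ 𝒯.cells) {K₀ : Rect d}
    (hK₀ : K₀ ∈ 𝒯.cells) {x x' : E d} (hx₀ : x ∈ K₀.toSet) (hx₀' : x' ∈ K₀.toSet) {θ : ℝ}
    (hθ : 0 ≤ θ) (h : ∀ i, |x i - x' i| ≤ θ * (K₀.hi i - K₀.lo i)) :
    |𝒯.cutoff A x - 𝒯.cutoff A x'| ≤ θ := by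
  rw [abs_le]
  have h1 := 𝒯.cutoff_le_add hA hK₀ hx₀ hx₀' hθ fun i => by rw [abs_sub_comm]; exact h i
  have h2 := 𝒯.cutoff_le_add hA hK₀ hx₀' hx₀ hθ h
  constructor <;> linarith

/-! ### Mesh size -/

theorem abs_coord_le_diam {K : Rect d} {x y : E d} (hx : x ∈ K.toSet) (hy : y ∈ K.toSet)
    (i : Fin d) : |x i - y i| ≤ Metric.diam K.toSet := by
  have h1 : |x i - y i| ≤ ‖x - y‖ := PiLp.norm_apply_le (x - y) i
  rw [← dist_eq_norm] at h1
  exact h1.trans (Metric.dist_le_diam_of_mem K.isCompact_toSet.isBounded hx hy)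

theorem width_le_diam (K : Rect d) (i : Fin d) : K.hi i - K.lo i ≤ Metric.diam K.toSet := by
  have h := abs_coord_le_diam (K.vertex_mem fun _ => true) (K.vertex_mem fun _ => false) i
  have := K.lt i
  simp only [Rect.vertex_apply, if_true, Bool.false_eq_true, if_false] at h
  exact (le_abs_self _).trans h

theorem diam_le_size {K : Rect d} (hK : K ∈ 𝒯.cells) : Metric.diam K.toSet ≤ 𝒯.size :=
  le_ciSup (f := fun K : {K // K ∈ 𝒯.cells} => Metric.diam K.1.toSet) (Set.finite_range _).bddAbove
    ⟨K, hK⟩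

theorem width_le_size {K : Rect d} (hK : K ∈ 𝒯.cells) (i : Fin d) :
    K.hi i - K.lo i ≤ 𝒯.size := (width_le_diam K i).trans (𝒯.diam_le_size hK)

theorem one_le_of_shapeRegular {σ : ℝ} (hs : 𝒯.ShapeRegular σ) {K : Rect d} (hK : K ∈ 𝒯.cells)
    (i : Fin d) : 1 ≤ σ := by
  have h := hs K hK i i
  have := sub_pos.2 (K.lt i)
  by_contra hσ
  nlinarith

/-- One factor σ is quasi-uniformity, the other the aspect ratio; √d compares the diameter with the
largest width. -/
theorem size_le_width {σ : ℝ} (hs : 𝒯.ShapeRegular σ) (hq : 𝒯.QuasiUniform σ)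
    {K : Rect d} (hK : K ∈ 𝒯.cells) (i : Fin d) :
    𝒯.size ≤ σ ^ 2 * √d * (K.hi i - K.lo i) := by
  have hσ := 𝒯.one_le_of_shapeRegular hs hK i
  have hw := sub_pos.2 (K.lt i)
  have h1 : Metric.diam K.toSet ≤ √d * (σ * (K.hi i - K.lo i)) := by
    refine Metric.diam_le_of_forall_dist_le (by positivity) fun x hx y hy => ?_
    rw [dist_eq_norm]
    refine norm_le_of_coord (by positivity) fun j => ?_
    have := hs K hK j i
    have a := hx j
    have b := hy j
    change |x j - y j| ≤ _
    rw [abs_le]; constructor <;> linarith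
  have : Nonempty {K // K ∈ 𝒯.cells} := ⟨⟨K, hK⟩⟩
  refine ciSup_le fun K' => ?_
  calc Metric.diam K'.1.toSet ≤ σ * Metric.diam K.toSet := hq _ K'.2 K hK
    _ ≤ σ * (√d * (σ * (K.hi i - K.lo i))) := by gcongr
    _ = _ := by ring

theorem abs_coord_near_le {K K' : Rect d} (hK : K ∈ 𝒯.cells) {n : ℕ} (h : K' ∈ 𝒯.near K n)
    {x y : E d} (hx : x ∈ K.toSet) (hy : y ∈ K'.toSet) (i : Fin d) :
    |x i - y i| ≤ (n + 1) * 𝒯.size := by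
  induction n generalizing K' y with
  | zero =>
    rw [𝒯.mem_near_zero.1 h] at hy
    simpa using (abs_coord_le_diam hx hy i).trans (𝒯.diam_le_size hK)
  | succ n ih =>
    obtain ⟨hc, L, hL, z, hz, hz'⟩ := 𝒯.mem_near_succ.1 h
    have h1 := ih hL hz
    have h2 := (abs_coord_le_diam hz' hy i).trans (𝒯.diam_le_size hc)
    have h3 := abs_sub_le (x i) (z i) (y i)
    push_cast
    linarith

/-- The number of cells in a patch grows polynomially. -/
theorem card_near_le (hd : 0 < d) {σ : ℝ} (hs : 𝒯.ShapeRegular σ) (hq : 𝒯.QuasiUniform σ)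
    {K : Rect d} (hK : K ∈ 𝒯.cells) (n : ℕ) :
    ((𝒯.near K n).card : ℝ) ≤ (2 * (σ ^ 2 * √d) * (n + 1)) ^ d := by
  set κ := σ ^ 2 * √d with hκ
  have hσ := 𝒯.one_le_of_shapeRegular hs hK ⟨0, hd⟩
  have hdpos : (0:ℝ) < d := by exact_mod_cast hd
  have hκ0 : 0 < κ := by positivity
  set H := 𝒯.size with hH
  have hH0 : 0 < H := (sub_pos.2 (K.lt ⟨0, hd⟩)).trans_le (𝒯.width_le_size hK _)
  set x := K.vertex fun _ => true with hx
  have hxK : x ∈ K.toSet := K.vertex_mem _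
  -- Volume comparison: the open cells of the patch are disjoint, have volume at least (H/κ)^d, and
  -- fit into a cube of side 2(n + 1)H.
  set B : Set (E d) := cbox (fun i => x i - (n + 1) * H) (fun i => x i + (n + 1) * H) with hB
  have hsub : (⋃ K' ∈ 𝒯.near K n, obox K'.lo K'.hi) ⊆ B := by
    intro y hy i
    simp only [mem_iUnion, exists_prop] at hy
    obtain ⟨K', hK', hy⟩ := hy
    have := abs_le.1 (𝒯.abs_coord_near_le hK hK' hxK (fun i => ⟨(hy i).1.le, (hy i).2.le⟩) i)
    constructor <;> linarith [this.1, this.2]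
  have hBfin : volume B ≠ ⊤ := (isCompact_cbox _ _).measure_lt_top.ne
  have hBvol : volume.real B = (2 * (n + 1) * H) ^ d := by
    rw [hB, volume_real_cbox (fun i => by nlinarith)]
    have : ∀ i : Fin d, x i + (n + 1) * H - (x i - (n + 1) * H) = 2 * (n + 1) * H := fun i => by ring
    simp [this]
  have hdisj : ((𝒯.near K n : Set (Rect d))).PairwiseDisjoint fun K' => obox K'.lo K'.hi := by
    intro K₁ h1 K₂ h2 hne
    rw [Function.onFun, Set.disjoint_left]
    intro y hy1 hy2
    exact hne (𝒯.eq_of_mem_obox (𝒯.near_subset hK n h1) (𝒯.near_subset hK n h2) hy1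
      fun i => ⟨(hy2 i).1.le, (hy2 i).2.le⟩)
  have hsum : ∑ K' ∈ 𝒯.near K n, volume.real (obox K'.lo K'.hi) ≤ volume.real B := by
    rw [← measureReal_biUnion_finset hdisj (fun K' _ => (isOpen_obox _ _).measurableSet)
      (fun K' _ => volume_obox_ne_top _ _)]
    exact measureReal_mono hsub hBfin
  have hlow : ∀ K' ∈ 𝒯.near K n, (H / κ) ^ d ≤ volume.real (obox K'.lo K'.hi) := by
    intro K' hK'
    rw [volume_real_obox fun i => (K'.lt i).le]
    have : (H / κ) ^ d = ∏ _i : Fin d, (H / κ) := by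
      rw [Finset.prod_const, Finset.card_univ, Fintype.card_fin]
    rw [this]
    refine Finset.prod_le_prod (fun _ _ => by positivity) fun i _ => ?_
    rw [div_le_iff₀ hκ0, mul_comm]
    exact 𝒯.size_le_width hs hq (𝒯.near_subset hK n hK') i
  have h := (Finset.card_nsmul_le_sum _ _ _ hlow).trans (hsum.trans hBvol.le)
  rw [nsmul_eq_mul] at h
  have hpos : 0 < (H / κ) ^ d := by positivity
  have e : (2 * (n + 1) * H) ^ d = (2 * κ * (n + 1)) ^ d * (H / κ) ^ d := by
    rw [← mul_pow]; congr 1; field_simp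
  rw [e] at h
  exact le_of_mul_le_mul_right h hpos

end RectMesh

/-- Vanishing almost everywhere on a cell. -/
def VanishOn {d : ℕ} {Ω : Set (E d)} (v : H10 Ω) (K : Rect d) : Prop :=
  ∀ᵐ x ∂(volume.restrict Ω), x ∈ K.toSet → val v x = 0

namespace LOD

variable {d : ℕ} {Ω : Set (E d)} (D : LOD Ω)

/-! ### The coefficient and the energy form -/

theorem a_pos (x : E d) : 0 < D.a x := by
  unfold a coefficient
  split_ifs
  exacts [D.a₀_pos, one_pos]

theorem a_le (x : E d) : D.a x ≤ max D.a₀ 1 := by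
  unfold a coefficient
  split_ifs
  exacts [le_max_left _ _, le_max_right _ _]

theorem le_a (x : E d) : min D.a₀ 1 ≤ D.a x := by
  unfold a coefficient
  split_ifs
  exacts [min_le_left _ _, min_le_right _ _]

theorem isWeight : IsWeight D.a where
  measurable := by
    classical
    have : Measurable fun x => if x ∈ D.Ωε then D.a₀ else 1 :=
      Measurable.ite D.measurable_Ωε measurable_const measurable_const
    convert this using 2
    unfold a coefficient
    congr
  nonneg x := (D.a_pos x).le
  bdd := ⟨_, D.a_le⟩

/-- The form `∫_{S ∩ Ω} a ∇v · ∇w` as a bilinear form. -/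
def form (S : Set (E d)) : LinearMap.BilinForm ℝ (H10 Ω) :=
  (D.isWeight.bilin S).comp (grad : H10 Ω →L[ℝ] L2Vec Ω).toLinearMap
    (grad : H10 Ω →L[ℝ] L2Vec Ω).toLinearMap

theorem form_symm (S : Set (E d)) (v w : H10 Ω) : D.form S v w = D.form S w v :=
  wform_symm _ _ _ _

theorem form_self_nonneg (S : Set (E d)) (v : H10 Ω) : 0 ≤ D.form S v v :=
  D.isWeight.wform_self_nonneg S _

theorem formOn_eq (S : Set (E d)) (v w : H10 Ω) : formOn D.a S v w = D.form S v w := rfl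

theorem sq_wnorm_grad (S : Set (E d)) (v : H10 Ω) :
    wnorm D.a S (grad v) ^ 2 = D.form S v v := D.isWeight.wnorm_sq _ _

theorem form_patch {K : Rect d} (hK : K ∈ D.coarse.cells) (n : ℕ) (v w : H10 Ω) :
    D.form (D.coarse.patch K n) v w = ∑ K' ∈ D.coarse.near K n, D.form K'.toSet v w := by
  rw [D.coarse.patch_eq]
  exact D.isWeight.wform_biUnion _ _ (fun i _ => i.measurableSet_toSet)
    (D.coarse.pairwise_null.mono fun K' h => D.coarse.near_subset hK n h) _ _

theorem wform_univ {F : Type*} [NormedAddCommGroup F] [InnerProductSpace ℝ F]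
    (f g : Lp F 2 (volume.restrict Ω)) :
    wform D.a univ f g = ∑ K ∈ D.coarse.cells, wform D.a K.toSet f g := by
  have h : wform D.a univ f g = wform D.a (⋃ K ∈ D.coarse.cells, K.toSet) f g := by
    rw [D.coarse.cover, wform, wform, Measure.restrict_univ,
      Measure.restrict_restrict isClosed_closure.measurableSet,
      inter_eq_self_of_subset_right subset_closure]
  rw [h]
  exact D.isWeight.wform_biUnion _ _ (fun i _ => i.measurableSet_toSet) D.coarse.pairwise_null _ _

theorem form_univ (v w : H10 Ω) :
    D.form univ v w = ∑ K ∈ D.coarse.cells, D.form K.toSet v w := D.wform_univ _ _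

/-- A fine cell not inside K lies in a different coarse cell and so meets K in a null set. Estimates
on fine cells, where the coefficient is constant, can therefore be summed to coarse cells. -/
theorem wform_coarse_cell {F : Type*} [NormedAddCommGroup F] [InnerProductSpace ℝ F]
    {K : Rect d} (hK : K ∈ D.coarse.cells) (f g : Lp F 2 (volume.restrict Ω)) :
    wform D.a K.toSet f g = ∑ k ∈ @Finset.filter _ (fun k => k.toSet ⊆ K.toSet)
      (Classical.decPred _) D.fine.cells, wform D.a k.toSet f g := by
  classical
  rw [D.isWeight.wform_eq_sum_inter D.fine.cells (fun k => k.toSet)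
    (fun k _ => k.measurableSet_toSet) D.fine.pairwise_null K.measurableSet_toSet
    (by rw [D.fine.cover]; exact D.coarse.cell_subset_closure hK)]
  have : ∀ k ∈ D.fine.cells, wform D.a (K.toSet ∩ k.toSet) f g =
      if k.toSet ⊆ K.toSet then wform D.a k.toSet f g else 0 := by
    intro k hk
    split_ifs with h
    · rw [inter_eq_self_of_subset_right h]
    · obtain ⟨K', hK', hkK'⟩ := D.refines k hk
      have hne : K ≠ K' := by rintro rfl; exact h hkK'
      exact wform_of_null (measure_mono_null (inter_subset_inter_right _ hkK')
        (D.coarse.volume_inter_eq_zero hK hK' hne)) _ _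
  rw [Finset.sum_congr rfl this, ← Finset.sum_filter]

/-- Almost every point of a coarse cell lies in a fine cell inside it. -/
theorem ae_exists_fine (hΩ : IsOpen Ω) {K : Rect d} (hK : K ∈ D.coarse.cells) :
    ∀ᵐ x ∂(volume.restrict Ω), x ∈ K.toSet →
      ∃ k ∈ D.fine.cells, x ∈ k.toSet ∧ k.toSet ⊆ K.toSet := by
  filter_upwards [ae_restrict_of_ae D.coarse.ae_not_mem_inter,
    ae_restrict_mem hΩ.measurableSet] with x hx hxΩ hxK
  obtain ⟨k, hk, hxk⟩ := D.fine.exists_cell (subset_closure hxΩ)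
  obtain ⟨K', hK', hkK'⟩ := D.refines k hk
  have : K = K' := by
    by_contra hne
    exact hx K hK K' hK' hne ⟨hxK, hkK' hxk⟩
  exact ⟨k, hk, hxk, this ▸ hkK'⟩

theorem coarse_le_fine : D.coarse.V ≤ D.fine.V := by
  intro v hv k hk
  obtain ⟨K, hK, hkK⟩ := D.refines k hk
  obtain ⟨p, hp, h⟩ := hv K hK
  refine ⟨p, hp, ?_⟩
  filter_upwards [h] with x hx hxk
  exact hx (hkK hxk)

theorem sub_interp_mem {v : H10 Ω} (hv : v ∈ D.fine.V) : v - (D.interp v : H10 Ω) ∈ D.W := by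
  refine ⟨Submodule.sub_mem _ hv (D.coarse_le_fine (D.interp v).2), ?_⟩
  change D.interp _ = 0
  rw [map_sub, D.interp_interp, sub_self]

/-- The gradient vanishes on the open cell, and the boundary of the cell is null. -/
theorem form_of_vanishOn {v : H10 Ω} {K : Rect d} (hK : K ∈ D.coarse.cells)
    (h : VanishOn v K) (w : H10 Ω) : D.form K.toSet v w = 0 := by
  refine wform_eq_zero ?_ _
  have h1 := grad_eq_gradient v (isOpen_obox K.lo K.hi) (D.coarse.obox_subset hK)
    (f := fun _ => (0:ℝ)) contDiff_const (by
      filter_upwards [h] with x hx hxK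
      exact hx fun i => ⟨(hxK i).1.le, (hxK i).2.le⟩)
  have h2 : ∀ᵐ x ∂(volume.restrict Ω), x ∉ K.toSet \ obox K.lo K.hi :=
    ae_restrict_of_ae (measure_eq_zero_iff_ae_notMem.1 K.volume_sdiff_obox)
  filter_upwards [h1, h2] with x h1 h2 hx
  have h3 := h1 (by by_contra hc; exact h2 ⟨hx, hc⟩)
  refine h3.trans ?_
  simp [gradient]

variable {D}

/-- The standing assumptions on the data, with normalized constants. -/
structure Admissible (D : LOD Ω) (σ CI CP : ℝ) : Prop where
  pos : 0 < d
  isOpen : IsOpen Ω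
  nonempty : Ω.Nonempty
  regular : interior (closure Ω) = Ω
  shape : D.coarse.ShapeRegular σ
  quasi : D.coarse.QuasiUniform σ
  fineShape : D.fine.ShapeRegular σ
  interp : D.InterpStable CI
  poincare : D.WeightedPoincare CP
  one_le_CI : 1 ≤ CI
  one_le_CP : 1 ≤ CP

/-- The shape constant relating the mesh size to the widths of the cells. -/
def kappa (d : ℕ) (σ : ℝ) : ℝ := σ ^ 2 * √d

/-- The constant in the bound for the number of cells in a patch. -/
def cardBound (d : ℕ) (σ : ℝ) (n : ℕ) : ℝ := (2 * kappa d σ * (n + 1)) ^ d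

/-- The constant in the energy bound for the nodal cutoff. -/
def nodalConst (d : ℕ) (σ CI : ℝ) : ℝ := 2 + 2 * d * 64 ^ d * (σ ^ 2 * kappa d σ) ^ 2 * CI ^ 2

/-- The constant in the energy bound for the cutoff in `W_h`. -/
def cutConst (d : ℕ) (σ CI : ℝ) : ℝ :=
  2 + 2 * (2 * nodalConst d σ CI + 2 * (CI ^ 2 * (cardBound d σ 1 * nodalConst d σ CI)))

theorem nodalConst_nonneg (d : ℕ) (σ CI : ℝ) : 0 ≤ nodalConst d σ CI := by
  unfold nodalConst; positivity

theorem cardBound_nonneg (d : ℕ) (σ : ℝ) (n : ℕ) : 0 ≤ cardBound d σ n := by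
  unfold cardBound kappa; positivity

theorem cutConst_nonneg (d : ℕ) (σ CI : ℝ) : 0 ≤ cutConst d σ CI := by
  have := nodalConst_nonneg d σ CI
  have := cardBound_nonneg d σ 1
  unfold cutConst; positivity

/-! ### Cutting off functions inside W_h. -/

namespace Admissible

variable {σ CI CP : ℝ} (h : D.Admissible σ CI CP)
include h

theorem card_near_le {K : Rect d} (hK : K ∈ D.coarse.cells) (n : ℕ) :
    ((D.coarse.near K n).card : ℝ) ≤ cardBound d σ n :=
  D.coarse.card_near_le h.pos h.shape h.quasi hK n

theorem H_pos : 0 < D.H := by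
  obtain ⟨x, hx⟩ := h.nonempty
  obtain ⟨K, hK, -⟩ := D.coarse.exists_cell (subset_closure hx)
  exact (sub_pos.2 (K.lt ⟨0, h.pos⟩)).trans_le (D.coarse.width_le_size hK _)

theorem one_le_shape : 1 ≤ σ := by
  obtain ⟨x, hx⟩ := h.nonempty
  obtain ⟨K, hK, -⟩ := D.coarse.exists_cell (subset_closure hx)
  exact D.coarse.one_le_of_shapeRegular h.shape hK ⟨0, h.pos⟩

theorem form_interp_le {K : Rect d} (hK : K ∈ D.coarse.cells) (v : H10 Ω) :
    D.form K.toSet (D.interp v : H10 Ω) (D.interp v : H10 Ω) ≤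
      CI ^ 2 * ∑ K' ∈ D.coarse.near K 1, D.form K'.toSet v v := by
  rw [← D.form_patch hK, ← D.sq_wnorm_grad, ← D.sq_wnorm_grad, ← mul_pow]
  exact pow_le_pow_left₀ (wnorm_nonneg _ _ _) (h.interp.1 K hK v) 2

theorem wform_val_le {K : Rect d} (hK : K ∈ D.coarse.cells) {w : H10 Ω} (hw : w ∈ D.W) :
    wform D.a K.toSet (val w) (val w) ≤
      CI ^ 2 * D.H ^ 2 * ∑ K' ∈ D.coarse.near K 1, D.form K'.toSet w w := by
  rw [← D.form_patch hK, ← D.sq_wnorm_grad, ← D.isWeight.wnorm_sq, ← mul_pow, ← mul_pow]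
  exact pow_le_pow_left₀ (wnorm_nonneg _ _ _) (h.interp.2 K hK w hw) 2

/-- On W_h the approximation property bounds values on K by gradients on one layer around it; in
this way vanishing energy yields vanishing values. -/
theorem vanishOn_of_form {K : Rect d} (hK : K ∈ D.coarse.cells) {w : H10 Ω} (hw : w ∈ D.W)
    (h0 : ∀ K' ∈ D.coarse.near K 1, D.form K'.toSet w w = 0) : VanishOn w K := by
  refine D.isWeight.ae_eq_zero D.a_pos K.measurableSet_toSet
    (le_antisymm ((h.wform_val_le hK hw).trans ?_) (D.isWeight.wform_self_nonneg _ _))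
  rw [Finset.sum_eq_zero h0, mul_zero]

/-- Nodal multiplication by the cutoff function is stable in the energy norm on `W_h`. -/
theorem form_nodal_mul_le {A : Finset (Rect d)} (hA : A ⊆ D.coarse.cells) {w w' : H10 Ω}
    (hw : w ∈ D.W) {c : Rect d → (Fin d → Bool) → ℝ}
    (hc : ∀ k ∈ D.fine.cells, RectMesh.IsVertexValues w k (c k))
    (hc' : ∀ k ∈ D.fine.cells,
      RectMesh.IsVertexValues w' k fun τ => D.coarse.cutoff A (k.vertex τ) * c k τ)
    {K : Rect d} (hK : K ∈ D.coarse.cells) :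
    D.form K.toSet w' w' ≤
      nodalConst d σ CI * ∑ K' ∈ D.coarse.near K 1, D.form K'.toSet w w := by
  have hH := h.H_pos
  have hσ := h.one_le_shape
  have hdpos : (0:ℝ) < d := by exact_mod_cast h.pos
  have hκ : 0 < kappa d σ := by unfold kappa; positivity
  have key : ∀ k ∈ @Finset.filter _ (fun k => k.toSet ⊆ K.toSet) (Classical.decPred _) D.fine.cells,
      wform D.a k.toSet (grad w') (grad w') ≤ 2 * wform D.a k.toSet (grad w) (grad w) +
        2 * d * 64 ^ d * (σ ^ 2 * kappa d σ / D.H) ^ 2 * wform D.a k.toSet (val w) (val w) := by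
    intro k hk
    obtain ⟨hk, hkK⟩ := (@Finset.mem_filter _ _ (Classical.decPred _) _ _).1 hk
    obtain ⟨α, hα⟩ := D.resolves k hk
    set i₀ : Fin d := ⟨0, h.pos⟩ with hi₀
    set l := k.hi i₀ - k.lo i₀ with hl
    have hlp : 0 < l := sub_pos.2 (k.lt _)
    -- The first factor bounds the oscillation of the cutoff over the fine cell, the second its
    -- inverse widths. The fine width l cancels, and the remaining 1/H is compensated by the
    -- approximation property on W_h.
    have e : σ ^ 2 * kappa d σ / D.H = (σ * l * kappa d σ / D.H) * (σ / l) := by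
      field_simp
    rw [e]
    -- The value α is tied to the coefficient only almost everywhere; max α 0 is nonnegative without
    -- discussing whether the cell is null.
    refine RectMesh.wform_nodal_mul_le (𝒯 := D.fine) hk (le_max_right α 0) ?_ (hc k hk) (hc' k hk) ?_ ?_ ?_
      (by positivity)
    · filter_upwards [hα] with x hx hxk
      have h1 : D.a x = α := hx hxk
      rw [h1, max_eq_left]
      rw [← h1]; exact (D.a_pos x).le
    · intro τ
      rw [abs_of_nonneg (D.coarse.cutoff_nonneg _ _)]
      exact D.coarse.cutoff_le_one _ _
    · intro τ τ'
      refine D.coarse.abs_cutoff_sub_le hA hK (hkK (k.vertex_mem τ)) (hkK (k.vertex_mem τ'))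
        (by positivity) fun i => ?_
      have h1 : |k.vertex τ i - k.vertex τ' i| ≤ k.hi i - k.lo i := by
        have a1 := k.vertex_mem τ i
        have a2 := k.vertex_mem τ' i
        rw [abs_le]; constructor <;> linarith
      refine h1.trans ((h.fineShape k hk i i₀).trans ?_)
      have h2 := D.coarse.size_le_width h.shape h.quasi hK i
      have : D.H ≤ kappa d σ * (K.hi i - K.lo i) := h2
      calc σ * (k.hi i₀ - k.lo i₀) = σ * l / D.H * D.H := by field_simp; rw [hl]
        _ ≤ σ * l / D.H * (kappa d σ * (K.hi i - K.lo i)) := by gcongr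
        _ = _ := by ring
    · intro i
      have h1 := h.fineShape k hk i₀ i
      have h2 := sub_pos.2 (k.lt i)
      rw [inv_eq_one_div, div_le_div_iff₀ h2 hlp, one_mul]
      exact h1
  have hsum := Finset.sum_le_sum key
  rw [Finset.sum_add_distrib, ← Finset.mul_sum, ← Finset.mul_sum, ← D.wform_coarse_cell hK,
    ← D.wform_coarse_cell hK, ← D.wform_coarse_cell hK] at hsum
  have hv := h.wform_val_le hK hw
  set S := ∑ K' ∈ D.coarse.near K 1, D.form K'.toSet w w with hS
  have hself : D.form K.toSet w w ≤ S :=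
    Finset.single_le_sum (f := fun K' : Rect d => D.form K'.toSet w w)
      (fun K' _ => D.form_self_nonneg _ _) (D.coarse.mem_near_self hK 1)
  refine hsum.trans ?_
  calc _ ≤ 2 * S + 2 * d * 64 ^ d * (σ ^ 2 * kappa d σ / D.H) ^ 2 * (CI ^ 2 * D.H ^ 2 * S) := by
        refine add_le_add (mul_le_mul_of_nonneg_left hself zero_le_two) ?_
        exact mul_le_mul_of_nonneg_left hv (by positivity)
    _ = _ := by unfold nodalConst; field_simp

/-- Two layers are lost: I_H v sees one layer around each cell, and recovering values from the
energy in W_h costs another. -/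
theorem vanishOn_sub_interp {v : H10 Ω} (hv : v ∈ D.fine.V) {K : Rect d}
    (hK : K ∈ D.coarse.cells) (h0 : ∀ K' ∈ D.coarse.near K 2, VanishOn v K') :
    VanishOn (v - (D.interp v : H10 Ω)) K := by
  refine h.vanishOn_of_form hK (D.sub_interp_mem hv) fun K' hK' => ?_
  have hc := D.coarse.near_subset hK 1 hK'
  have h1 : D.form K'.toSet v v = 0 :=
    D.form_of_vanishOn hc (h0 K' (D.coarse.near_mono hK one_le_two hK')) _
  have h2 : D.form K'.toSet (D.interp v : H10 Ω) (D.interp v : H10 Ω) = 0 := by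
    refine le_antisymm ((h.form_interp_le hc v).trans ?_) (D.form_self_nonneg _ _)
    rw [Finset.sum_eq_zero, mul_zero]
    intro K'' hK''
    have hm : K'' ∈ D.coarse.near K 2 := D.coarse.mem_near_trans hK' hK''
    exact D.form_of_vanishOn (D.coarse.near_subset hK 2 hm) (h0 K'' hm) _
  refine le_antisymm ?_ (D.form_self_nonneg _ _)
  have := two_mul_of_nonneg (D.form K'.toSet) (D.form_symm _) (D.form_self_nonneg _) v
    (-(D.interp v : H10 Ω))
  rw [← sub_eq_add_neg] at this
  simpa [h1, h2] using this

/-- Splitting a function of `W_h` into a part supported near the cells of `A` and a part that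
vanishes well inside `A`. -/
theorem exists_cut {A : Finset (Rect d)} (hA : A ⊆ D.coarse.cells) {w : H10 Ω} (hw : w ∈ D.W) :
    ∃ w₁ ∈ D.W, ∃ w₂ ∈ D.W, w = w₁ + w₂ ∧
      (∀ K ∈ D.coarse.cells, Disjoint (D.coarse.near K 3) A → VanishOn w₁ K) ∧
      (∀ K ∈ D.coarse.cells, D.coarse.near K 2 ⊆ A → VanishOn w₂ K) ∧
      ∀ K ∈ D.coarse.cells,
        D.form K.toSet w₁ w₁ ≤
          cutConst d σ CI * ∑ K' ∈ D.coarse.near K 2, D.form K'.toSet w w ∧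
        D.form K.toSet w₂ w₂ ≤
          cutConst d σ CI * ∑ K' ∈ D.coarse.near K 2, D.form K'.toSet w w := by
  -- The cut-off function is a nodal product, so that v is in V_h again; the pointwise product with
  -- the cutoff function would not be.
  obtain ⟨v, hv, c, hc⟩ := D.fine.exists_nodal_mul h.isOpen h.regular hw.1 (D.coarse.cutoff A)
  replace hv := D.fine.span_le_V h.isOpen h.regular hv
  have hint : D.interp w = 0 := hw.2
  have hcell : ∀ K ∈ D.coarse.cells, ∀ e : ℝ, (∀ x ∈ K.toSet, D.coarse.cutoff A x = e) →
      ∀ᵐ x ∂(volume.restrict Ω), x ∈ K.toSet → val v x = e * val w x := by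
    intro K hK e he
    have hae := (Filter.eventually_all_finset D.fine.cells).2 fun k hk => (hc k hk).1
    have hae' := (Filter.eventually_all_finset D.fine.cells).2 fun k hk => (hc k hk).2
    filter_upwards [hae, hae', D.ae_exists_fine h.isOpen hK] with x h1 h2 h3 hx
    obtain ⟨k, hk, hxk, hkK⟩ := h3 hx
    rw [h1 k hk hxk, h2 k hk hxk, Rect.multilin, Rect.multilin, Finset.mul_sum]
    exact Finset.sum_congr rfl fun τ _ => by rw [he _ (hkK (k.vertex_mem τ)), mul_assoc]
  have hv0 : ∀ K ∈ A, VanishOn v K := by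
    intro K hK
    filter_upwards [hcell K (hA hK) 0 fun x hx => D.coarse.cutoff_eq_zero hA hK hx] with x hx hxK
    rw [hx hxK, zero_mul]
  have hv1 : ∀ K ∈ D.coarse.cells, Disjoint (D.coarse.near K 1) A → VanishOn (w - v) K := by
    intro K hK hd
    have h1 := hcell K hK 1 fun x hx => D.coarse.cutoff_eq_one hA hK (fun L hL => by
      by_contra hne
      exact (Finset.disjoint_left.1 hd) (D.coarse.mem_near_one (hA hL)
        (nonempty_iff_ne_empty.2 hne)) hL) hx
    filter_upwards [h1, Lp.coeFn_sub (val w) (val v)] with x hx h2 hxK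
    rw [map_sub, h2, Pi.sub_apply, hx hxK, one_mul, sub_self]
  have hwv : w - v ∈ D.fine.V := Submodule.sub_mem _ hw.1 hv
  -- Subtracting the interpolants puts both parts into W_h, and because I_H w = 0 the two
  -- corrections cancel.
  have e1 : w = (w - v - (D.interp (w - v) : H10 Ω)) + (v - (D.interp v : H10 Ω)) := by
    rw [map_sub, hint, zero_sub, Submodule.coe_neg]; abel
  have hb2 : ∀ K ∈ D.coarse.cells,
      D.form K.toSet (v - (D.interp v : H10 Ω)) (v - (D.interp v : H10 Ω)) ≤
        (2 * nodalConst d σ CI + 2 * (CI ^ 2 * (cardBound d σ 1 * nodalConst d σ CI))) *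
          ∑ K' ∈ D.coarse.near K 2, D.form K'.toSet w w := by
    intro K hK
    have hnod : ∀ K ∈ D.coarse.cells, D.form K.toSet v v ≤
        nodalConst d σ CI * ∑ K' ∈ D.coarse.near K 1, D.form K'.toSet w w := fun K hK =>
      h.form_nodal_mul_le hA hw (fun k hk => (hc k hk).1) (fun k hk => (hc k hk).2) hK
    have hn0 := nodalConst_nonneg d σ CI
    have hnn : ∀ K' : Rect d, 0 ≤ D.form K'.toSet w w := fun K' => D.form_self_nonneg _ _
    have hmono : ∑ K' ∈ D.coarse.near K 1, D.form K'.toSet w w ≤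
        ∑ K' ∈ D.coarse.near K 2, D.form K'.toSet w w :=
      Finset.sum_le_sum_of_subset_of_nonneg (D.coarse.near_mono hK one_le_two) fun _ _ _ => hnn _
    have i1 := two_mul_of_nonneg (D.form K.toSet) (D.form_symm _) (D.form_self_nonneg _) v
      (-(D.interp v : H10 Ω))
    rw [← sub_eq_add_neg] at i1
    simp only [map_neg, LinearMap.neg_apply, neg_neg] at i1
    have i2 := h.form_interp_le hK v
    have i3 : ∑ K' ∈ D.coarse.near K 1, D.form K'.toSet v v ≤ nodalConst d σ CI *
        (cardBound d σ 1 * ∑ K' ∈ D.coarse.near K 2, D.form K'.toSet w w) := by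
      refine (Finset.sum_le_sum fun K' hK' => hnod K' (D.coarse.near_subset hK 1 hK')).trans ?_
      rw [← Finset.mul_sum]
      refine mul_le_mul_of_nonneg_left ?_ hn0
      refine (D.coarse.sum_near_near_le (K := K) (f := fun K' => D.form K'.toSet w w) hnn 1 1).trans ?_
      exact mul_le_mul_of_nonneg_right (h.card_near_le hK 1) (Finset.sum_nonneg fun _ _ => hnn _)
    have i4 := hnod K hK
    have i5 := mul_le_mul_of_nonneg_left i3 (sq_nonneg CI)
    have i6 := mul_le_mul_of_nonneg_left hmono hn0
    linarith
  refine ⟨_, D.sub_interp_mem hwv, _, D.sub_interp_mem hv, e1, ?_, ?_, ?_⟩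
  · intro K hK hd
    -- Of the three layers, two pay for the interpolation and one for the zone in which the cutoff
    -- rises from 0 to 1.
    refine h.vanishOn_sub_interp hwv hK fun K' hK' => hv1 K' (D.coarse.near_subset hK 2 hK') ?_
    exact hd.mono_left fun K'' hK'' => D.coarse.mem_near_trans hK' hK''
  · intro K hK hd
    exact h.vanishOn_sub_interp hv hK fun K' hK' => hv0 K' (hd hK')
  · intro K hK
    have hb := hb2 K hK
    have hS : D.form K.toSet w w ≤ ∑ K' ∈ D.coarse.near K 2, D.form K'.toSet w w :=
      Finset.single_le_sum (f := fun K' : Rect d => D.form K'.toSet w w)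
        (fun K' _ => D.form_self_nonneg _ _) (D.coarse.mem_near_self hK 2)
    have hw0 := D.form_self_nonneg K.toSet w
    refine ⟨?_, ?_⟩
    · have e2 : w - v - (D.interp (w - v) : H10 Ω) = w + -(v - (D.interp v : H10 Ω)) := by
        rw [map_sub, hint, zero_sub, Submodule.coe_neg]; abel
      have i1 := two_mul_of_nonneg (D.form K.toSet) (D.form_symm _) (D.form_self_nonneg _) w
        (-(v - (D.interp v : H10 Ω)))
      rw [← e2] at i1
      rw [LinearMap.BilinForm.neg_left, LinearMap.BilinForm.neg_right, neg_neg] at i1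
      unfold cutConst
      linarith
    · have hn := D.form_self_nonneg K.toSet (v - (D.interp v : H10 Ω))
      unfold cutConst
      linarith

end Admissible

end LOD

/-! ### Galerkin projections -/

/-- `galerkin` is defined by choice, so a given solution is its value only once uniqueness is known.
-/
theorem galerkin_eq {X : Type*} [Zero X] {B : X → X → ℝ} {S : Set X} {ℓ : X → ℝ} {z : X}
    (hz : z ∈ S) (h : ∀ w ∈ S, B z w = ℓ w)
    (huniq : ∀ z' ∈ S, (∀ w ∈ S, B z' w = ℓ w) → z' = z) : galerkin B S ℓ = z := by
  have hex : ∃ z ∈ S, ∀ w ∈ S, B z w = ℓ w := ⟨z, hz, h⟩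
  rw [galerkin, dif_pos hex]
  exact huniq _ hex.choose_spec.1 hex.choose_spec.2

/-- The Galerkin solution operator of a coercive form on a complete subspace. -/
theorem exists_galerkin_clm {X : Type*} [NormedAddCommGroup X] [InnerProductSpace ℝ X]
    (B A : X →L[ℝ] X →L[ℝ] ℝ) (hB : IsCoercive B) (S : Submodule ℝ X) [CompleteSpace S] :
    ∃ P : X →L[ℝ] X, ∀ v, P v ∈ S ∧ ∀ w ∈ S, B (P v) w = A v w := by
  -- Lax–Milgram on S, applied to the Riesz representative of A v restricted to S. A separate
  -- right-hand form A covers both elliptic projections and correctors, and the solution operator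
  -- comes out linear and continuous, so that it commutes with time integrals.
  let res : (X →L[ℝ] ℝ) →L[ℝ] (S →L[ℝ] ℝ) :=
    (ContinuousLinearMap.compL ℝ S X ℝ).flip S.subtypeL
  let BS : S →L[ℝ] S →L[ℝ] ℝ := res.comp (B.comp S.subtypeL)
  have hBS : IsCoercive BS := by
    obtain ⟨C, hC, h⟩ := hB
    exact ⟨C, hC, fun u => h u⟩
  let R : X →L[ℝ] S :=
    { toFun := fun v => (InnerProductSpace.toDual ℝ S).symm (res (A v))
      map_add' := fun v v' => by rw [map_add, map_add, map_add]
      map_smul' := fun c v => by rw [map_smul, map_smul]; simp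
      cont := (InnerProductSpace.toDual ℝ S).symm.continuous.comp
        (res.continuous.comp A.continuous) }
  refine ⟨S.subtypeL.comp
    ((hBS.continuousLinearEquivOfBilin.symm : S →L[ℝ] S).comp R), fun v => ⟨Subtype.coe_prop _, ?_⟩⟩
  intro w hw
  have h1 := hBS.continuousLinearEquivOfBilin_apply
    (hBS.continuousLinearEquivOfBilin.symm (R v)) ⟨w, hw⟩
  rw [ContinuousLinearEquiv.apply_symm_apply] at h1
  have h2 : inner ℝ (R v) (⟨w, hw⟩ : S) = A v w :=
    InnerProductSpace.toDual_symm_apply (y := res (A v))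
  exact h1.symm.trans h2

/-! ### Galerkin problems for correctors and elliptic projections. -/

namespace LOD

variable {d : ℕ} {Ω : Set (E d)} (D : LOD Ω)

theorem norm_grad_le (v : H10 Ω) : ‖grad v‖ ≤ ‖v‖ := by
  refine abs_le_of_sq_le_sq' ?_ (norm_nonneg _) |>.2
  rw [h10_norm_sq]
  exact le_add_of_nonneg_left (sq_nonneg _)

theorem form_self_le_univ (S : Set (E d)) (v : H10 Ω) : D.form S v v ≤ D.form univ v v :=
  D.isWeight.wform_mono (subset_univ S) _

theorem form_self_le (S : Set (E d)) (v : H10 Ω) : D.form S v v ≤ max D.a₀ 1 * ‖v‖ ^ 2 := by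
  refine (D.form_self_le_univ S v).trans ((D.isWeight.wform_le D.a_le _).trans ?_)
  have h1 := norm_grad_le v
  have h2 : (0:ℝ) ≤ max D.a₀ 1 := zero_le_one.trans (le_max_right _ _)
  exact mul_le_mul_of_nonneg_left (pow_le_pow_left₀ (norm_nonneg _) h1 2) h2

theorem abs_form_le (S : Set (E d)) (v w : H10 Ω) :
    |D.form S v w| ≤ max D.a₀ 1 * ‖v‖ * ‖w‖ := by
  have hM : (0:ℝ) ≤ max D.a₀ 1 := zero_le_one.trans (le_max_right _ _)
  refine (abs_le_sqrt_of_nonneg _ (D.form_symm S) (D.form_self_nonneg S) v w).trans ?_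
  rw [← Real.sqrt_mul (D.form_self_nonneg S v)]
  refine Real.sqrt_le_iff.2 ⟨by positivity, ?_⟩
  calc _ ≤ (max D.a₀ 1 * ‖v‖ ^ 2) * (max D.a₀ 1 * ‖w‖ ^ 2) := by
        gcongr
        exacts [D.form_self_nonneg _ _, D.form_self_le _ _, D.form_self_le _ _]
    _ = _ := by ring

/-- `form` as a continuous bilinear form. -/
def formL (S : Set (E d)) : H10 Ω →L[ℝ] H10 Ω →L[ℝ] ℝ :=
  (D.form S).mkContinuous₂ (max D.a₀ 1) fun v w => D.abs_form_le S v w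

theorem formL_apply (S : Set (E d)) (v w : H10 Ω) : D.formL S v w = D.form S v w := rfl

/-- The functions of `W_h` that vanish on the cells outside the patch `U_m(K)`. -/
def WNear (K : Rect d) (m : ℕ) : Submodule ℝ (H10 Ω) where
  carrier := {w | w ∈ D.W ∧ ∀ K' ∈ D.coarse.cells, K' ∉ D.coarse.near K m → VanishOn w K'}
  zero_mem' := ⟨D.W.zero_mem, fun K' _ _ => by
    filter_upwards [Lp.coeFn_zero ℝ 2 (volume.restrict Ω)] with x hx _
    rw [map_zero, hx, Pi.zero_apply]⟩
  add_mem' := fun {v w} hv hw => ⟨D.W.add_mem hv.1 hw.1, fun K' h1 h2 => by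
    filter_upwards [hv.2 K' h1 h2, hw.2 K' h1 h2, Lp.coeFn_add (val v) (val w)] with x a1 a2 a3 hx
    rw [map_add, a3, Pi.add_apply, a1 hx, a2 hx, add_zero]⟩
  smul_mem' := fun c v hv => ⟨D.W.smul_mem c hv.1, fun K' h1 h2 => by
    filter_upwards [hv.2 K' h1 h2, Lp.coeFn_smul c (val v)] with x a1 a3 hx
    rw [map_smul, a3, Pi.smul_apply, a1 hx, smul_zero]⟩

/-- Cells overlap in null sets only, so vanishing off the patch can be checked cell by cell. This
turns the local space into a subspace described by combinatorial distance. -/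
theorem WOn_patch (hΩ : IsOpen Ω) {K : Rect d} (hK : K ∈ D.coarse.cells) (m : ℕ) :
    D.WOn (D.coarse.patch K m) = (D.WNear K m : Set (H10 Ω)) := by
  ext w
  refine and_congr_right fun _ => ?_
  rw [D.coarse.patch_eq]
  simp only [mem_iUnion, exists_prop, not_exists, not_and]
  constructor
  · intro h K' hK' hn
    filter_upwards [h, ae_restrict_of_ae D.coarse.ae_not_mem_inter] with x h1 h2 hx
    refine h1 fun K'' hK'' hx'' => h2 K' hK' K'' (D.coarse.near_subset hK m hK'') ?_ ⟨hx, hx''⟩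
    rintro rfl
    exact hn hK''
  · intro h
    have h' : ∀ᵐ x ∂(volume.restrict Ω), ∀ K' ∈ D.coarse.cells, K' ∉ D.coarse.near K m →
        x ∈ K'.toSet → val w x = 0 := by
      refine (Filter.eventually_all_finset D.coarse.cells).2 fun K' hK' => ?_
      by_cases hn : K' ∈ D.coarse.near K m
      · exact Filter.Eventually.of_forall fun x hx => absurd hn hx
      · filter_upwards [h K' hK' hn] with x hx _
        exact hx
    filter_upwards [h', ae_restrict_mem hΩ.measurableSet] with x h1 hx h2
    obtain ⟨K', hK', hxK'⟩ := D.coarse.exists_cell (subset_closure hx)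
    exact h1 K' hK' (fun hn => h2 K' hn hxK') hxK'

/-- Cells outside the patch contribute nothing, so the local corrector problem may be posed with the
global form and compared with the ideal one. -/
theorem form_patch_of_mem {K : Rect d} (hK : K ∈ D.coarse.cells) {m : ℕ} {z : H10 Ω}
    (hz : z ∈ D.WNear K m) (w : H10 Ω) :
    D.form (D.coarse.patch K m) z w = D.form univ z w := by
  rw [D.form_patch hK, D.form_univ]
  refine Finset.sum_subset (D.coarse.near_subset hK m) fun K' h1 h2 => ?_
  exact D.form_of_vanishOn h1 (hz.2 K' h1 h2) w

/-- The element corrector without localization. -/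
def idealCell (K : Rect d) (v : H10 Ω) : H10 Ω :=
  galerkin D.b D.W fun w => -formOn D.a K.toSet v w

/-- The corrector without localization. -/
def ideal (v : H10 Ω) : H10 Ω := ∑ K ∈ D.coarse.cells, D.idealCell K v

theorem energyNorm_eq (v : H10 Ω) : D.energyNorm v = √(D.form univ v v) := wnorm_eq_sqrt _ _ _

theorem energyNorm_nonneg (v : H10 Ω) : 0 ≤ D.energyNorm v := Real.sqrt_nonneg _

theorem energyNorm_sq (v : H10 Ω) : D.energyNorm v ^ 2 = D.form univ v v := D.sq_wnorm_grad _ _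

theorem energyNorm_add_le (v w : H10 Ω) : D.energyNorm (v + w) ≤ D.energyNorm v + D.energyNorm w := by
  simp only [energyNorm_eq]
  exact sqrt_add_le_of_nonneg _ (D.form_symm _) (D.form_self_nonneg _) v w

theorem abs_form_le_energyNorm (v w : H10 Ω) :
    |D.form univ v w| ≤ D.energyNorm v * D.energyNorm w := by
  simp only [energyNorm_eq]
  exact abs_le_sqrt_of_nonneg _ (D.form_symm _) (D.form_self_nonneg _) v w

/-- Céa's lemma for the form `b`. -/
theorem form_sub_le_of_orthogonal {x z w : H10 Ω} (h : D.form univ (x - z) (z - w) = 0) :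
    D.form univ (x - z) (x - z) ≤ D.form univ (x - w) (x - w) := by
  have e : x - w = (x - z) + (z - w) := by abel
  have hs := D.form_symm univ (z - w) (x - z)
  have hn := D.form_self_nonneg univ (z - w)
  rw [e, LinearMap.BilinForm.add_left, LinearMap.BilinForm.add_right,
    LinearMap.BilinForm.add_right, hs, h]
  linarith

namespace Admissible

variable {D} {σ CI CP : ℝ} (h : D.Admissible σ CI CP)
include h

/-- This coercivity constant depends on the contrast. That is harmless: it serves only for
existence, uniqueness and continuity of Galerkin solutions, and enters no estimate. -/
theorem isCoercive : IsCoercive (D.formL univ) := by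
  have hm : 0 < min D.a₀ 1 := lt_min D.a₀_pos one_pos
  have hCP : 0 < CP := one_pos.trans_le h.one_le_CP
  have hc : 0 < CP ^ 2 + (min D.a₀ 1)⁻¹ := by positivity
  refine ⟨(CP ^ 2 + (min D.a₀ 1)⁻¹)⁻¹, by positivity, fun v => ?_⟩
  rw [formL_apply, mul_assoc, ← sq, inv_mul_le_iff₀ hc, h10_norm_sq, add_mul]
  refine add_le_add ?_ ?_
  · rw [← D.energyNorm_sq, ← mul_pow]
    exact pow_le_pow_left₀ (norm_nonneg _) (h.poincare v) 2
  · rw [← div_eq_inv_mul, le_div_iff₀ hm, mul_comm]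
    exact D.isWeight.le_wform D.le_a _

theorem eq_zero_of_form {v : H10 Ω} (hv : D.form univ v v = 0) : v = 0 := by
  obtain ⟨C, hC, hc⟩ := h.isCoercive
  have h1 := hc v
  rw [formL_apply, hv] at h1
  by_contra hne
  have := norm_pos_iff.2 hne
  have : 0 < C * ‖v‖ * ‖v‖ := by positivity
  linarith

theorem eq_of_form {S : Submodule ℝ (H10 Ω)} {z z' : H10 Ω} (hz : z ∈ S) (hz' : z' ∈ S)
    (he : ∀ w ∈ S, D.form univ z' w = D.form univ z w) : z' = z := by
  have := he (z' - z) (S.sub_mem hz' hz)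
  refine sub_eq_zero.1 (h.eq_zero_of_form ?_)
  rw [LinearMap.BilinForm.sub_left, this, sub_self]

theorem finiteDimensional_fine : FiniteDimensional ℝ D.fine.V :=
  D.fine.finiteDimensional_V h.isOpen h.regular

theorem completeSpace {S : Submodule ℝ (H10 Ω)} (hS : S ≤ D.fine.V) : CompleteSpace S := by
  have := h.finiteDimensional_fine
  have := Submodule.finiteDimensional_of_le hS
  exact FiniteDimensional.complete ℝ S

theorem exists_proj {S : Submodule ℝ (H10 Ω)} (hS : S ≤ D.fine.V) (A : H10 Ω →L[ℝ] H10 Ω →L[ℝ] ℝ) :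
    ∃ P : H10 Ω →L[ℝ] H10 Ω, ∀ v, P v ∈ S ∧ ∀ w ∈ S, D.form univ (P v) w = A v w := by
  have := h.completeSpace hS
  exact exists_galerkin_clm _ A h.isCoercive S

theorem exists_ritz {S : Submodule ℝ (H10 Ω)} (hS : S ≤ D.fine.V) :
    ∃ P : H10 Ω →L[ℝ] H10 Ω, ∀ v, P v = galerkin D.b S (D.b v) ∧ P v ∈ S ∧
      ∀ w ∈ S, D.form univ (P v) w = D.form univ v w := by
  obtain ⟨P, hP⟩ := h.exists_proj hS (D.formL univ)
  refine ⟨P, fun v => ⟨?_, (hP v).1, (hP v).2⟩⟩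
  refine (galerkin_eq (hP v).1 (hP v).2 fun z' hz' he => ?_).symm
  exact h.eq_of_form (hP v).1 hz' fun w hw => (he w hw).trans ((hP v).2 w hw).symm

theorem exists_cellCorrector {K : Rect d} (hK : K ∈ D.coarse.cells) (m : ℕ) :
    ∃ P : H10 Ω →L[ℝ] H10 Ω, ∀ v, P v = D.cellCorrector m K v ∧ P v ∈ D.WNear K m ∧
      ∀ w ∈ D.WNear K m, D.form univ (P v) w = -D.form K.toSet v w := by
  obtain ⟨P, hP⟩ := h.exists_proj (S := D.WNear K m) (fun w hw => hw.1.1) (-D.formL K.toSet)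
  refine ⟨P, fun v => ⟨?_, (hP v).1, (hP v).2⟩⟩
  rw [cellCorrector, D.WOn_patch h.isOpen hK]
  refine (galerkin_eq (hP v).1 (fun w hw => ?_) fun z' hz' he => ?_).symm
  · rw [formOn_eq, D.form_patch_of_mem hK (hP v).1]
    exact (hP v).2 w hw
  · refine h.eq_of_form (hP v).1 hz' fun w hw => ?_
    rw [← D.form_patch_of_mem hK hz']
    exact (he w hw).trans ((hP v).2 w hw).symm

theorem cellCorrector_mem {K : Rect d} (hK : K ∈ D.coarse.cells) (m : ℕ) (v : H10 Ω) :
    D.cellCorrector m K v ∈ D.WNear K m := by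
  obtain ⟨P, hP⟩ := h.exists_cellCorrector hK m
  rw [← (hP v).1]
  exact (hP v).2.1

theorem form_cellCorrector {K : Rect d} (hK : K ∈ D.coarse.cells) (m : ℕ) (v : H10 Ω) {w : H10 Ω}
    (hw : w ∈ D.WNear K m) : D.form univ (D.cellCorrector m K v) w = -D.form K.toSet v w := by
  obtain ⟨P, hP⟩ := h.exists_cellCorrector hK m
  rw [← (hP v).1]
  exact (hP v).2.2 w hw

theorem idealCell_spec (K : Rect d) (v : H10 Ω) :
    D.idealCell K v ∈ D.W ∧ ∀ w ∈ D.W, D.form univ (D.idealCell K v) w = -D.form K.toSet v w := by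
  obtain ⟨P, hP⟩ := h.exists_proj (S := D.W) (fun w hw => hw.1) (-D.formL K.toSet)
  have : D.idealCell K v = P v := by
    refine galerkin_eq (hP v).1 (hP v).2 fun z' hz' he => ?_
    exact h.eq_of_form (hP v).1 hz' fun w hw => (he w hw).trans ((hP v).2 w hw).symm
  rw [this]
  exact hP v

theorem exists_ms (m : ℕ) : ∃ M : H10 Ω →L[ℝ] H10 Ω, ∀ v, M v = D.ms m v := by
  classical
  have : ∀ K : Rect d, ∃ P : H10 Ω →L[ℝ] H10 Ω, K ∈ D.coarse.cells →
      ∀ v, P v = D.cellCorrector m K v := by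
    intro K
    by_cases hK : K ∈ D.coarse.cells
    · obtain ⟨P, hP⟩ := h.exists_cellCorrector hK m
      exact ⟨P, fun _ v => (hP v).1⟩
    · exact ⟨0, fun hc => absurd hc hK⟩
  choose P hP using this
  refine ⟨ContinuousLinearMap.id ℝ _ + ∑ K ∈ D.coarse.cells, P K, fun v => ?_⟩
  rw [add_apply, sum_apply, ms, corrector]
  congr 1
  exact Finset.sum_congr rfl fun K hK => hP K hK v

theorem corrector_mem (m : ℕ) (v : H10 Ω) : D.corrector m v ∈ D.W :=
  Submodule.sum_mem _ fun _ hK => (h.cellCorrector_mem hK m v).1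

theorem ideal_mem (v : H10 Ω) : D.ideal v ∈ D.W :=
  Submodule.sum_mem _ fun K _ => (h.idealCell_spec K v).1

/-- The right-hand sides of the element problems add up to -b(v, ·) on W_h. This orthogonality is
the reason for introducing the corrector. -/
theorem form_add_ideal (v : H10 Ω) {w : H10 Ω} (hw : w ∈ D.W) :
    D.form univ (v + D.ideal v) w = 0 := by
  rw [LinearMap.BilinForm.add_left, ideal, map_sum, LinearMap.sum_apply, D.form_univ v w,
    ← Finset.sum_add_distrib]
  exact Finset.sum_eq_zero fun K _ => by rw [(h.idealCell_spec K v).2 w hw, add_neg_cancel]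

theorem ms_mem_fine (m : ℕ) {v : H10 Ω} (hv : v ∈ D.coarse.V) : D.ms m v ∈ D.fine.V :=
  Submodule.add_mem _ (D.coarse_le_fine hv) (h.corrector_mem m v).1

/-- The multiscale space as a submodule. -/
theorem exists_Vms (m : ℕ) : ∃ S : Submodule ℝ (H10 Ω), (S : Set (H10 Ω)) = D.Vms m ∧
    S ≤ D.fine.V := by
  obtain ⟨M, hM⟩ := h.exists_ms m
  refine ⟨D.coarse.V.map M.toLinearMap, ?_, ?_⟩
  · rw [Submodule.map_coe, Vms]
    exact image_congr fun v _ => hM v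
  · rintro _ ⟨v, hv, rfl⟩
    change M v ∈ _
    rw [hM]
    exact h.ms_mem_fine m hv

end Admissible

end LOD

theorem RectMesh.mem_near_add {d : ℕ} {Ω : Set (E d)} (𝒯 : RectMesh Ω) {K K' K'' : Rect d}
    {m n k : ℕ} (h1 : K' ∈ 𝒯.near K m) (h2 : K'' ∈ 𝒯.near K' n) (hk : m + n = k) :
    K'' ∈ 𝒯.near K k := hk ▸ 𝒯.mem_near_trans h1 h2

namespace LOD

variable {d : ℕ} {Ω : Set (E d)} (D : LOD Ω)

/-! ### Exponential decay of the element correctors -/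

open Classical in
/-- The energy outside the patch `U_n(K)`. -/
def tail (K : Rect d) (n : ℕ) (v : H10 Ω) : ℝ :=
  ∑ K' ∈ D.coarse.cells, if K' ∈ D.coarse.near K n then 0 else D.form K'.toSet v v

theorem tail_antitone {K : Rect d} (hK : K ∈ D.coarse.cells) {n n' : ℕ} (hn : n ≤ n') (v : H10 Ω) :
    D.tail K n' v ≤ D.tail K n v := by
  refine Finset.sum_le_sum fun K' _ => ?_
  have := D.form_self_nonneg K'.toSet v
  split_ifs with h1 h2 h2
  exacts [le_rfl, this, absurd (D.coarse.near_mono hK hn h2) h1, le_rfl]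

theorem tail_le (K : Rect d) (n : ℕ) (v : H10 Ω) : D.tail K n v ≤ D.form univ v v := by
  rw [D.form_univ]
  refine Finset.sum_le_sum fun K' _ => ?_
  split_ifs
  exacts [D.form_self_nonneg _ _, le_rfl]

theorem form_eq_zero_of_vanishOn {v w : H10 Ω}
    (hvw : ∀ K ∈ D.coarse.cells, VanishOn v K ∨ VanishOn w K) : D.form univ v w = 0 := by
  rw [D.form_univ]
  refine Finset.sum_eq_zero fun K hK => ?_
  rcases hvw K hK with hv | hw
  · exact D.form_of_vanishOn hK hv w
  · rw [D.form_symm]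
    exact D.form_of_vanishOn hK hw v

variable {D}

/-- The constant in the Caccioppoli-type inequality. -/
def annulusConst (d : ℕ) (σ CI : ℝ) : ℝ := (1 + cutConst d σ CI) / 2 * cardBound d σ 2

/-- The decay rate of the correctors, per nine layers. -/
def decayRate (d : ℕ) (σ CI : ℝ) : ℝ := annulusConst d σ CI / (1 + annulusConst d σ CI)

/-- The constant in the localization error of the element correctors. -/
def locConst (d : ℕ) (σ CI : ℝ) : ℝ := 1 + cutConst d σ CI * cardBound d σ 2

/-- The overlap constant in the localization error of the corrector. -/
def overlapConst (d : ℕ) (σ CI : ℝ) (m : ℕ) : ℝ :=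
  1 + cutConst d σ CI * (cardBound d σ (m + 5) * cardBound d σ (m + 7))

/-- The bound for the squared localization error. -/
def locError (d : ℕ) (σ CI : ℝ) (m : ℕ) : ℝ :=
  overlapConst d σ CI m * (locConst d σ CI * decayRate d σ CI ^ ((m - 7) / 9))

theorem annulusConst_nonneg (d : ℕ) (σ CI : ℝ) : 0 ≤ annulusConst d σ CI := by
  have := cutConst_nonneg d σ CI
  have := cardBound_nonneg d σ 2
  unfold annulusConst; positivity

theorem decayRate_nonneg (d : ℕ) (σ CI : ℝ) : 0 ≤ decayRate d σ CI := by
  have := annulusConst_nonneg d σ CI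
  unfold decayRate; positivity

theorem decayRate_lt_one (d : ℕ) (σ CI : ℝ) : decayRate d σ CI < 1 := by
  have := annulusConst_nonneg d σ CI
  unfold decayRate
  rw [div_lt_one (by linarith)]
  linarith

theorem one_le_locConst (d : ℕ) (σ CI : ℝ) : 1 ≤ locConst d σ CI := by
  have := cutConst_nonneg d σ CI
  have := cardBound_nonneg d σ 2
  unfold locConst
  exact le_add_of_nonneg_right (by positivity)

theorem one_le_overlapConst (d : ℕ) (σ CI : ℝ) (m : ℕ) : 1 ≤ overlapConst d σ CI m := by
  have := cutConst_nonneg d σ CI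
  have := cardBound_nonneg d σ (m + 5)
  have := cardBound_nonneg d σ (m + 7)
  unfold overlapConst
  exact le_add_of_nonneg_right (by positivity)

theorem locError_nonneg (d : ℕ) (σ CI : ℝ) (m : ℕ) : 0 ≤ locError d σ CI m := by
  have := one_le_overlapConst d σ CI m
  have := one_le_locConst d σ CI
  have := decayRate_nonneg d σ CI
  unfold locError; positivity

namespace Admissible

variable {σ CI CP : ℝ} (h : D.Admissible σ CI CP)
include h

theorem sum_sum_near_le {f : Rect d → ℝ} (hf : ∀ K, 0 ≤ f K) (n : ℕ) :
    ∑ K ∈ D.coarse.cells, ∑ K' ∈ D.coarse.near K n, f K' ≤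
      cardBound d σ n * ∑ K ∈ D.coarse.cells, f K :=
  D.coarse.sum_sum_near_le hf n fun _ hK => h.card_near_le hK n

/-- Hole filling: the outer part φ₂ of φ is an admissible test function, hence orthogonal to φ. It
vanishes inside and equals φ outside, so the energy outside is controlled by what remains in the
annulus. -/
theorem tail_le_annulus {K : Rect d} (hK : K ∈ D.coarse.cells) {φ : H10 Ω} (hφ : φ ∈ D.W)
    (horth : ∀ w ∈ D.W, VanishOn w K → D.form univ φ w = 0) (n : ℕ) :
    D.tail K (n + 9) φ ≤ annulusConst d σ CI * (D.tail K n φ - D.tail K (n + 9) φ) := by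
  classical
  -- Nine layers are consumed. Cutting at n + 4 makes φ₂ vanish up to n + 2 and φ₁ vanish beyond n +
  -- 7; the energy bound for φ₂ looks two layers further on either side, to n and n + 9.
  obtain ⟨φ₁, -, φ₂, hφ₂, hsum, hfar, hin, hb⟩ :=
    h.exists_cut (D.coarse.near_subset hK (n + 4)) hφ
  set f : Rect d → ℝ := fun K' =>
    if K' ∈ D.coarse.near K n ∨ K' ∉ D.coarse.near K (n + 9) then 0 else D.form K'.toSet φ φ with hf
  have hf0 : ∀ K', 0 ≤ f K' := by
    intro K'
    simp only [hf]
    split_ifs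
    exacts [le_rfl, D.form_self_nonneg _ _]
  have hfsum : ∑ K' ∈ D.coarse.cells, f K' = D.tail K n φ - D.tail K (n + 9) φ := by
    rw [tail, tail, ← Finset.sum_sub_distrib]
    refine Finset.sum_congr rfl fun K' _ => ?_
    have : K' ∈ D.coarse.near K n → K' ∈ D.coarse.near K (n + 9) := fun hn =>
      D.coarse.near_mono hK (Nat.le_add_right n 9) hn
    simp only [hf]
    by_cases h1 : K' ∈ D.coarse.near K n
    · simp [h1, this h1]
    · by_cases h2 : K' ∈ D.coarse.near K (n + 9) <;> simp [h1, h2]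
  have hcut := cutConst_nonneg d σ CI
  have hpt : ∀ K' ∈ D.coarse.cells,
      (if K' ∈ D.coarse.near K (n + 9) then 0 else D.form K'.toSet φ φ) ≤
        D.form K'.toSet φ φ₂ +
          (1 + cutConst d σ CI) / 2 * ∑ K'' ∈ D.coarse.near K' 2, f K'' := by
    intro K' hK'
    have hS : 0 ≤ (1 + cutConst d σ CI) / 2 * ∑ K'' ∈ D.coarse.near K' 2, f K'' :=
      mul_nonneg (by linarith) (Finset.sum_nonneg fun _ _ => hf0 _)
    by_cases h1 : K' ∈ D.coarse.near K (n + 2)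
    · rw [if_pos (D.coarse.near_mono hK (by omega) h1), D.form_symm,
        D.form_of_vanishOn hK' (hin K' hK' fun K'' hK'' => D.coarse.mem_near_add h1 hK'' (by omega))]
      linarith
    · by_cases h2 : K' ∈ D.coarse.near K (n + 7)
      · rw [if_pos (D.coarse.near_mono hK (by omega) h2)]
        have hfe : ∑ K'' ∈ D.coarse.near K' 2, f K'' =
            ∑ K'' ∈ D.coarse.near K' 2, D.form K''.toSet φ φ := by
          refine Finset.sum_congr rfl fun K'' hK'' => ?_
          simp only [hf]
          rw [if_neg]
          rintro (h3 | h3)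
          · exact h1 (D.coarse.mem_near_add h3 (D.coarse.mem_near_comm hK' hK'') (by omega))
          · exact h3 (D.coarse.mem_near_add h2 hK'' (by omega))
        rw [hfe]
        have hy := young_of_nonneg _ (D.form_symm K'.toSet) (D.form_self_nonneg _) one_pos φ φ₂
        have hself : D.form K'.toSet φ φ ≤ ∑ K'' ∈ D.coarse.near K' 2, D.form K''.toSet φ φ :=
          Finset.single_le_sum (f := fun K'' : Rect d => D.form K''.toSet φ φ)
            (fun K'' _ => D.form_self_nonneg _ _) (D.coarse.mem_near_self hK' 2)
        have := neg_abs_le (D.form K'.toSet φ φ₂)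
        have := (hb K' hK').2
        rw [inv_one] at hy
        linarith
      · have hv : VanishOn φ₁ K' := by
          refine hfar K' hK' (Finset.disjoint_left.2 fun K'' a1 a2 => h2 ?_)
          exact D.coarse.mem_near_add a2 (D.coarse.mem_near_comm hK' a1) (by omega)
        have e : D.form K'.toSet φ φ₂ = D.form K'.toSet φ φ := by
          have e1 : D.form K'.toSet φ (φ₁ + φ₂) = D.form K'.toSet φ φ₂ := by
            rw [LinearMap.BilinForm.add_right, D.form_symm _ φ φ₁, D.form_of_vanishOn hK' hv,
              zero_add]
          rw [← e1, ← hsum]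
        rw [e]
        have := D.form_self_nonneg K'.toSet φ
        split_ifs <;> linarith
  have hz : D.form univ φ φ₂ = 0 := by
    refine horth φ₂ hφ₂ (hin K hK ?_)
    exact D.coarse.near_mono hK (by omega)
  have htot := Finset.sum_le_sum hpt
  rw [Finset.sum_add_distrib, ← D.form_univ, hz, zero_add, ← Finset.mul_sum] at htot
  refine htot.trans ?_
  rw [← hfsum, annulusConst, mul_assoc]
  exact mul_le_mul_of_nonneg_left (h.sum_sum_near_le hf0 2) (by linarith)

/-- Moving the outer tail in the annulus inequality to the left gives the contraction factor A/(1 +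
A) for every nine layers. -/
theorem tail_le_pow {K : Rect d} (hK : K ∈ D.coarse.cells) {φ : H10 Ω} (hφ : φ ∈ D.W)
    (horth : ∀ w ∈ D.W, VanishOn w K → D.form univ φ w = 0) (j : ℕ) :
    D.tail K (9 * j) φ ≤ decayRate d σ CI ^ j * D.form univ φ φ := by
  have hA := annulusConst_nonneg d σ CI
  induction j with
  | zero => simpa using D.tail_le K 0 φ
  | succ j ih =>
    have h1 := h.tail_le_annulus hK hφ horth (9 * j)
    have h2 : D.tail K (9 * j + 9) φ ≤ decayRate d σ CI * D.tail K (9 * j) φ := by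
      rw [decayRate, div_mul_eq_mul_div, le_div_iff₀ (by linarith)]
      linarith
    rw [mul_add, mul_one, pow_succ', mul_assoc]
    exact h2.trans (mul_le_mul_of_nonneg_left ih (decayRate_nonneg d σ CI))

/-- The corrector is tested with itself, and its part on K is absorbed by Young's inequality. -/
theorem form_idealCell_le (K : Rect d) (v : H10 Ω) :
    D.form univ (D.idealCell K v) (D.idealCell K v) ≤ D.form K.toSet v v := by
  obtain ⟨hm, hs⟩ := h.idealCell_spec K v
  have h1 := hs _ hm
  have hy := young_of_nonneg _ (D.form_symm K.toSet) (D.form_self_nonneg _) one_pos v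
    (D.idealCell K v)
  have := neg_abs_le (D.form K.toSet v (D.idealCell K v))
  have := D.form_self_le_univ K.toSet (D.idealCell K v)
  rw [inv_one] at hy
  linarith

/-- The localization error of an element corrector decays exponentially. -/
theorem form_idealCell_sub_le {K : Rect d} (hK : K ∈ D.coarse.cells) (m : ℕ) (v : H10 Ω) :
    D.form univ (D.idealCell K v - D.cellCorrector m K v)
        (D.idealCell K v - D.cellCorrector m K v) ≤
      locConst d σ CI * decayRate d σ CI ^ ((m - 7) / 9) * D.form K.toSet v v := by
  obtain ⟨hφ, hs⟩ := h.idealCell_spec K v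
  set φ := D.idealCell K v with hφdef
  have hmem := h.cellCorrector_mem hK m v
  have hcea : ∀ w ∈ D.WNear K m, D.form univ (φ - D.cellCorrector m K v)
      (φ - D.cellCorrector m K v) ≤ D.form univ (φ - w) (φ - w) := by
    intro w hw
    refine D.form_sub_le_of_orthogonal ?_
    have hw' := Submodule.sub_mem _ hmem hw
    rw [LinearMap.BilinForm.sub_left, hs _ hw'.1, h.form_cellCorrector hK m v hw', sub_self]
  have hτ0 := decayRate_nonneg d σ CI
  have hL := one_le_locConst d σ CI
  have hen := h.form_idealCell_le K v
  have hq := D.form_self_nonneg K.toSet v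
  -- For m < 7 the truncated subtraction makes the exponent 0, and the competitor 0 suffices.
  rcases lt_or_ge m 7 with hm | hm
  · have h0 := hcea 0 (Submodule.zero_mem _)
    rw [sub_zero] at h0
    have e : (m - 7) / 9 = 0 := by omega
    rw [e, pow_zero, mul_one]
    refine (h0.trans hen).trans ?_
    exact le_mul_of_one_le_left hq hL
  -- Cutting at m - 3 puts φ₁ into the local space, since the support spreads by three layers. The
  -- rest φ₂ vanishes up to m - 5, and its energy is bounded by that of φ beyond m - 7.
  · obtain ⟨φ₁, hφ₁, φ₂, -, hsum, hfar, hin, hb⟩ :=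
      h.exists_cut (D.coarse.near_subset hK (m - 3)) hφ
    have hφ₁' : φ₁ ∈ D.WNear K m := by
      refine ⟨hφ₁, fun K' hK' hn => hfar K' hK' (Finset.disjoint_left.2 fun K'' a1 a2 => hn ?_)⟩
      have := D.coarse.mem_near_trans a2 (D.coarse.mem_near_comm hK' a1)
      rwa [Nat.sub_add_cancel (by omega)] at this
    have h1 := hcea φ₁ hφ₁'
    have e : φ - φ₁ = φ₂ := by rw [hsum]; abel
    rw [e] at h1
    classical
    set f : Rect d → ℝ := fun K' =>
      if K' ∈ D.coarse.near K (m - 7) then 0 else D.form K'.toSet φ φ with hf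
    have hf0 : ∀ K', 0 ≤ f K' := by
      intro K'
      simp only [hf]
      split_ifs
      exacts [le_rfl, D.form_self_nonneg _ _]
    have hcut := cutConst_nonneg d σ CI
    have hpt : ∀ K' ∈ D.coarse.cells, D.form K'.toSet φ₂ φ₂ ≤
        cutConst d σ CI * ∑ K'' ∈ D.coarse.near K' 2, f K'' := by
      intro K' hK'
      by_cases hn : K' ∈ D.coarse.near K (m - 5)
      · rw [D.form_of_vanishOn hK' (hin K' hK' fun K'' hK'' => by
          have := D.coarse.mem_near_trans hn hK''
          rwa [show m - 5 + 2 = m - 3 by omega] at this)]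
        exact mul_nonneg hcut (Finset.sum_nonneg fun _ _ => hf0 _)
      · refine (hb K' hK').2.trans_eq ?_
        congr 1
        refine Finset.sum_congr rfl fun K'' hK'' => ?_
        simp only [hf]
        rw [if_neg]
        intro h3
        have := D.coarse.mem_near_trans h3 (D.coarse.mem_near_comm hK' hK'')
        rw [show m - 7 + 2 = m - 5 by omega] at this
        exact hn this
    have h2 := Finset.sum_le_sum hpt
    rw [← D.form_univ, ← Finset.mul_sum] at h2
    have h3 := h.sum_sum_near_le hf0 2
    have h4 : ∑ K' ∈ D.coarse.cells, f K' ≤ decayRate d σ CI ^ ((m - 7) / 9) * D.form K.toSet v v := by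
      have a1 : D.tail K (m - 7) φ ≤ D.tail K (9 * ((m - 7) / 9)) φ :=
        D.tail_antitone hK (Nat.mul_div_le _ _) φ
      have a2 := h.tail_le_pow hK hφ (fun w hw hwK => by
        rw [hs w hw, D.form_symm, D.form_of_vanishOn hK hwK, neg_zero]) ((m - 7) / 9)
      refine (a1.trans a2).trans (mul_le_mul_of_nonneg_left hen (by positivity))
    have hN := cardBound_nonneg d σ 2
    calc _ ≤ cutConst d σ CI * (cardBound d σ 2 *
          (decayRate d σ CI ^ ((m - 7) / 9) * D.form K.toSet v v)) := by
          refine h1.trans (h2.trans (mul_le_mul_of_nonneg_left ?_ hcut))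
          exact h3.trans (mul_le_mul_of_nonneg_left h4 hN)
      _ ≤ _ := by
          have : 0 ≤ decayRate d σ CI ^ ((m - 7) / 9) * D.form K.toSet v v := by positivity
          unfold locConst
          linarith

/-- The localization error of the corrector. -/
theorem form_ideal_sub_le (m : ℕ) (v : H10 Ω) :
    D.form univ (D.ideal v - D.corrector m v) (D.ideal v - D.corrector m v) ≤
      locError d σ CI m * D.form univ v v := by
  set e := D.ideal v - D.corrector m v with he
  have heW : e ∈ D.W := Submodule.sub_mem _ (h.ideal_mem v) (h.corrector_mem m v)
  set ε : Rect d → H10 Ω := fun K => D.idealCell K v - D.cellCorrector m K v with hε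
  have hesum : e = ∑ K ∈ D.coarse.cells, ε K := by
    rw [he, ideal, corrector, Finset.sum_sub_distrib]
  set P := overlapConst d σ CI m with hP
  have hP1 : 1 ≤ P := one_le_overlapConst d σ CI m
  have hcut := cutConst_nonneg d σ CI
  -- Each element error interacts only with the part of e near K. Summing these local bounds avoids
  -- a factor growing with the number of all elements.
  have hcell : ∀ K ∈ D.coarse.cells, 2 * D.form univ (ε K) e ≤
      P * D.form univ (ε K) (ε K) + P⁻¹ * (cutConst d σ CI * (cardBound d σ (m + 5) *
        ∑ K' ∈ D.coarse.near K (m + 7), D.form K'.toSet e e)) := by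
    intro K hK
    obtain ⟨e₁, he₁, e₂, he₂, hsum, hfar, hin, hb⟩ :=
      h.exists_cut (D.coarse.near_subset hK (m + 2)) heW
    -- For the ideal corrector, e₂ is a test function vanishing on K; for the localized one, the two
    -- supports share no cell, since e₂ vanishes on the patch of order m.
    have hz : D.form univ (ε K) e₂ = 0 := by
      rw [hε]
      simp only [LinearMap.BilinForm.sub_left]
      rw [(h.idealCell_spec K v).2 e₂ he₂, D.form_symm K.toSet, D.form_of_vanishOn hK
        (hin K hK (D.coarse.near_mono hK (by omega))), D.form_eq_zero_of_vanishOn, neg_zero, sub_self]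
      intro K' hK'
      by_cases hn : K' ∈ D.coarse.near K m
      · exact Or.inr (hin K' hK' fun K'' hK'' => D.coarse.mem_near_trans hn hK'')
      · exact Or.inl ((h.cellCorrector_mem hK m v).2 K' hK' hn)
    have h1 : D.form univ (ε K) e = D.form univ (ε K) e₁ := by
      conv_lhs => rw [hsum]
      rw [LinearMap.BilinForm.add_right, hz, add_zero]
    have hy := young_of_nonneg _ (D.form_symm univ) (D.form_self_nonneg _)
      (inv_pos.2 (one_pos.trans_le hP1)) (ε K) e₁
    rw [inv_inv] at hy
    have h2 : D.form univ e₁ e₁ ≤ cutConst d σ CI * (cardBound d σ (m + 5) *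
        ∑ K' ∈ D.coarse.near K (m + 7), D.form K'.toSet e e) := by
      have hnn : ∀ K' : Rect d, 0 ≤ D.form K'.toSet e e := fun K' => D.form_self_nonneg _ _
      have a1 : D.form univ e₁ e₁ = ∑ K' ∈ D.coarse.near K (m + 5), D.form K'.toSet e₁ e₁ := by
        rw [D.form_univ]
        refine (Finset.sum_subset (D.coarse.near_subset hK _) fun K' hK' hn => ?_).symm
        refine D.form_of_vanishOn hK' (hfar K' hK' (Finset.disjoint_left.2 fun K'' b1 b2 => hn ?_)) _
        exact D.coarse.mem_near_add b2 (D.coarse.mem_near_comm hK' b1) (by omega)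
      rw [a1]
      refine (Finset.sum_le_sum fun K' hK' => (hb K' (D.coarse.near_subset hK _ hK')).1).trans ?_
      rw [← Finset.mul_sum]
      refine mul_le_mul_of_nonneg_left ?_ hcut
      refine (D.coarse.sum_near_near_le (K := K) (f := fun K' => D.form K'.toSet e e) hnn
        (m + 5) 2).trans ?_
      exact mul_le_mul_of_nonneg_right (h.card_near_le hK _) (Finset.sum_nonneg fun _ _ => hnn _)
    have h3 := mul_le_mul_of_nonneg_left h2 (inv_nonneg.2 (zero_le_one.trans hP1))
    have := le_abs_self (D.form univ (ε K) e₁)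
    rw [h1]
    linarith
  have htot := Finset.sum_le_sum hcell
  rw [← Finset.mul_sum, Finset.sum_add_distrib, ← Finset.mul_sum, ← Finset.mul_sum,
    ← Finset.mul_sum, ← Finset.mul_sum] at htot
  have e1 : ∑ K ∈ D.coarse.cells, D.form univ (ε K) e = D.form univ e e := by
    rw [← LinearMap.sum_apply, ← map_sum, ← hesum]
  rw [e1] at htot
  have hN := cardBound_nonneg d σ (m + 5)
  have h4 := h.sum_sum_near_le (f := fun K' => D.form K'.toSet e e)
    (fun K' => D.form_self_nonneg _ _) (m + 7)
  rw [← D.form_univ] at h4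
  have he0 := D.form_self_nonneg univ e
  -- P dominates the overlap of the patches of order m + 5 and m + 7, so this term is at most one
  -- copy of the energy of e and is absorbed by the factor 2 on the left.
  have h5 : P⁻¹ * (cutConst d σ CI * (cardBound d σ (m + 5) *
      ∑ K ∈ D.coarse.cells, ∑ K' ∈ D.coarse.near K (m + 7), D.form K'.toSet e e)) ≤
      D.form univ e e := by
    rw [inv_mul_le_iff₀ (one_pos.trans_le hP1)]
    calc _ ≤ cutConst d σ CI * (cardBound d σ (m + 5) *
          (cardBound d σ (m + 7) * D.form univ e e)) := by gcongr
      _ ≤ _ := by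
          rw [hP, overlapConst]; linarith
  have h6 : ∑ K ∈ D.coarse.cells, D.form univ (ε K) (ε K) ≤
      locConst d σ CI * decayRate d σ CI ^ ((m - 7) / 9) * D.form univ v v := by
    rw [D.form_univ v v, Finset.mul_sum]
    exact Finset.sum_le_sum fun K hK => h.form_idealCell_sub_le hK m v
  have h7 := mul_le_mul_of_nonneg_left h6 (zero_le_one.trans hP1)
  rw [locError]
  linarith

end Admissible

end LOD

namespace LOD

variable {d : ℕ} {Ω : Set (E d)} (D : LOD Ω)

/-! ### The elliptic projection error -/

theorem isWeight_aInv : IsWeight D.aInv where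
  measurable := D.isWeight.measurable.inv
  nonneg x := (inv_pos.2 (D.a_pos x)).le
  bdd := ⟨(min D.a₀ 1)⁻¹, fun x => inv_anti₀ (lt_min D.a₀_pos one_pos) (D.le_a x)⟩

theorem invNorm_nonneg (g : L2 Ω) : 0 ≤ D.invNorm g := Real.sqrt_nonneg _

/-- Weighted Cauchy–Schwarz, by writing g as the coefficient times a⁻¹g. It matches the dual norm of
the data with the weighted L² norm in which I_H approximates. -/
theorem abs_inner_le (g w : L2 Ω) : |(inner ℝ g w : ℝ)| ≤ D.invNorm g * wnorm D.a univ w := by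
  obtain ⟨M, hM⟩ := D.isWeight_aInv.bdd
  have hmem : MemLp (fun x => D.aInv x * g x) 2 (volume.restrict Ω) := by
    refine MemLp.of_le_mul (c := M) (Lp.memLp g)
      (D.isWeight_aInv.measurable.aestronglyMeasurable.mul (Lp.aestronglyMeasurable g))
      (Filter.Eventually.of_forall fun x => ?_)
    rw [norm_mul, Real.norm_eq_abs, abs_of_nonneg (D.isWeight_aInv.nonneg x)]
    exact mul_le_mul_of_nonneg_right (hM x) (norm_nonneg _)
  obtain ⟨g', hg'⟩ : ∃ g' : L2 Ω, g' =ᵐ[volume.restrict Ω] fun x => D.aInv x * g x :=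
    ⟨hmem.toLp _, hmem.coeFn_toLp⟩
  have e1 : (inner ℝ g w : ℝ) = wform D.a univ g' w := by
    rw [L2.inner_def, wform, Measure.restrict_univ]
    refine integral_congr_ae ?_
    filter_upwards [hg'] with x hx
    have := (D.a_pos x).ne'
    simp only [hx, aInv, RCLike.inner_apply, conj_trivial]
    field_simp
  have e2 : wform D.a univ g' g' = wform D.aInv univ g g := by
    rw [wform, wform, Measure.restrict_univ]
    refine integral_congr_ae ?_
    filter_upwards [hg'] with x hx
    have := (D.a_pos x).ne'
    simp only [hx, aInv, RCLike.inner_apply, conj_trivial]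
    field_simp
  rw [e1, invNorm, wnorm_eq_sqrt, ← e2, wnorm_eq_sqrt]
  exact abs_le_sqrt_of_nonneg (D.isWeight.bilin univ) (fun x y => wform_symm _ _ _ _)
    (fun x => D.isWeight.wform_self_nonneg _ x) g' w

/-- Continuity serves to make the norms measurable as functions of time, as additivity of the L¹
norms requires. -/
theorem continuous_energyNorm : Continuous D.energyNorm := by
  have : D.energyNorm = fun v => √(D.formL univ v v) := by
    funext v; rw [energyNorm_eq, formL_apply]
  rw [this]
  fun_prop

theorem continuous_invNorm : Continuous D.invNorm := by
  obtain ⟨M, hM⟩ := D.isWeight_aInv.bdd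
  have hb : ∀ g g' : L2 Ω, |wform D.aInv univ g g'| ≤ max M 0 * ‖g‖ * ‖g'‖ := by
    intro g g'
    refine (abs_le_sqrt_of_nonneg (D.isWeight_aInv.bilin univ) (fun x y => wform_symm _ _ _ _)
      (fun x => D.isWeight_aInv.wform_self_nonneg _ x) g g').trans ?_
    rw [IsWeight.bilin_apply, IsWeight.bilin_apply,
      ← Real.sqrt_mul (D.isWeight_aInv.wform_self_nonneg _ g)]
    have h1 : ∀ g : L2 Ω, wform D.aInv univ g g ≤ max M 0 * ‖g‖ ^ 2 := fun g =>
      (D.isWeight_aInv.wform_le (M := max M 0) (fun x => (hM x).trans (le_max_left _ _)) g)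
    refine Real.sqrt_le_iff.2 ⟨by positivity, ?_⟩
    calc _ ≤ (max M 0 * ‖g‖ ^ 2) * (max M 0 * ‖g'‖ ^ 2) :=
          mul_le_mul (h1 g) (h1 g') (D.isWeight_aInv.wform_self_nonneg _ _) (by positivity)
      _ = _ := by ring
  let B := (D.isWeight_aInv.bilin (F := ℝ) (Ω := Ω) univ).mkContinuous₂ (max M 0) hb
  have : D.invNorm = fun g => √(B g g) := by
    funext g; exact wnorm_eq_sqrt _ _ _
  rw [this]
  fun_prop

variable {D}

/-- The global stability constant of the interpolation operator. -/
def interpConst (d : ℕ) (σ CI : ℝ) : ℝ := CI * √(cardBound d σ 1)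

namespace Admissible

variable {σ CI CP : ℝ} (h : D.Admissible σ CI CP)
include h

theorem interpConst_nonneg : 0 ≤ interpConst d σ CI :=
  mul_nonneg (zero_le_one.trans h.one_le_CI) (Real.sqrt_nonneg _)

theorem sum_near_one_le (v : H10 Ω) :
    ∑ K ∈ D.coarse.cells, ∑ K' ∈ D.coarse.near K 1, D.form K'.toSet v v ≤
      cardBound d σ 1 * D.form univ v v := by
  rw [D.form_univ v v]
  exact h.sum_sum_near_le (f := fun K' => D.form K'.toSet v v) (fun _ => D.form_self_nonneg _ _) 1

theorem energyNorm_interp_le (v : H10 Ω) :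
    D.energyNorm (D.interp v : H10 Ω) ≤ interpConst d σ CI * D.energyNorm v := by
  have hN := cardBound_nonneg d σ 1
  refine abs_le_of_sq_le_sq' ?_ (mul_nonneg h.interpConst_nonneg (D.energyNorm_nonneg v)) |>.2
  rw [mul_pow, interpConst, mul_pow, Real.sq_sqrt hN, D.energyNorm_sq, D.energyNorm_sq,
    D.form_univ, mul_assoc]
  refine (Finset.sum_le_sum fun K hK => h.form_interp_le hK v).trans ?_
  rw [← Finset.mul_sum]
  exact mul_le_mul_of_nonneg_left (h.sum_near_one_le v) (sq_nonneg _)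

theorem wnorm_val_le {w : H10 Ω} (hw : w ∈ D.W) :
    wnorm D.a univ (val w) ≤ interpConst d σ CI * D.H * D.energyNorm w := by
  have hN := cardBound_nonneg d σ 1
  have hH := h.H_pos.le
  have hI := h.interpConst_nonneg
  refine abs_le_of_sq_le_sq' ?_ (mul_nonneg (mul_nonneg hI hH) (D.energyNorm_nonneg w)) |>.2
  rw [mul_pow, mul_pow, interpConst, mul_pow, Real.sq_sqrt hN, D.energyNorm_sq,
    D.isWeight.wnorm_sq, D.wform_univ]
  refine (Finset.sum_le_sum fun K hK => h.wform_val_le hK hw).trans ?_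
  rw [← Finset.mul_sum]
  refine (mul_le_mul_of_nonneg_left (h.sum_near_one_le w) (by positivity)).trans_eq ?_
  ring

theorem ritzFine_spec (u : H10 Ω) : D.ritzFine u ∈ D.fine.V ∧
    ∀ w ∈ D.fine.V, D.form univ (D.ritzFine u) w = D.form univ u w := by
  obtain ⟨P, hP⟩ := h.exists_ritz (S := D.fine.V) le_rfl
  have : D.ritzFine u = P u := (hP u).1.symm
  rw [this]
  exact (hP u).2

theorem exists_ritzMs (m : ℕ) : ∃ P : H10 Ω →L[ℝ] H10 Ω, ∀ u, P u = D.ritzMs m u := by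
  obtain ⟨S, hS, hSV⟩ := h.exists_Vms m
  obtain ⟨P, hP⟩ := h.exists_ritz hSV
  exact ⟨P, fun u => (hP u).1.trans (by rw [ritzMs, hS])⟩

theorem ritzMs_spec (m : ℕ) (u : H10 Ω) : D.ritzMs m u ∈ D.Vms m ∧
    ∀ w ∈ D.Vms m, D.form univ (D.ritzMs m u) w = D.form univ u w := by
  obtain ⟨S, hS, hSV⟩ := h.exists_Vms m
  obtain ⟨P, hP⟩ := h.exists_ritz hSV
  have : D.ritzMs m u = P u := by rw [(hP u).1, hS, ritzMs]
  rw [this, ← hS]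
  exact (hP u).2

theorem Vms_subset_fine (m : ℕ) : D.Vms m ⊆ D.fine.V := by
  rintro _ ⟨v, hv, rfl⟩
  exact h.ms_mem_fine m hv

/-- The fine-scale and the multiscale elliptic projections of functions with regular data are close
to each other. -/
theorem energyNorm_ritz_sub_le (m : ℕ) {u : H10 Ω} {g : L2 Ω}
    (hg : ∀ v : H10 Ω, D.form univ u v = inner ℝ g (val v)) :
    D.energyNorm (D.ritzFine u - D.ritzMs m u) ≤ interpConst d σ CI *
      (D.H * D.invNorm g + √(locError d σ CI m) * D.energyNorm u) := by
  obtain ⟨hz, hzs⟩ := h.ritzFine_spec u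
  obtain ⟨hp, hps⟩ := h.ritzMs_spec m u
  have hI := h.interpConst_nonneg
  set z := D.ritzFine u with hzdef
  set vH : H10 Ω := (D.interp z : H10 Ω) with hvH
  have hzu : D.energyNorm z ≤ D.energyNorm u := by
    have h1 := D.abs_form_le_energyNorm u z
    rw [← hzs z hz, ← D.energyNorm_sq, abs_of_nonneg (sq_nonneg _), sq] at h1
    rcases (D.energyNorm_nonneg z).eq_or_lt with h0 | h0
    · rw [← h0]; exact D.energyNorm_nonneg u
    · exact le_of_mul_le_mul_right h1 h0
  -- w₀ is the W_h-component of z in the ideal decomposition. By orthogonality b(w₀, w₀) = b(z, w₀)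
  -- = (g, w₀), and the approximation property on W_h supplies the factor H.
  set w₀ := z - vH - D.ideal vH with hw₀
  have hw₀W : w₀ ∈ D.W := Submodule.sub_mem _ (D.sub_interp_mem hz) (h.ideal_mem vH)
  have hw₀b : D.energyNorm w₀ ≤ interpConst d σ CI * (D.H * D.invNorm g) := by
    have e : D.form univ w₀ w₀ = inner ℝ g (val w₀) := by
      have h1 := h.form_add_ideal vH hw₀W
      have h2 : D.form univ w₀ w₀ = D.form univ z w₀ - D.form univ (vH + D.ideal vH) w₀ := by
        rw [← LinearMap.BilinForm.sub_left, hw₀, sub_sub]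
      rw [h2, h1, sub_zero, hzs w₀ hw₀W.1, hg]
    have h3 := (le_abs_self _).trans (D.abs_inner_le g (val w₀))
    rw [← e, ← D.energyNorm_sq] at h3
    have h4 := mul_le_mul_of_nonneg_left (h.wnorm_val_le hw₀W) (D.invNorm_nonneg g)
    rcases (D.energyNorm_nonneg w₀).eq_or_lt with h0 | h0
    · rw [← h0]
      exact mul_nonneg hI (mul_nonneg h.H_pos.le (D.invNorm_nonneg g))
    · refine le_of_mul_le_mul_right ?_ h0
      rw [← sq]
      linarith
  have hcorr : D.energyNorm (D.ideal vH - D.corrector m vH) ≤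
      interpConst d σ CI * (√(locError d σ CI m) * D.energyNorm u) := by
    have h1 := Real.sqrt_le_sqrt (h.form_ideal_sub_le m vH)
    rw [Real.sqrt_mul (locError_nonneg _ _ _ _), ← D.energyNorm_eq, ← D.energyNorm_eq] at h1
    have h2 := mul_le_mul_of_nonneg_left (h.energyNorm_interp_le z) (Real.sqrt_nonneg (locError d σ CI m))
    have h3 := mul_le_mul_of_nonneg_left hzu
      (mul_nonneg (Real.sqrt_nonneg (locError d σ CI m)) hI)
    linarith
  have hmem : D.ms m vH ∈ D.Vms m := ⟨vH, (D.interp z).2, rfl⟩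
  obtain ⟨S, hS, hSV⟩ := h.exists_Vms m
  -- The competitor is the localized multiscale function built from vH; it misses z by w₀ and by the
  -- localization error.
  have hcea : D.form univ (z - D.ritzMs m u) (z - D.ritzMs m u) ≤
      D.form univ (z - D.ms m vH) (z - D.ms m vH) := by
    refine D.form_sub_le_of_orthogonal ?_
    have hd : D.ritzMs m u - D.ms m vH ∈ D.Vms m := by
      rw [← hS] at hp hmem ⊢
      exact S.sub_mem hp hmem
    rw [LinearMap.BilinForm.sub_left, hps _ hd, hzs _ (h.Vms_subset_fine m hd), sub_self]
  have hcea' := Real.sqrt_le_sqrt hcea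
  rw [← D.energyNorm_eq, ← D.energyNorm_eq] at hcea'
  have e : z - D.ms m vH = w₀ + (D.ideal vH - D.corrector m vH) := by
    rw [hw₀, ms]; abel
  rw [e] at hcea'
  have := D.energyNorm_add_le w₀ (D.ideal vH - D.corrector m vH)
  linarith

end Admissible

/-! ### The exponential rate -/

/-- The squared localization error behaves like m^(2d) times a geometric factor; half of the
geometric decay is spent on the polynomial. -/
theorem exists_rate (d : ℕ) (σ CI : ℝ) : ∃ γ : ℝ, 0 < γ ∧ γ < 1 ∧ ∃ C : ℝ, 0 < C ∧
    ∀ m : ℕ, √(locError d σ CI m) ≤ C * γ ^ m := by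
  -- The maximum with 1/2 keeps τ positive when the decay rate is zero.
  set τ := max (decayRate d σ CI) (1 / 2) with hτ
  have hτ0 : 0 < τ := lt_max_of_lt_right (by norm_num)
  have hτ1 : τ < 1 := max_lt (decayRate_lt_one d σ CI) (by norm_num)
  -- 36 = 4 · 9: a factor τ per nine layers is γ^4 per layer. Of it, γ^2 absorbs the polynomial, and
  -- the square root of the other γ^2 leaves γ.
  set γ := τ ^ ((36 : ℝ)⁻¹) with hγ
  have hγ0 : 0 < γ := Real.rpow_pos_of_pos hτ0 _
  have hγ1 : γ < 1 := Real.rpow_lt_one hτ0.le hτ1 (by norm_num)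
  have hγτ : γ ^ 36 = τ := by
    rw [hγ, ← Real.rpow_natCast, ← Real.rpow_mul hτ0.le]; norm_num
  have hcut := cutConst_nonneg d σ CI
  have hL := one_le_locConst d σ CI
  set c := 2 * kappa d σ with hc
  have hc0 : 0 ≤ c := by rw [hc, kappa]; positivity
  have hbdd : ∃ M : ℝ, ∀ n : ℕ, (n : ℝ) ^ (2 * d) * (γ ^ 2) ^ n ≤ M := by
    have := tendsto_pow_const_mul_const_pow_of_abs_lt_one (2 * d) (r := γ ^ 2)
      (by rw [abs_of_nonneg (by positivity)]; exact pow_lt_one₀ hγ0.le hγ1 two_ne_zero)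
    obtain ⟨M, hM⟩ := this.bddAbove_range
    exact ⟨M, fun n => hM ⟨n, rfl⟩⟩
  obtain ⟨M, hM⟩ := hbdd
  have hM0 : 0 ≤ M := le_trans (by positivity) (hM 0)
  set A := 1 + cutConst d σ CI * c ^ (2 * d) with hA
  have hA1 : 1 ≤ A := le_add_of_nonneg_right (by positivity)
  have hover : ∀ m : ℕ, overlapConst d σ CI m ≤ A * ((m + 8 : ℕ) : ℝ) ^ (2 * d) := by
    intro m
    have h8 : (1:ℝ) ≤ ((m + 8 : ℕ) : ℝ) := by push_cast; linarith [(Nat.cast_nonneg m : (0:ℝ) ≤ m)]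
    have h1 : cardBound d σ (m + 5) ≤ (c * ((m + 8 : ℕ) : ℝ)) ^ d := by
      unfold cardBound
      refine pow_le_pow_left₀ (by positivity) ?_ d
      refine mul_le_mul_of_nonneg_left ?_ hc0
      push_cast; linarith
    have h2 : cardBound d σ (m + 7) ≤ (c * ((m + 8 : ℕ) : ℝ)) ^ d := by
      unfold cardBound
      refine pow_le_pow_left₀ (by positivity) ?_ d
      refine mul_le_mul_of_nonneg_left ?_ hc0
      push_cast; linarith
    have h3 := mul_le_mul h1 h2 (cardBound_nonneg _ _ _) (by positivity)
    have h4 : (1:ℝ) ≤ ((m + 8 : ℕ) : ℝ) ^ (2 * d) := one_le_pow₀ h8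
    have h5 : (c * ((m + 8 : ℕ) : ℝ)) ^ d * (c * ((m + 8 : ℕ) : ℝ)) ^ d =
        c ^ (2 * d) * ((m + 8 : ℕ) : ℝ) ^ (2 * d) := by
      rw [← pow_add, ← two_mul, mul_pow]
    rw [h5] at h3
    have h6 := mul_le_mul_of_nonneg_left h3 hcut
    rw [overlapConst, hA]
    linarith
  -- The 60 pays for the truncated subtraction and the integer division: 36⌊(m - 7)/9⌋ + 60 ≥ 4m.
  have hpow : ∀ m : ℕ, decayRate d σ CI ^ ((m - 7) / 9) ≤ (γ ^ 60)⁻¹ * γ ^ (4 * m) := by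
    intro m
    refine (pow_le_pow_left₀ (decayRate_nonneg d σ CI) (le_max_left _ (1 / 2)) _).trans ?_
    rw [← hτ, ← hγτ, ← pow_mul, le_inv_mul_iff₀ (by positivity), ← pow_add]
    exact pow_le_pow_of_le_one hγ0.le hγ1.le (by omega)
  have hfin : ∀ m : ℕ, locError d σ CI m ≤
      (A * (γ ^ 16)⁻¹ * M * (locConst d σ CI * (γ ^ 60)⁻¹)) * (γ ^ m) ^ 2 := by
    intro m
    -- The bound M is taken at m + 8, and γ^16 is the cost of this shift at the rate γ^2.
    have h1 : ((m + 8 : ℕ) : ℝ) ^ (2 * d) * γ ^ (2 * m) ≤ (γ ^ 16)⁻¹ * M := by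
      rw [le_inv_mul_iff₀ (by positivity)]
      refine le_trans (le_of_eq ?_) (hM (m + 8))
      rw [← pow_mul, mul_add, pow_add]; ring
    have hd0 := decayRate_nonneg d σ CI
    calc locError d σ CI m ≤ (A * ((m + 8 : ℕ) : ℝ) ^ (2 * d)) *
          (locConst d σ CI * ((γ ^ 60)⁻¹ * γ ^ (4 * m))) := by
          unfold locError
          refine mul_le_mul (hover m) ?_ (by positivity) (by positivity)
          exact mul_le_mul_of_nonneg_left (hpow m) (by positivity)
      _ = A * (((m + 8 : ℕ) : ℝ) ^ (2 * d) * γ ^ (2 * m)) *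
          (locConst d σ CI * (γ ^ 60)⁻¹) * (γ ^ m) ^ 2 := by
          rw [show 4 * m = 2 * m + m * 2 by ring, pow_add, pow_mul γ m 2]; ring
      _ ≤ A * ((γ ^ 16)⁻¹ * M) * (locConst d σ CI * (γ ^ 60)⁻¹) * (γ ^ m) ^ 2 := by gcongr
      _ = _ := by ring
  set C := A * (γ ^ 16)⁻¹ * M * (locConst d σ CI * (γ ^ 60)⁻¹) with hC
  have hC0 : 0 ≤ C := by positivity
  refine ⟨γ, hγ0, hγ1, √C + 1, by positivity, fun m => ?_⟩
  calc √(locError d σ CI m) ≤ √(C * (γ ^ m) ^ 2) := Real.sqrt_le_sqrt (hfin m)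
    _ = √C * γ ^ m := by rw [Real.sqrt_mul hC0, Real.sqrt_sq (by positivity)]
    _ ≤ _ := by gcongr; linarith

end LOD

/-! ### Weak time derivatives -/

section Time

instance (T : ℝ) : IsFiniteMeasure (timeMeasure T) := by
  unfold timeMeasure; infer_instance

instance (T : ℝ) : NullSingletonClass (timeMeasure T) := by
  unfold timeMeasure; infer_instance

theorem HasInitialValue.congr {X : Type*} [NormedAddCommGroup X] {T : ℝ} {v v' : ℝ → X} {v₀ : X} (h : HasInitialValue T v v₀)
    (hv : v =ᵐ[timeMeasure T] v') : HasInitialValue T v' v₀ := by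
  obtain ⟨r, h1, h2, h3⟩ := h
  exact ⟨r, h1, h2.trans hv, h3⟩

variable {X Y Z : Type*} [NormedAddCommGroup X] [NormedSpace ℝ X] [NormedAddCommGroup Y]
  [NormedSpace ℝ Y] [NormedAddCommGroup Z] [NormedSpace ℝ Z] {T : ℝ}

theorem ae_mem_timeMeasure (T : ℝ) : ∀ᵐ t ∂(timeMeasure T), t ∈ Ioo 0 T :=
  ae_restrict_mem measurableSet_Ioo

theorem timeMeasure_restrict_Iio {t : ℝ} (ht : t ≤ T) :
    (timeMeasure T).restrict (Iio t) = timeMeasure t := by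
  rw [timeMeasure, timeMeasure, Measure.restrict_restrict measurableSet_Iio]
  congr 1
  ext s
  simp only [mem_inter_iff, mem_Iio, mem_Ioo]
  constructor
  · rintro ⟨h1, h2, -⟩; exact ⟨h2, h1⟩
  · rintro ⟨h1, h2⟩; exact ⟨h2, h1, h2.trans_le ht⟩

theorem timeMeasure_mono {t : ℝ} (ht : t ≤ T) : timeMeasure t ≤ timeMeasure T := by
  rw [← timeMeasure_restrict_Iio ht]; exact Measure.restrict_le_self

theorem integrable_smul_of_compactSupport {μ : Measure ℝ} {φ : ℝ → ℝ} (hφ : Continuous φ)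
    (hc : HasCompactSupport φ) {v : ℝ → X} (hv : Integrable v μ) :
    Integrable (fun t => φ t • v t) μ := by
  obtain ⟨C, hC⟩ := hφ.bounded_above_of_compact_support hc
  exact hv.bdd_smul C hφ.aestronglyMeasurable (Filter.Eventually.of_forall hC)

theorem ae_eq_zero_of_test [CompleteSpace X] {v : ℝ → X} (hv : Integrable v (timeMeasure T))
    (h : ∀ φ : ℝ → ℝ, ContDiff ℝ ∞ φ → HasCompactSupport φ → tsupport φ ⊆ Ioo 0 T →
      ∫ t, φ t • v t ∂(timeMeasure T) = 0) : v =ᵐ[timeMeasure T] 0 := by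
  have h1 := isOpen_Ioo.ae_eq_zero_of_integral_contDiff_smul_eq_zero (U := Ioo 0 T) (μ := volume)
    (f := v) (IntegrableOn.locallyIntegrableOn hv) fun φ h1 h2 h3 => by
      rw [← h φ h1 h2 h3]
      refine (setIntegral_eq_integral_of_forall_compl_eq_zero fun t ht => ?_).symm
      rw [image_eq_zero_of_notMem_tsupport fun hc => ht (h3 hc), zero_smul]
  exact (ae_restrict_iff' measurableSet_Ioo).2 h1

namespace IsWeakTimeDeriv

variable {v v' w w' : ℝ → X}

theorem clm [CompleteSpace X] [CompleteSpace Y] (h : IsWeakTimeDeriv T v w) (L : X →L[ℝ] Y) :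
    IsWeakTimeDeriv T (fun t => L (v t)) (fun t => L (w t)) := by
  refine ⟨L.integrable_comp h.1, L.integrable_comp h.2.1, fun φ h1 h2 h3 => ?_⟩
  have e := congrArg L (h.2.2 φ h1 h2 h3)
  rw [map_neg, ← L.integral_comp_comm (integrable_smul_of_compactSupport
      (h1.continuous_deriv (by simp)) h2.deriv h.1),
    ← L.integral_comp_comm (integrable_smul_of_compactSupport h1.continuous h2 h.2.1)] at e
  simpa only [map_smul] using e

theorem sub (h : IsWeakTimeDeriv T v w) (h' : IsWeakTimeDeriv T v' w') :
    IsWeakTimeDeriv T (fun t => v t - v' t) (fun t => w t - w' t) := by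
  refine ⟨h.1.sub h'.1, h.2.1.sub h'.2.1, fun φ h1 h2 h3 => ?_⟩
  have c1 : Continuous (deriv φ) := h1.continuous_deriv (by simp)
  simp only [smul_sub]
  rw [integral_sub (integrable_smul_of_compactSupport c1 h2.deriv h.1)
      (integrable_smul_of_compactSupport c1 h2.deriv h'.1),
    integral_sub (integrable_smul_of_compactSupport h1.continuous h2 h.2.1)
      (integrable_smul_of_compactSupport h1.continuous h2 h'.2.1),
    h.2.2 φ h1 h2 h3, h'.2.2 φ h1 h2 h3]
  abel

theorem congr (h : IsWeakTimeDeriv T v w) (hv : v =ᵐ[timeMeasure T] v')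
    (hw : w =ᵐ[timeMeasure T] w') : IsWeakTimeDeriv T v' w' := by
  refine ⟨h.1.congr hv, h.2.1.congr hw, fun φ h1 h2 h3 => ?_⟩
  have e1 : ∫ t, deriv φ t • v t ∂(timeMeasure T) = ∫ t, deriv φ t • v' t ∂(timeMeasure T) :=
    integral_congr_ae (by filter_upwards [hv] with t ht; rw [ht])
  have e2 : ∫ t, φ t • w t ∂(timeMeasure T) = ∫ t, φ t • w' t ∂(timeMeasure T) :=
    integral_congr_ae (by filter_upwards [hw] with t ht; rw [ht])
  rw [← e1, ← e2]
  exact h.2.2 φ h1 h2 h3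

theorem unique [CompleteSpace X] (h : IsWeakTimeDeriv T v w) (h' : IsWeakTimeDeriv T v w') :
    w =ᵐ[timeMeasure T] w' := by
  have h0 := h.sub h'
  have := ae_eq_zero_of_test h0.2.1 fun φ h1 h2 h3 => by
    have := h0.2.2 φ h1 h2 h3
    simp only [sub_self, smul_zero, integral_zero] at this
    exact neg_eq_zero.1 this.symm
  filter_upwards [this] with t ht
  exact sub_eq_zero.1 ht

/-- Weak derivatives can be lifted along injective continuous linear maps. -/
theorem of_injective [CompleteSpace X] [CompleteSpace Y] {L : X →L[ℝ] Y}
    (hL : Function.Injective L) (hv : Integrable v (timeMeasure T))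
    (hw : Integrable w (timeMeasure T))
    (h : IsWeakTimeDeriv T (fun t => L (v t)) (fun t => L (w t))) : IsWeakTimeDeriv T v w := by
  refine ⟨hv, hw, fun φ h1 h2 h3 => hL ?_⟩
  rw [map_neg, ← L.integral_comp_comm (integrable_smul_of_compactSupport
      (h1.continuous_deriv (by simp)) h2.deriv hv),
    ← L.integral_comp_comm (integrable_smul_of_compactSupport h1.continuous h2 hw)]
  simpa only [map_smul] using h.2.2 φ h1 h2 h3

end IsWeakTimeDeriv

/-- The primitive of `w` that vanishes at `0`. -/
def primitive (w : ℝ → X) (t : ℝ) : X := ∫ s, w s ∂(timeMeasure t)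

theorem primitive_zero (w : ℝ → X) : primitive w 0 = 0 := by
  simp [primitive, timeMeasure]

theorem continuousOn_primitive {w : ℝ → X} (hw : Integrable w (timeMeasure T)) :
    ContinuousOn (primitive w) (Icc 0 T) := by
  have h : IntegrableOn w (Icc 0 T) volume := by
    rw [integrableOn_Icc_iff_integrableOn_Ioo]; exact hw
  refine (intervalIntegral.continuousOn_primitive h).congr fun t _ => ?_
  beta_reduce
  rw [integral_Ioc_eq_integral_Ioo]; rfl

theorem primitive_clm [CompleteSpace X] [CompleteSpace Y] (L : X →L[ℝ] Y) {w : ℝ → X}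
    (hw : Integrable w (timeMeasure T)) {t : ℝ} (ht : t ≤ T) :
    L (primitive w t) = primitive (fun s => L (w s)) t :=
  (L.integral_comp_comm (hw.mono_measure (timeMeasure_mono ht))).symm

/-- Exchanging the order of integration over a triangle. -/
theorem integral_bilin_Iio [CompleteSpace X] [CompleteSpace Y] [CompleteSpace Z]
    (μ : Measure ℝ) [SFinite μ] (A : X →L[ℝ] Y →L[ℝ] Z) {f : ℝ → X} {g : ℝ → Y} (hf : Integrable f μ)
    (hg : Integrable g μ) :
    ∫ s, A (f s) (∫ r in Iio s, g r ∂μ) ∂μ = ∫ r, A (∫ s in Ioi r, f s ∂μ) (g r) ∂μ := by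
  classical
  set G : ℝ → ℝ → Z := fun s r => {p : ℝ × ℝ | p.2 < p.1}.indicator
    (fun p => A (f p.1) (g p.2)) (s, r) with hG
  have hint : Integrable (Function.uncurry G) (μ.prod μ) := by
    have : Integrable (fun p : ℝ × ℝ => A (f p.1) (g p.2)) (μ.prod μ) :=
      Integrable.op_fst_snd (op := fun x y => A x y) A.continuous₂ ⟨‖A‖, A.le_opNorm₂⟩ hf hg
    exact this.indicator (measurableSet_lt measurable_snd measurable_fst)
  have e1 : ∀ s, A (f s) (∫ r in Iio s, g r ∂μ) = ∫ r, G s r ∂μ := by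
    intro s
    rw [← integral_indicator measurableSet_Iio, ← (A (f s)).integral_comp_comm
      (hg.indicator measurableSet_Iio)]
    refine integral_congr_ae (Filter.Eventually.of_forall fun r => ?_)
    simp only [hG, indicator_apply, mem_Iio, mem_ofPred_eq]
    split_ifs <;> simp
  have e2 : ∀ r, A (∫ s in Ioi r, f s ∂μ) (g r) = ∫ s, G s r ∂μ := by
    intro r
    rw [← integral_indicator measurableSet_Ioi, ← ContinuousLinearMap.flip_apply,
      ← (A.flip (g r)).integral_comp_comm (hf.indicator measurableSet_Ioi)]
    refine integral_congr_ae (Filter.Eventually.of_forall fun s => ?_)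
    simp only [hG, indicator_apply, mem_Ioi, mem_ofPred_eq]
    split_ifs <;> simp
  simp only [e1, e2]
  exact integral_integral_swap hint

theorem integral_primitive [CompleteSpace X] {w : ℝ → X} (hw : Integrable w (timeMeasure T))
    {r : ℝ} (hr : r ∈ Ioo 0 T) :
    ∫ s in Ioi r, w s ∂(timeMeasure T) = primitive w T - primitive w r := by
  have h1 := integral_add_compl (μ := timeMeasure T) (measurableSet_Iic (a := r)) hw
  rw [compl_Iic, integral_Iic_eq_integral_Iio, timeMeasure_restrict_Iio hr.2.le] at h1
  exact eq_sub_of_add_eq' h1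

/-- Exchanging the order of integration over the triangle r < t moves the derivative: the inner
integral of φ' from r to T is -φ(r), because φ(T) = 0. -/
theorem isWeakTimeDeriv_primitive [CompleteSpace X] {w : ℝ → X}
    (hw : Integrable w (timeMeasure T)) : IsWeakTimeDeriv T (primitive w) w := by
  have hint : Integrable (primitive w) (timeMeasure T) := by
    have := (continuousOn_primitive hw).integrableOn_compact isCompact_Icc (μ := volume)
    exact this.mono_set Ioo_subset_Icc_self
  refine ⟨hint, hw, fun φ h1 h2 h3 => ?_⟩
  have c1 : Continuous (deriv φ) := h1.continuous_deriv (by simp)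
  have hd : Integrable (deriv φ) (timeMeasure T) :=
    (c1.integrable_of_hasCompactSupport h2.deriv).restrict
  have key := integral_bilin_Iio (timeMeasure T) (ContinuousLinearMap.lsmul ℝ ℝ : ℝ →L[ℝ] X →L[ℝ] X)
    hd hw
  simp only [ContinuousLinearMap.lsmul_apply] at key
  have hφ : ∀ t ∈ Icc 0 T, primitive (deriv φ) t = φ t - φ 0 := by
    intro t ht
    rw [← intervalIntegral.integral_deriv_eq_sub (fun s _ => h1.differentiable (by simp) s)
      (c1.intervalIntegrable _ _), intervalIntegral.integral_of_le ht.1,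
      integral_Ioc_eq_integral_Ioo]
    rfl
  have h0T : ∀ t, t ∉ Ioo 0 T → φ t = 0 := fun t ht =>
    image_eq_zero_of_notMem_tsupport fun hc => ht (h3 hc)
  calc ∫ t, deriv φ t • primitive w t ∂(timeMeasure T)
      = ∫ t, deriv φ t • ∫ r in Iio t, w r ∂(timeMeasure T) ∂(timeMeasure T) := by
        refine integral_congr_ae ?_
        filter_upwards [ae_mem_timeMeasure T] with t ht
        rw [timeMeasure_restrict_Iio ht.2.le]; rfl
    _ = _ := key
    _ = ∫ t, -(φ t • w t) ∂(timeMeasure T) := by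
        refine integral_congr_ae ?_
        filter_upwards [ae_mem_timeMeasure T] with t ht
        have hT : 0 ≤ T := ht.1.le.trans ht.2.le
        rw [integral_primitive hd ht, hφ T ⟨hT, le_rfl⟩, hφ t ⟨ht.1.le, ht.2.le⟩,
          h0T T (by simp), ← neg_smul]
        congr 1; ring
    _ = _ := integral_neg _

/-- The lemma of du Bois-Reymond. -/
theorem exists_ae_eq_const [CompleteSpace X] (hT : 0 < T) {z : ℝ → X}
    (h : IsWeakTimeDeriv T z fun _ => 0) : ∃ c : X, ∀ᵐ t ∂(timeMeasure T), z t = c := by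
  let ψ : ContDiffBump (T / 2) := ⟨T / 8, T / 4, by positivity, by linarith⟩
  set ψ₀ : ℝ → ℝ := ψ.normed volume with hψ₀
  have ψ1 : ContDiff ℝ ∞ ψ₀ := ψ.contDiff_normed
  have ψ2 : HasCompactSupport ψ₀ := ψ.hasCompactSupport_normed
  have ψ3 : tsupport ψ₀ ⊆ Ioo 0 T := by
    rw [hψ₀, ψ.tsupport_normed_eq, Real.closedBall_eq_Icc]
    change Icc (T / 2 - T / 4) (T / 2 + T / 4) ⊆ _
    intro s hs
    constructor <;> linarith [hs.1, hs.2]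
  have ψ4 : ∫ t, ψ₀ t = 1 := ψ.integral_normed
  set c := ∫ t, ψ₀ t • z t ∂(timeMeasure T) with hc
  refine ⟨c, ?_⟩
  have hint : Integrable (fun t => z t - c) (timeMeasure T) := h.1.sub (integrable_const c)
  have key := ae_eq_zero_of_test hint fun φ φ1 φ2 φ3 => by
    set α := ∫ t, φ t with hα
    -- Subtracting a multiple of a fixed bump of unit mass leaves mean zero, so the primitive of η
    -- is again a test function with support in (0, T).
    set η : ℝ → ℝ := fun t => φ t - α * ψ₀ t with hη
    have η1 : ContDiff ℝ ∞ η := φ1.sub (contDiff_const.mul ψ1)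
    have iφ : Integrable φ := φ1.continuous.integrable_of_hasCompactSupport φ2
    have iψ : Integrable ψ₀ := ψ1.continuous.integrable_of_hasCompactSupport ψ2
    have η4 : ∫ t, η t = 0 := by
      rw [integral_sub iφ (iψ.const_mul α), integral_const_mul, ψ4, mul_one, sub_self]
    have iη : Integrable η := iφ.sub (iψ.const_mul α)
    set K := tsupport φ ∪ tsupport ψ₀ with hK
    have hKc : IsCompact K := φ2.isCompact.union ψ2.isCompact
    have hKne : K.Nonempty := by
      by_contra hne
      have : tsupport ψ₀ = ∅ := by
        rw [not_nonempty_iff_eq_empty] at hne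
        exact (union_empty_iff.1 hne).2
      rw [tsupport_eq_empty_iff] at this
      rw [this] at ψ4
      simp at ψ4
    obtain ⟨a, haK, ha⟩ := hKc.exists_isLeast hKne
    obtain ⟨b, hbK, hb⟩ := hKc.exists_isGreatest hKne
    have hKT : K ⊆ Ioo 0 T := union_subset φ3 ψ3
    have η0 : ∀ t, t ∉ Icc a b → η t = 0 := by
      intro t ht
      have htK : t ∉ K := fun hc => ht ⟨ha hc, hb hc⟩
      rw [hη]
      simp only
      rw [image_eq_zero_of_notMem_tsupport fun hc => htK (Or.inl hc),
        image_eq_zero_of_notMem_tsupport fun hc => htK (Or.inr hc), mul_zero, sub_zero]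
    set χ : ℝ → ℝ := fun t => ∫ s in Iic t, η s with hχ
    have χ' : ∀ t, HasDerivAt χ (η t) t := by
      intro t
      have e : χ = fun t => (∫ s in Iic 0, η s) + ∫ s in (0:ℝ)..t, η s := by
        funext t
        rw [← intervalIntegral.integral_Iic_sub_Iic iη.integrableOn iη.integrableOn]; ring
      rw [e]
      exact (intervalIntegral.integral_hasDerivAt_right (η1.continuous.intervalIntegrable _ _)
        (η1.continuous.stronglyMeasurableAtFilter _ _) η1.continuous.continuousAt).const_add _
    have χd : deriv χ = η := funext fun t => (χ' t).deriv
    have χ1 : ContDiff ℝ ∞ χ := by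
      rw [contDiff_infty_iff_deriv, χd]
      exact ⟨fun t => (χ' t).differentiableAt, η1⟩
    have χ0 : ∀ t, t ∉ Icc a b → χ t = 0 := by
      intro t ht
      rcases lt_or_ge t a with hta | hta
      · rw [hχ]
        refine setIntegral_eq_zero_of_forall_eq_zero fun s hs => η0 s fun hc => ?_
        exact absurd (hc.1.trans hs) (not_le.2 hta)
      · rw [← η4]
        refine setIntegral_eq_integral_of_forall_compl_eq_zero fun s hs => η0 s fun hc => ht ⟨hta, ?_⟩
        exact (not_le.1 hs).le.trans hc.2
    have χs : tsupport χ ⊆ Icc a b :=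
      closure_minimal (fun t ht => by by_contra hc; exact ht (χ0 t hc)) isClosed_Icc
    have χ2 : HasCompactSupport χ := HasCompactSupport.intro isCompact_Icc χ0
    have χ3 : tsupport χ ⊆ Ioo 0 T := χs.trans fun t ht =>
      ⟨(hKT haK).1.trans_le ht.1, ht.2.trans_lt (hKT hbK).2⟩
    have hz := h.2.2 χ χ1 χ2 χ3
    simp only [smul_zero, integral_zero, neg_zero, χd] at hz
    have I1 := integrable_smul_of_compactSupport φ1.continuous φ2 h.1
    have I2 := integrable_smul_of_compactSupport ψ1.continuous ψ2 h.1
    have e1 : ∫ t, φ t • z t ∂(timeMeasure T) = α • c := by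
      have : ∀ t, η t • z t = φ t • z t - α • (ψ₀ t • z t) := fun t => by
        rw [hη]; simp only; rw [sub_smul, mul_smul]
      simp only [this] at hz
      have I3 : Integrable (fun t => α • (ψ₀ t • z t)) (timeMeasure T) := I2.smul α
      rw [integral_sub I1 I3, integral_smul] at hz
      exact sub_eq_zero.1 hz
    have e2 : ∫ t, φ t • c ∂(timeMeasure T) = α • c := by
      rw [integral_smul_const]
      congr 1
      refine setIntegral_eq_integral_of_forall_compl_eq_zero fun t ht => ?_
      exact image_eq_zero_of_notMem_tsupport fun hc => ht (φ3 hc)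
    simp only [smul_sub]
    rw [integral_sub I1 (integrable_smul_of_compactSupport φ1.continuous φ2 (integrable_const c)), e1,
      e2, sub_self]
  filter_upwards [key] with t ht
  exact sub_eq_zero.1 ht

/-- A function with a weak derivative is, up to a constant, the primitive of its derivative. -/
theorem IsWeakTimeDeriv.exists_eq_primitive [CompleteSpace X] (hT : 0 < T) {v w : ℝ → X}
    (h : IsWeakTimeDeriv T v w) : ∃ c : X, ∀ᵐ t ∂(timeMeasure T), v t = c + primitive w t := by
  have h0 := h.sub (isWeakTimeDeriv_primitive h.2.1)
  simp only [sub_self] at h0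
  obtain ⟨c, hc⟩ := exists_ae_eq_const hT h0
  refine ⟨c, ?_⟩
  filter_upwards [hc] with t ht
  exact sub_eq_iff_eq_add.1 ht

/-- A function with a weak derivative and with initial value `v₀`, possibly in the sense of a
larger space, is `v₀` plus the primitive of its derivative. -/
theorem IsWeakTimeDeriv.eq_add_primitive [CompleteSpace X] [CompleteSpace Y] (hT : 0 < T)
    {v w : ℝ → X} {v₀ : X} (h : IsWeakTimeDeriv T v w) {L : X →L[ℝ] Y}
    (hL : Function.Injective L) (h0 : HasInitialValue T (fun t => L (v t)) (L v₀)) :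
    ∀ᵐ t ∂(timeMeasure T), v t = v₀ + primitive w t := by
  obtain ⟨c, hc⟩ := h.exists_eq_primitive hT
  obtain ⟨r, h1, h2, h3⟩ := h0
  -- The primitive and the representative from the initial condition are continuous and agree almost
  -- everywhere, hence also at 0; injectivity of L then identifies the constant.
  have hcont : ContinuousOn (fun t => L (c + primitive w t)) (Icc 0 T) :=
    L.continuous.comp_continuousOn (continuousOn_const.add (continuousOn_primitive h.2.1))
  have hae : r =ᵐ[volume.restrict (Icc 0 T)] fun t => L (c + primitive w t) := by
    rw [← restrict_Ioo_eq_restrict_Icc]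
    filter_upwards [h2, hc] with t a1 a2
    rw [a1, a2]
  have he := Measure.eqOn_Icc_of_ae_eq volume hT.ne hae h1 hcont (left_mem_Icc.2 hT.le)
  simp only [primitive_zero, add_zero] at he
  rw [h3] at he
  filter_upwards [hc] with t ht
  rw [ht, hL he]

theorem integrable_bilin_primitive [CompleteSpace X] (A : X →L[ℝ] X →L[ℝ] Z) {f : ℝ → X}
    (hf : Integrable f (timeMeasure T)) :
    Integrable (fun s => A (primitive f s) (f s)) (timeMeasure T) := by
  obtain ⟨M, hM⟩ : ∃ M, ∀ s ∈ Icc 0 T, ‖primitive f s‖ ≤ M :=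
    (isCompact_Icc.exists_bound_of_continuousOn (continuousOn_primitive hf))
  have hmeas : AEStronglyMeasurable (primitive f) (timeMeasure T) :=
    (isWeakTimeDeriv_primitive hf).1.aestronglyMeasurable
  refine (hf.norm.const_mul (‖A‖ * M)).mono' (A.continuous₂.comp_aestronglyMeasurable₂ hmeas
    hf.aestronglyMeasurable) ?_
  filter_upwards [ae_mem_timeMeasure T] with s hs
  refine (A.le_opNorm₂ _ _).trans ?_
  gcongr
  exact hM s ⟨hs.1.le, hs.2.le⟩

theorem primitive_sub {v w : ℝ → X} (hv : Integrable v (timeMeasure T))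
    (hw : Integrable w (timeMeasure T)) {t : ℝ} (ht : t ≤ T) :
    primitive (fun s => v s - w s) t = primitive v t - primitive w t :=
  integral_sub (hv.mono_measure (timeMeasure_mono ht)) (hw.mono_measure (timeMeasure_mono ht))

/-- The product rule for a quadratic form of a primitive. -/
theorem bilin_primitive [CompleteSpace X] [CompleteSpace Z] (A : X →L[ℝ] X →L[ℝ] Z) {f : ℝ → X}
    (hf : Integrable f (timeMeasure T)) :
    A (primitive f T) (primitive f T) =
      (∫ s, A (f s) (primitive f s) ∂(timeMeasure T)) +
        ∫ s, A (primitive f s) (f s) ∂(timeMeasure T) := by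
  -- The square of the total integral splits into the two triangles s < r and r < s; exchanging
  -- integrals identifies one of them.
  have key := integral_bilin_Iio (timeMeasure T) A hf hf
  have e1 : ∫ s, A (f s) (∫ r in Iio s, f r ∂(timeMeasure T)) ∂(timeMeasure T) =
      ∫ s, A (f s) (primitive f s) ∂(timeMeasure T) := by
    refine integral_congr_ae ?_
    filter_upwards [ae_mem_timeMeasure T] with s hs
    rw [timeMeasure_restrict_Iio hs.2.le]; rfl
  have hint := integrable_bilin_primitive A hf
  have e2 : ∫ r, A (∫ s in Ioi r, f s ∂(timeMeasure T)) (f r) ∂(timeMeasure T) =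
      A (primitive f T) (primitive f T) - ∫ s, A (primitive f s) (f s) ∂(timeMeasure T) := by
    have : ∫ s, A (primitive f T) (f s) ∂(timeMeasure T) = A (primitive f T) (primitive f T) :=
      (A (primitive f T)).integral_comp_comm hf
    rw [← this, ← integral_sub ((A (primitive f T)).integrable_comp hf) hint]
    refine integral_congr_ae ?_
    filter_upwards [ae_mem_timeMeasure T] with r hr
    rw [integral_primitive hf hr, map_sub, sub_apply]
  rw [← e1, key, e2, sub_add_cancel]

end Time

/-! ### Energy estimates for the semi-discrete problem -/

section

variable {d : ℕ} {Ω : Set (E d)}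

/-- The embedding `L²(Ω) → H⁻¹(Ω)` as a continuous linear map. -/
def toHneg1L : L2 Ω →L[ℝ] Hneg1 Ω :=
  LinearMap.mkContinuous
    { toFun := toHneg1
      map_add' := fun g g' => by
        ext v; simp [toHneg1]
      map_smul' := fun c g => by
        ext v; simp [toHneg1] } ‖(val : H10 Ω →L[ℝ] L2 Ω)‖ fun g => by
    refine ContinuousLinearMap.opNorm_le_bound _ (by positivity) fun v => ?_
    change ‖(inner ℝ g (val v) : ℝ)‖ ≤ _
    refine (norm_inner_le_norm g (val v)).trans ?_
    have := (val : H10 Ω →L[ℝ] L2 Ω).le_opNorm v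
    calc _ ≤ ‖g‖ * (‖(val : H10 Ω →L[ℝ] L2 Ω)‖ * ‖v‖) := by gcongr
      _ = _ := by ring

theorem toHneg1L_apply (g : L2 Ω) (v : H10 Ω) : toHneg1L g v = inner ℝ g (val v) := rfl

theorem toHneg1L_injective (hΩ : IsOpen Ω) : Function.Injective (toHneg1L : L2 Ω →L[ℝ] Hneg1 Ω) :=
  toHneg1_injective hΩ

end

namespace LOD

variable {d : ℕ} {Ω : Set (E d)} (D : LOD Ω) {T : ℝ}

/-- For a fixed test function the error equation may be integrated in time; this is the step by
which the L² estimate loses one time derivative. -/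
theorem inner_add_form_primitive {G : ℝ → L2 Ω} {p : ℝ → H10 Ω} {w : H10 Ω} {t : ℝ}
    (hG : Integrable G (timeMeasure T)) (hp : Integrable p (timeMeasure T)) (ht : t ≤ T)
    (hz : ∀ᵐ s ∂(timeMeasure T), inner ℝ (G s) (val w) + D.form univ (p s) w = 0) :
    inner ℝ (primitive G t) (val w) + D.form univ (primitive p t) w = 0 := by
  obtain ⟨A, hA⟩ : ∃ A : L2 Ω →L[ℝ] ℝ, ∀ g, A g = inner ℝ g (val w) :=
    ⟨innerSL ℝ (val w), fun g => real_inner_comm g (val w)⟩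
  obtain ⟨B, hB⟩ : ∃ B : H10 Ω →L[ℝ] ℝ, ∀ v, B v = D.form univ v w :=
    ⟨(D.formL univ).flip w, fun v => rfl⟩
  have I1 := (A.integrable_comp hG).mono_measure (timeMeasure_mono ht)
  have I2 := (B.integrable_comp hp).mono_measure (timeMeasure_mono ht)
  rw [← hA, ← hB, primitive_clm A hG ht, primitive_clm B hp ht]
  unfold primitive
  rw [← integral_add I1 I2]
  refine integral_eq_zero_of_ae ?_
  filter_upwards [(Measure.absolutelyContinuous_of_le (timeMeasure_mono ht)).ae_le hz] with s hs
  rw [hA, hB]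
  exact hs

/-- Energy estimate for a second order evolution equation with zero initial data, where
`p` is the velocity and `q` the acceleration. -/
theorem energy_estimate (hT : 0 < T) {p q : ℝ → H10 Ω} {g : ℝ → L2 Ω}
    (hp : Integrable p (timeMeasure T)) (hq : Integrable q (timeMeasure T))
    (hg : Integrable g (timeMeasure T)) (hpq : ∀ᵐ t ∂(timeMeasure T), p t = primitive q t)
    (heq : ∀ᵐ t ∂(timeMeasure T), inner ℝ (val (q t)) (val (p t)) +
      D.form univ (primitive p t) (p t) = inner ℝ (g t) (val (p t))) :
    ∀ᵐ t ∂(timeMeasure T), ‖val (p t)‖ ≤ 2 * ∫ s, ‖g s‖ ∂(timeMeasure T) ∧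
      D.energyNorm (primitive p t) ≤ 2 * ∫ s, ‖g s‖ ∂(timeMeasure T) := by
  obtain ⟨N, hN⟩ : ∃ N, N = ∫ s, ‖g s‖ ∂(timeMeasure T) := ⟨_, rfl⟩
  rw [← hN]
  have hN0 : 0 ≤ N := hN ▸ integral_nonneg fun _ => norm_nonneg _
  have hcont : ContinuousOn (fun t => ‖val (primitive q t)‖) (Icc 0 T) :=
    (val.continuous.comp_continuousOn (continuousOn_primitive hq)).norm
  -- The estimate is closed at the time where the velocity is largest instead of by Gronwall's
  -- inequality, so no exponential in T appears.
  obtain ⟨t₀, ht₀, hmax⟩ := isCompact_Icc.exists_isMaxOn (nonempty_Icc.2 hT.le) hcont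
  obtain ⟨S, hS⟩ : ∃ S, S = ‖val (primitive q t₀)‖ := ⟨_, rfl⟩
  have hS0 : 0 ≤ S := hS ▸ norm_nonneg _
  obtain ⟨mass, hmass⟩ : ∃ mass : H10 Ω →L[ℝ] H10 Ω →L[ℝ] ℝ,
      ∀ v w, mass v w = inner ℝ (val v) (val w) := ⟨toHneg1L.comp val, fun _ _ => rfl⟩
  have hmax' : ∀ t ∈ Icc 0 T, ‖val (primitive q t)‖ ≤ S := fun t ht => hS ▸ hmax ht
  have key : ∀ t ∈ Icc 0 T, ‖val (primitive q t)‖ ^ 2 +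
      D.form univ (primitive p t) (primitive p t) ≤ 2 * N * S := by
    intro t ht
    have hle := timeMeasure_mono ht.2
    have hac := Measure.absolutelyContinuous_of_le hle
    have hp' := hp.mono_measure hle
    have hq' := hq.mono_measure hle
    have hg' := hg.mono_measure hle
    have b1 := bilin_primitive mass hq'
    have b2 := bilin_primitive (D.formL univ) hp'
    have s1 : ∀ v w, mass v w = mass w v := fun v w => by
      rw [hmass, hmass, real_inner_comm]
    have s2 : ∀ v w, D.formL univ v w = D.formL univ w v := fun v w => D.form_symm _ _ _
    simp only [s1 (q _) (primitive q _)] at b1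
    simp only [s2 (p _) (primitive p _)] at b2
    have i1 := integrable_bilin_primitive mass hq'
    have i2 := integrable_bilin_primitive (D.formL univ) hp'
    -- The energy at time t is twice the integrated power, because both initial data vanish; the
    -- equation then replaces the power by the source tested with p.
    have e : ‖val (primitive q t)‖ ^ 2 + D.form univ (primitive p t) (primitive p t) =
        2 * ∫ s, (mass (primitive q s) (q s) + D.formL univ (primitive p s) (p s))
          ∂(timeMeasure t) := by
      rw [integral_add i1 i2, ← real_inner_self_eq_norm_sq, ← hmass, b1, ← formL_apply, b2]
      ring
    rw [e, mul_assoc]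
    refine mul_le_mul_of_nonneg_left ?_ zero_le_two
    calc ∫ s, (mass (primitive q s) (q s) + D.formL univ (primitive p s) (p s)) ∂(timeMeasure t)
        ≤ ∫ s, ‖g s‖ * S ∂(timeMeasure t) := by
          refine integral_mono_ae (i1.add i2) (hg'.norm.mul_const S) ?_
          filter_upwards [hac.ae_le hpq, hac.ae_le heq, ae_mem_timeMeasure t] with s h1 h2 h3
          have h4 : ‖val (p s)‖ ≤ S := by
            rw [h1]; exact hmax' s ⟨h3.1.le, h3.2.le.trans ht.2⟩
          have h5 : mass (primitive q s) (q s) = inner ℝ (val (q s)) (val (p s)) := by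
            rw [s1, hmass, h1]
          have h6 : mass (primitive q s) (q s) + D.formL univ (primitive p s) (p s) =
              inner ℝ (g s) (val (p s)) := by rw [h5, formL_apply]; exact h2
          change mass (primitive q s) (q s) + D.formL univ (primitive p s) (p s) ≤ _
          rw [h6]
          exact (real_inner_le_norm _ _).trans (mul_le_mul_of_nonneg_left h4 (norm_nonneg _))
      _ = (∫ s, ‖g s‖ ∂(timeMeasure t)) * S := integral_mul_const _ _
      _ ≤ N * S := by
          refine mul_le_mul_of_nonneg_right ?_ hS0
          rw [hN]
          exact integral_mono_measure hle (Filter.Eventually.of_forall fun _ => norm_nonneg _) hg.norm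
  -- At the maximum, S² ≤ 2NS, and one factor S cancels.
  have hSN : S ≤ 2 * N := by
    have h1 := key t₀ ht₀
    rw [← hS] at h1
    have h2 := D.form_self_nonneg univ (primitive p t₀)
    rcases hS0.eq_or_lt with h0 | h0
    · linarith
    · refine le_of_mul_le_mul_right ?_ h0
      rw [← sq]
      linarith
  filter_upwards [hpq, ae_mem_timeMeasure T] with t h1 h2
  have ht : t ∈ Icc 0 T := ⟨h2.1.le, h2.2.le⟩
  refine ⟨?_, ?_⟩
  · rw [h1]; exact (hmax' t ht).trans hSN
  · refine abs_le_of_sq_le_sq' ?_ (by positivity) |>.2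
    rw [D.energyNorm_sq]
    have h3 := key t ht
    have h4 := mul_le_mul_of_nonneg_left hSN (by positivity : 0 ≤ 2 * N)
    have h5 := sq_nonneg ‖val (primitive q t)‖
    nlinarith

/-! ### The weak solution and the semi-discrete approximation -/

variable {D}

/-- Both sides are continuous linear images of weakly differentiable functions, so uniqueness of
weak derivatives differentiates the elliptic identity. Thus ∂_t u and ∂_tt u solve elliptic problems
with differentiated data. -/
theorem formL_eq_of_deriv {v v' : ℝ → H10 Ω} {g g' : ℝ → L2 Ω} (hv : IsWeakTimeDeriv T v v')
    (hg : IsWeakTimeDeriv T g g')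
    (h : ∀ᵐ t ∂(timeMeasure T), D.formL univ (v t) = toHneg1L (g t)) :
    ∀ᵐ t ∂(timeMeasure T), D.formL univ (v' t) = toHneg1L (g' t) := by
  have h1 := hv.clm (D.formL univ)
  have h2 := (hg.clm toHneg1L).congr (v' := fun t => D.formL univ (v t))
    (by filter_upwards [h] with t ht; rw [ht]) (Filter.EventuallyEq.refl _ _)
  exact h1.unique h2

/-- Uniqueness identifies the derivatives hidden in the weak formulation with the given regular
ones. The equation then becomes elliptic at almost every time, and the initial conditions become
integral representations. -/
theorem isWeakSolution_spec (hΩ : IsOpen Ω) (hT : 0 < T) {f : ℝ → L2 Ω} {u₀ : H10 Ω} {v₀ : L2 Ω}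
    {u u₁ : ℝ → H10 Ω} {u₂ : ℝ → L2 Ω} (hu : IsWeakSolution T D.a f u₀ v₀ u)
    (h1 : IsWeakTimeDeriv T (fun t => val (u t)) (fun t => val (u₁ t)))
    (h2 : IsWeakTimeDeriv T (fun t => val (u₁ t)) u₂) (hi : Integrable u₁ (timeMeasure T)) :
    IsWeakTimeDeriv T u u₁ ∧
    (∀ᵐ t ∂(timeMeasure T), D.formL univ (u t) = toHneg1L (f t - u₂ t)) ∧
    (∀ᵐ t ∂(timeMeasure T), u t = u₀ + primitive u₁ t) ∧
    (∀ᵐ t ∂(timeMeasure T), val (u₁ t) = v₀ + primitive u₂ t) := by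
  obtain ⟨hmem, u', u'', -, d1, -, d2, heq, i0, i1⟩ := hu
  have hiu : Integrable u (timeMeasure T) := hmem.integrable (by norm_num)
  have hu1 : u' =ᵐ[timeMeasure T] fun t => val (u₁ t) := d1.unique h1
  have hw : IsWeakTimeDeriv T u u₁ := h1.of_injective (val_injective hΩ) hiu hi
  have hd2 : u'' =ᵐ[timeMeasure T] fun t => toHneg1L (u₂ t) := by
    refine d2.unique ((h2.clm toHneg1L).congr ?_ (Filter.EventuallyEq.refl _ _))
    filter_upwards [hu1] with t ht
    rw [ht]; rfl
  refine ⟨hw, ?_, hw.eq_add_primitive hT (val_injective hΩ) i0,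
    h2.eq_add_primitive hT (toHneg1L_injective hΩ) (i1.congr ?_)⟩
  · filter_upwards [heq, hd2] with t a1 a2
    ext v
    have := a1 v
    rw [a2, toHneg1L_apply, formOn_eq] at this
    rw [formL_apply, toHneg1L_apply, inner_sub_left]
    linarith
  · filter_upwards [hu1] with t ht
    rw [ht]; rfl

/-! ### Comparison of the elliptic projection with the semi-discrete solution. -/

namespace Admissible

variable {σ CI CP : ℝ} (h : D.Admissible σ CI CP)
include h

/-- The map 1 + C is linear and continuous, so it commutes with weak time derivatives, and the
scheme can be restated for the multiscale functions themselves. -/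
theorem isSemidiscrete_spec (hT : 0 < T) {m : ℕ} {f : ℝ → L2 Ω} {u₀ v0H : H10 Ω} {uH : ℝ → H10 Ω}
    (hs : D.IsSemidiscrete T m f u₀ v0H uH) : ∃ y₁ y₂ : ℝ → H10 Ω,
      IsWeakTimeDeriv T (fun t => D.ms m (uH t)) y₁ ∧ IsWeakTimeDeriv T y₁ y₂ ∧
      (∀ᵐ t ∂(timeMeasure T), D.ms m (uH t) ∈ D.Vms m ∧ y₁ t ∈ D.Vms m) ∧
      (∀ᵐ t ∂(timeMeasure T), ∀ w ∈ D.Vms m, inner ℝ (val (y₂ t)) (val w) +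
        D.form univ (D.ms m (uH t)) w = inner ℝ (f t) (val w)) ∧
      (∀ᵐ t ∂(timeMeasure T), D.ms m (uH t) = D.ritzMs m u₀ + primitive y₁ t) ∧
      (∀ᵐ t ∂(timeMeasure T), y₁ t = v0H + primitive y₂ t) := by
  obtain ⟨uH', uH'', hmem, -, -, -, d1, d2, heq, i0, p, dp, ip⟩ := hs
  obtain ⟨M, hM⟩ := h.exists_ms m
  have w1 := d1.clm M
  have w2 := d2.clm M
  have e0 : ∀ t, D.ms m (uH t) = M (uH t) := fun t => (hM _).symm
  simp only [e0] at i0 dp ⊢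
  have hid : Function.Injective (ContinuousLinearMap.id ℝ (H10 Ω)) := fun _ _ h => h
  refine ⟨fun t => M (uH' t), fun t => M (uH'' t), w1, w2, ?_, ?_,
    w1.eq_add_primitive (v₀ := D.ritzMs m u₀) hT hid i0,
    w2.eq_add_primitive (v₀ := v0H) hT hid (ip.congr (dp.unique w1))⟩
  · filter_upwards [hmem] with t ht
    exact ⟨⟨_, ht.1, e0 t⟩, ⟨_, ht.2.1, (hM _).symm⟩⟩
  · filter_upwards [heq] with t ht
    rintro _ ⟨v, hv, rfl⟩
    have := ht v hv
    rw [← hM (uH'' t), ← hM (uH t)] at this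
    exact this

/-- The multiscale space has a finite-dimensional image in L²; a preimage of the orthogonal
projection onto this image solves the problem. -/
theorem l2Ms_spec (m : ℕ) (g : L2 Ω) : D.l2Ms m g ∈ D.Vms m ∧
    ∀ w ∈ D.Vms m, inner ℝ (val (D.l2Ms m g)) (val w) = (inner ℝ g (val w) : ℝ) := by
  obtain ⟨S, hS, hSV⟩ := h.exists_Vms m
  have := h.finiteDimensional_fine
  have := Submodule.finiteDimensional_of_le hSV
  set K := S.map (val : H10 Ω →L[ℝ] L2 Ω).toLinearMap with hK
  obtain ⟨z, hz, hzK⟩ := (K.orthogonalProjectionOnto g).2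
  have hex : ∃ z ∈ D.Vms m, ∀ w ∈ D.Vms m,
      (inner ℝ (val z) (val w) : ℝ) = inner ℝ g (val w) := by
    refine ⟨z, by rw [← hS]; exact hz, fun w hw => ?_⟩
    rw [← hS] at hw
    have h1 := K.inner_orthogonalProjectionOnto_eq_of_mem_left ⟨val w, w, hw, rfl⟩ g
    have h2 : val z = (K.orthogonalProjectionOnto g : L2 Ω) := hzK
    rw [h2, real_inner_comm, real_inner_comm (val w) g]
    exact h1
  rw [l2Ms, galerkin, dif_pos hex]
  exact hex.choose_spec

theorem sub_mem_Vms {m : ℕ} {v w : H10 Ω} (hv : v ∈ D.Vms m) (hw : w ∈ D.Vms m) :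
    v - w ∈ D.Vms m := by
  obtain ⟨S, hS, -⟩ := h.exists_Vms m
  rw [← hS] at hv hw ⊢
  exact S.sub_mem hv hw

/-- Comparison of the elliptic projection and the semi-discrete approximation, in the energy. -/
theorem energy_comparison (hT : 0 < T) {m : ℕ} {f : ℝ → L2 Ω} {u₀ v₀' : H10 Ω}
    {u u₁ u₂ uH : ℝ → H10 Ω} (w2 : IsWeakTimeDeriv T u₁ u₂)
    (w1 : IsWeakTimeDeriv T u u₁)
    (heq : ∀ᵐ t ∂(timeMeasure T), D.formL univ (u t) = toHneg1L (f t - val (u₂ t)))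
    (i0 : ∀ᵐ t ∂(timeMeasure T), u t = u₀ + primitive u₁ t)
    (i1 : ∀ᵐ t ∂(timeMeasure T), u₁ t = v₀' + primitive u₂ t)
    (hs : D.IsSemidiscrete T m f u₀ (D.ritzMs m v₀') uH) {ums₁ : ℝ → L2 Ω}
    (hums : IsWeakTimeDeriv T (fun t => val (D.ms m (uH t))) ums₁) :
    ∀ᵐ t ∂(timeMeasure T),
      ‖val (D.ritzMs m (u₁ t)) - ums₁ t‖ ≤
        2 * ∫ s, ‖val (D.ritzMs m (u₂ s) - u₂ s)‖ ∂(timeMeasure T) ∧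
      D.energyNorm (D.ritzMs m (u t) - D.ms m (uH t)) ≤
        2 * ∫ s, ‖val (D.ritzMs m (u₂ s) - u₂ s)‖ ∂(timeMeasure T) := by
  obtain ⟨y₁, y₂, d1, d2, hmem, hy, j0, j1⟩ := h.isSemidiscrete_spec hT hs
  obtain ⟨P, hP⟩ := h.exists_ritzMs m
  have hums' : ums₁ =ᵐ[timeMeasure T] fun t => val (y₁ t) := hums.unique (d1.clm val)
  set p : ℝ → H10 Ω := fun t => P (u₁ t) - y₁ t with hp
  set q : ℝ → H10 Ω := fun t => P (u₂ t) - y₂ t with hq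
  have wq : IsWeakTimeDeriv T p q := (w2.clm P).sub d2
  -- The initial velocities cancel because the discrete one is the elliptic projection of the exact
  -- one.
  have hpq : ∀ᵐ t ∂(timeMeasure T), p t = primitive q t := by
    filter_upwards [i1, j1, ae_mem_timeMeasure T] with t a1 a2 a3
    rw [hp, hq, primitive_sub (P.integrable_comp w2.2.1) d2.2.1 a3.2.le,
      ← primitive_clm P w2.2.1 a3.2.le]
    simp only
    rw [a1, a2, map_add, hP v₀']
    abel
  have hθ : ∀ᵐ t ∂(timeMeasure T), P (u t) - D.ms m (uH t) = primitive p t := by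
    filter_upwards [i0, j0, ae_mem_timeMeasure T] with t a1 a2 a3
    rw [hp, primitive_sub (P.integrable_comp w1.2.1) d1.2.1 a3.2.le,
      ← primitive_clm P w1.2.1 a3.2.le, a1, a2, map_add, hP u₀]
    abel
  have hg : Integrable (fun t => val (P (u₂ t) - u₂ t)) (timeMeasure T) :=
    val.integrable_comp ((P.integrable_comp w2.2.1).sub w2.2.1)
  -- Testing with p in the multiscale space, the elliptic projection disappears from the energy
  -- form; the only source left is the projection error of ∂_tt u in L².
  have est := D.energy_estimate hT wq.1 wq.2.1 hg hpq (by
    filter_upwards [hθ, heq, hy, hmem] with t a1 a2 a3 a4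
    have hw : p t ∈ D.Vms m := by
      rw [hp]; simp only; rw [hP]
      exact h.sub_mem_Vms (h.ritzMs_spec m _).1 a4.2
    have b1 := a3 _ hw
    have b2 := congrArg (fun F : Hneg1 Ω => F (p t)) a2
    simp only [formL_apply, toHneg1L_apply, inner_sub_left] at b2
    have b3 := (h.ritzMs_spec m (u t)).2 _ hw
    rw [← a1, LinearMap.BilinForm.sub_left, hP (u t), b3, b2]
    have c1 : val (q t) = val (P (u₂ t)) - val (y₂ t) := map_sub _ _ _
    have c2 : val (P (u₂ t) - u₂ t) = val (P (u₂ t)) - val (u₂ t) := map_sub _ _ _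
    rw [c1, c2, inner_sub_left, inner_sub_left]
    linarith)
  filter_upwards [est, hums', hθ] with t a1 a2 a3
  simp only [hP] at a1 a3
  refine ⟨?_, ?_⟩
  · rw [a2, ← map_sub, ← hP (u₁ t)]
    exact a1.1
  · rw [a3]; exact a1.2

/-- Comparison of the elliptic projection and the semi-discrete approximation, in `L²(Ω)`. -/
theorem l2_comparison (hT : 0 < T) {m : ℕ} {f : ℝ → L2 Ω} {u₀ : H10 Ω} {v₀ : L2 Ω}
    {u u₁ uH : ℝ → H10 Ω} {u₂ : ℝ → L2 Ω} (w1 : IsWeakTimeDeriv T u u₁)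
    (h2 : Integrable u₂ (timeMeasure T))
    (heq : ∀ᵐ t ∂(timeMeasure T), D.formL univ (u t) = toHneg1L (f t - u₂ t))
    (i0 : ∀ᵐ t ∂(timeMeasure T), u t = u₀ + primitive u₁ t)
    (i1 : ∀ᵐ t ∂(timeMeasure T), val (u₁ t) = v₀ + primitive u₂ t)
    (hs : D.IsSemidiscrete T m f u₀ (D.l2Ms m v₀) uH) :
    ∀ᵐ t ∂(timeMeasure T), ‖val (D.ritzMs m (u t) - D.ms m (uH t))‖ ≤
        2 * ∫ s, ‖val (D.ritzMs m (u₁ s) - u₁ s)‖ ∂(timeMeasure T) := by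
  obtain ⟨y₁, y₂, d1, d2, hmem, hy, j0, j1⟩ := h.isSemidiscrete_spec hT hs
  obtain ⟨P, hP⟩ := h.exists_ritzMs m
  -- Here the error itself, not its time derivative, plays the role of the velocity in
  -- `energy_estimate`.
  set p : ℝ → H10 Ω := fun t => P (u t) - D.ms m (uH t) with hp
  set q : ℝ → H10 Ω := fun t => P (u₁ t) - y₁ t with hq
  have wq : IsWeakTimeDeriv T p q := (w1.clm P).sub d1
  have hpq : ∀ᵐ t ∂(timeMeasure T), p t = primitive q t := by
    filter_upwards [i0, j0, ae_mem_timeMeasure T] with t a1 a2 a3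
    rw [hp, hq, primitive_sub (P.integrable_comp w1.2.1) d1.2.1 a3.2.le,
      ← primitive_clm P w1.2.1 a3.2.le]
    simp only
    rw [a1, a2, map_add, hP u₀]
    abel
  have hg : Integrable (fun t => val (P (u₁ t) - u₁ t)) (timeMeasure T) :=
    val.integrable_comp ((P.integrable_comp w1.2.1).sub w1.2.1)
  have hvy : Integrable (fun s => val (y₂ s)) (timeMeasure T) := val.integrable_comp d2.2.1
  -- The error equation integrated over (0, t). It contains the increments of the velocities; the
  -- difference of the initial velocities is L²-orthogonal to the test space and drops out below.
  have hint : ∀ t ∈ Ioo 0 T, ∀ w ∈ D.Vms m,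
      inner ℝ (primitive u₂ t - val (primitive y₂ t)) (val w) +
        D.form univ (primitive p t) w = 0 := by
    intro t ht w hw
    rw [primitive_clm val d2.2.1 ht.2.le, ← primitive_sub h2 hvy ht.2.le]
    refine D.inner_add_form_primitive (h2.sub hvy) wq.1 ht.2.le ?_
    filter_upwards [heq, hy] with s a2 a3
    have b2 := congrArg (fun F : Hneg1 Ω => F w) a2
    simp only [formL_apply, toHneg1L_apply, inner_sub_left] at b2
    have b3 := (h.ritzMs_spec m (u s)).2 _ hw
    have b1 := a3 w hw
    rw [hp]
    simp only
    rw [LinearMap.BilinForm.sub_left, hP (u s), b3, b2, inner_sub_left]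
    linarith
  have est := D.energy_estimate hT wq.1 wq.2.1 hg hpq (by
    filter_upwards [i1, j1, hmem, ae_mem_timeMeasure T] with t a1 a2 a3 a4
    have hw : p t ∈ D.Vms m := by
      rw [hp]; simp only; rw [hP]
      exact h.sub_mem_Vms (h.ritzMs_spec m _).1 a3.1
    have b1 := hint t a4 _ hw
    have b2 := (h.l2Ms_spec m v₀).2 _ hw
    rw [inner_sub_left] at b1
    have c1 : val (q t) = val (P (u₁ t)) - val (y₁ t) := map_sub _ _ _
    have c2 : val (P (u₁ t) - u₁ t) = val (P (u₁ t)) - val (u₁ t) := map_sub _ _ _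
    have c3 : val (y₁ t) = val (D.l2Ms m v₀) + val (primitive y₂ t) := by rw [a2, map_add]
    rw [c1, c2, inner_sub_left, inner_sub_left, a1, c3, inner_add_left, inner_add_left, b2]
    linarith)
  filter_upwards [est] with t a1
  rw [hp] at a1
  simp only [hP] at a1
  exact a1.1

end Admissible

end LOD

/-! ### Error estimates in Bochner norms -/

section

variable {X Y : Type*} [NormedAddCommGroup X] [NormedAddCommGroup Y] {T : ℝ}

theorem enorm_le_of_norm_le {x : X} {y : Y} {c r s N : ℝ} (hc : 0 ≤ c) (hr : 0 ≤ r) (hs : 0 ≤ s)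
    (hN : 0 ≤ N) (h : ‖x‖ ≤ ‖y‖ + c * (r + s) + N) :
    ‖x‖ₑ ≤ ‖y‖ₑ + ENNReal.ofReal c * (‖r‖ₑ + ‖s‖ₑ) + ENNReal.ofReal N := by
  rw [← ofReal_norm, ← ofReal_norm, Real.enorm_of_nonneg hr,
    Real.enorm_of_nonneg hs, ← ENNReal.ofReal_add hr hs, ← ENNReal.ofReal_mul hc,
    ← ENNReal.ofReal_add (norm_nonneg _) (by positivity), ← ENNReal.ofReal_add (by positivity) hN]
  exact ENNReal.ofReal_le_ofReal h

theorem bochnerNorm_top_le {F : ℝ → X} {G : ℝ → Y} {A B : ℝ → ℝ} {c N : ℝ} (hc : 0 ≤ c)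
    (hN : 0 ≤ N) (hA : ∀ t, 0 ≤ A t) (hB : ∀ t, 0 ≤ B t)
    (h : ∀ᵐ t ∂(timeMeasure T), ‖F t‖ ≤ ‖G t‖ + c * (A t + B t) + N) :
    bochnerNorm T ⊤ F ≤ bochnerNorm T ⊤ G +
      ENNReal.ofReal c * (bochnerNorm T ⊤ A + bochnerNorm T ⊤ B) + ENNReal.ofReal N := by
  simp only [bochnerNorm, eLpNorm_exponent_top]
  refine eLpNormEssSup_le_of_ae_enorm_bound ?_
  filter_upwards [h, enorm_ae_le_eLpNormEssSup G (timeMeasure T),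
    enorm_ae_le_eLpNormEssSup A (timeMeasure T), enorm_ae_le_eLpNormEssSup B (timeMeasure T)]
    with t a1 a2 a3 a4
  refine (enorm_le_of_norm_le hc (hA t) (hB t) hN a1).trans ?_
  gcongr

theorem bochnerNorm_one_le {F : ℝ → X} {G : ℝ → Y} {A B : ℝ → ℝ} {c : ℝ} (hc : 0 ≤ c)
    (hA : ∀ t, 0 ≤ A t) (hB : ∀ t, 0 ≤ B t) (mA : AEMeasurable A (timeMeasure T))
    (mB : AEMeasurable B (timeMeasure T))
    (h : ∀ᵐ t ∂(timeMeasure T), ‖F t‖ ≤ ‖G t‖ + c * (A t + B t)) :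
    bochnerNorm T 1 F ≤ bochnerNorm T 1 G +
      ENNReal.ofReal c * (bochnerNorm T 1 A + bochnerNorm T 1 B) := by
  simp only [bochnerNorm, eLpNorm_one_eq_lintegral_enorm]
  calc _ ≤ ∫⁻ t, (‖G t‖ₑ + ENNReal.ofReal c * (‖A t‖ₑ + ‖B t‖ₑ)) ∂(timeMeasure T) := by
        refine lintegral_mono_ae ?_
        filter_upwards [h] with t a1
        simpa using enorm_le_of_norm_le hc (hA t) (hB t) le_rfl (by simpa using a1)
    _ = _ := by
        have mAB : AEMeasurable (fun t => ENNReal.ofReal c * (‖A t‖ₑ + ‖B t‖ₑ)) (timeMeasure T) :=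
          (mA.enorm.add mB.enorm).const_mul _
        rw [lintegral_add_right' _ mAB,
          lintegral_const_mul' _ _ ENNReal.ofReal_ne_top, lintegral_add_right' _ mB.enorm]

theorem bochnerNorm_one_le_top (F : ℝ → X) :
    bochnerNorm T 1 F ≤ ENNReal.ofReal T * bochnerNorm T ⊤ F := by
  simp only [bochnerNorm, eLpNorm_one_eq_lintegral_enorm, eLpNorm_exponent_top]
  refine (lintegral_mono_ae (enorm_ae_le_eLpNormEssSup F (timeMeasure T))).trans ?_
  simp [timeMeasure, mul_comm]

theorem ofReal_integral_norm {F : ℝ → X} (h : Integrable F (timeMeasure T)) :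
    ENNReal.ofReal (∫ t, ‖F t‖ ∂(timeMeasure T)) = bochnerNorm T 1 F := by
  rw [ofReal_integral_norm_eq_lintegral_enorm h, bochnerNorm, eLpNorm_one_eq_lintegral_enorm]

end

/-! ### Error bounds from the elliptic and the evolutionary comparison. -/

namespace LOD

variable {d : ℕ} {Ω : Set (E d)} {D : LOD Ω} {T : ℝ}

theorem invNorm_sub_comm (g g' : L2 Ω) : D.invNorm (g - g') = D.invNorm (g' - g) := by
  rw [← neg_sub g' g, invNorm, invNorm, wnorm, wnorm]
  congr 1
  refine integral_congr_ae ?_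
  filter_upwards [ae_restrict_of_ae (Lp.coeFn_neg (g' - g))] with x hx
  rw [hx, Pi.neg_apply, norm_neg]

variable (D) in
/-- The elliptic projections onto the fine and the multiscale space differ by at most `c`, relative
to the data, in the energy norm and in `L²(Ω)`. -/
def RitzClose (m : ℕ) (c : ℝ) : Prop :=
  ∀ (u : H10 Ω) (g w : L2 Ω), D.formL univ u = toHneg1L (g - w) →
    D.energyNorm (D.ritzFine u - D.ritzMs m u) ≤ c * (D.invNorm (w - g) + D.energyNorm u) ∧
    ‖val (D.ritzFine u - D.ritzMs m u)‖ ≤ c * (D.invNorm (w - g) + D.energyNorm u)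

namespace Admissible

variable {σ CI CP : ℝ} (h : Admissible D σ CI CP)
include h

/-- The L² bound follows from the energy bound by Poincaré's inequality, without a duality argument;
1 ≤ CP lets one constant serve both. The hypothesis on the rate is all that is retained of m. -/
theorem ritzClose {m : ℕ} {r δ : ℝ} (hH : D.H ≤ δ)
    (hr : √(locError d σ CI m) ≤ r * δ) :
    D.RitzClose m (CP * interpConst d σ CI * (1 + r) * δ) := by
  intro u g w hu
  have hI := h.interpConst_nonneg
  have hCP := h.one_le_CP
  have hδ : 0 < δ := h.H_pos.trans_le hH
  have hrδ : 0 ≤ r * δ := (Real.sqrt_nonneg _).trans hr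
  have key := h.energyNorm_ritz_sub_le m (u := u) (g := g - w) fun v => by
    have := congrArg (fun F : Hneg1 Ω => F v) hu
    exact this
  rw [invNorm_sub_comm] at key
  have h1 := D.invNorm_nonneg (w - g)
  have h2 := D.energyNorm_nonneg u
  have bd : D.H * D.invNorm (w - g) + √(locError d σ CI m) * D.energyNorm u ≤
      (1 + r) * δ * (D.invNorm (w - g) + D.energyNorm u) := by
    have e1 := mul_le_mul_of_nonneg_right hH h1
    have e2 := mul_le_mul_of_nonneg_right hr h2
    have e3 := mul_nonneg hrδ h1
    have e4 := mul_nonneg hδ.le h2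
    nlinarith
  have key' : D.energyNorm (D.ritzFine u - D.ritzMs m u) ≤
      interpConst d σ CI * ((1 + r) * δ * (D.invNorm (w - g) + D.energyNorm u)) :=
    key.trans (mul_le_mul_of_nonneg_left bd hI)
  have key2 : CP * D.energyNorm (D.ritzFine u - D.ritzMs m u) ≤
      CP * interpConst d σ CI * (1 + r) * δ * (D.invNorm (w - g) + D.energyNorm u) :=
    (mul_le_mul_of_nonneg_left key' (by linarith)).trans_eq (by ring)
  exact ⟨(le_mul_of_one_le_left (D.energyNorm_nonneg _) hCP).trans key2,
    (h.poincare _).trans key2⟩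

/-- The multiscale projection error is split at the fine projection, leaving the discretization
error and a difference controlled by `RitzClose`. -/
theorem bochnerNorm_ritzMs_sub_le {m : ℕ} {c : ℝ} (hc : 0 ≤ c) (hR : D.RitzClose m c)
    {u : ℝ → H10 Ω} {g w : ℝ → L2 Ω} (iu : Integrable u (timeMeasure T))
    (ig : Integrable g (timeMeasure T)) (iw : Integrable w (timeMeasure T))
    (heq : ∀ᵐ t ∂(timeMeasure T), D.formL univ (u t) = toHneg1L (g t - w t)) :
    ENNReal.ofReal (∫ t, ‖val (D.ritzMs m (u t) - u t)‖ ∂(timeMeasure T)) ≤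
      bochnerNorm T 1 (fun t => val (u t - D.ritzFine (u t))) + ENNReal.ofReal c *
        (bochnerNorm T 1 (fun t => D.invNorm (w t - g t)) +
          bochnerNorm T 1 (fun t => D.energyNorm (u t))) := by
  obtain ⟨P, hP⟩ := h.exists_ritzMs m
  simp only [← hP]
  have iP : Integrable (fun t => val (P (u t) - u t)) (timeMeasure T) :=
    val.integrable_comp ((P.integrable_comp iu).sub iu)
  rw [ofReal_integral_norm iP]
  refine bochnerNorm_one_le hc (fun t => D.invNorm_nonneg _) (fun t => D.energyNorm_nonneg _)
    (D.continuous_invNorm.comp_aestronglyMeasurable (iw.sub ig).1).aemeasurable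
    (D.continuous_energyNorm.comp_aestronglyMeasurable iu.1).aemeasurable ?_
  filter_upwards [heq] with t ht
  have := (hR _ _ _ ht).2
  rw [← hP] at this
  have e : val (P (u t) - u t) =
      -(val (u t - D.ritzFine (u t)) + val (D.ritzFine (u t) - P (u t))) := by
    simp only [map_sub]; abel
  rw [e, norm_neg]
  exact (norm_add_le _ _).trans (by gcongr)

/-- The elliptic comparison is used three times: for u in the energy norm, for ∂_t u in L², and for
∂_tt u inside the source. The common source contribution is isolated as n. -/
theorem energy_error_le (hT : 0 < T) {m : ℕ} {c : ℝ} (hc : 0 ≤ c) (hR : D.RitzClose m c)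
    {f : ℝ → L2 Ω} {u₀ v₀' : H10 Ω} {v₀ : L2 Ω} {u : ℝ → H10 Ω}
    (hu : IsWeakSolution T D.a f u₀ v₀ u)
    {u1 u2 : ℝ → H10 Ω} {u3 u4 f1 f2 : ℝ → L2 Ω}
    (d1 : IsWeakTimeDeriv T (fun t => val (u t)) (fun t => val (u1 t)))
    (d2 : IsWeakTimeDeriv T (fun t => val (u1 t)) (fun t => val (u2 t)))
    (d3 : IsWeakTimeDeriv T (fun t => val (u2 t)) u3) (d4 : IsWeakTimeDeriv T u3 u4)
    (df1 : IsWeakTimeDeriv T f f1) (df2 : IsWeakTimeDeriv T f1 f2)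
    (iu1 : Integrable u1 (timeMeasure T)) (iu2 : Integrable u2 (timeMeasure T))
    (hv : val v₀' = v₀) {uH : ℝ → H10 Ω} (hs : D.IsSemidiscrete T m f u₀ (D.ritzMs m v₀') uH)
    {ums1 : ℝ → L2 Ω} (hums : IsWeakTimeDeriv T (fun t => val (D.ms m (uH t))) ums1) :
    ∃ n : ℝ≥0∞,
      n ≤ ENNReal.ofReal T * bochnerNorm T ⊤ (fun t => val (u2 t - D.ritzFine (u2 t))) +
        ENNReal.ofReal c * (bochnerNorm T 1 (fun t => D.invNorm (u4 t - f2 t)) +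
          bochnerNorm T 1 (fun t => D.energyNorm (u2 t))) ∧
      bochnerNorm T ⊤ (fun t => val (u1 t) - ums1 t) ≤
        bochnerNorm T ⊤ (fun t => val (u1 t - D.ritzFine (u1 t))) +
        ENNReal.ofReal c * (bochnerNorm T ⊤ (fun t => D.invNorm (u3 t - f1 t)) +
          bochnerNorm T ⊤ (fun t => D.energyNorm (u1 t))) + 2 * n ∧
      bochnerNorm T ⊤ (fun t => D.energyNorm (u t - D.ms m (uH t))) ≤
        bochnerNorm T ⊤ (fun t => D.energyNorm (u t - D.ritzFine (u t))) +
        ENNReal.ofReal c * (bochnerNorm T ⊤ (fun t => D.invNorm (val (u2 t) - f t)) +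
          bochnerNorm T ⊤ (fun t => D.energyNorm (u t))) + 2 * n := by
  obtain ⟨w1, q0, i0, i1⟩ := isWeakSolution_spec h.isOpen hT hu d1 d2 iu1
  have w2 : IsWeakTimeDeriv T u1 u2 := d2.of_injective (val_injective h.isOpen) iu1 iu2
  have q1 := formL_eq_of_deriv w1 (df1.sub d3) q0
  have q2 := formL_eq_of_deriv w2 (df2.sub d4) q1
  have i1' : ∀ᵐ t ∂(timeMeasure T), u1 t = v₀' + primitive u2 t := by
    filter_upwards [i1, ae_mem_timeMeasure T] with t a1 a2
    refine val_injective h.isOpen ?_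
    rw [a1, map_add, hv, primitive_clm val iu2 a2.2.le]
  have est := h.energy_comparison hT w2 w1 q0 i0 i1' hs hums
  have hn := h.bochnerNorm_ritzMs_sub_le hc hR iu2 df2.2.1 d4.2.1 q2
  obtain ⟨N, hN⟩ : ∃ N, N = ∫ s, ‖val (D.ritzMs m (u2 s) - u2 s)‖ ∂(timeMeasure T) := ⟨_, rfl⟩
  have hN0 : 0 ≤ 2 * N :=
    mul_nonneg zero_le_two (hN ▸ integral_nonneg fun _ => norm_nonneg _)
  have h2N : ENNReal.ofReal (2 * N) = 2 * ENNReal.ofReal N := by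
    rw [ENNReal.ofReal_mul zero_le_two, ENNReal.ofReal_ofNat]
  rw [← hN] at hn
  simp only [← hN] at est
  -- The source is needed in L¹ in time while the discretization error of ∂_tt u is measured in L^∞;
  -- this is where T enters the constant.
  refine ⟨ENNReal.ofReal N, hn.trans (by gcongr; exact bochnerNorm_one_le_top _), ?_, ?_⟩
  · rw [← h2N]
    refine bochnerNorm_top_le hc hN0 (fun t => D.invNorm_nonneg _)
      (fun t => D.energyNorm_nonneg _) ?_
    filter_upwards [est, q1] with t a1 a2
    have a3 := (hR _ _ _ a2).2
    have e : val (u1 t) - ums1 t = val (u1 t - D.ritzFine (u1 t)) +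
        val (D.ritzFine (u1 t) - D.ritzMs m (u1 t)) + (val (D.ritzMs m (u1 t)) - ums1 t) := by
      simp only [map_sub]; abel
    rw [e]
    exact (norm_add₃_le).trans (add_le_add (by gcongr) a1.1)
  · rw [← h2N]
    refine bochnerNorm_top_le hc hN0 (fun t => D.invNorm_nonneg _)
      (fun t => D.energyNorm_nonneg _) ?_
    filter_upwards [est, q0] with t a1 a2
    have a3 := (hR _ _ _ a2).1
    have e : u t - D.ms m (uH t) = (u t - D.ritzFine (u t)) +
        (D.ritzFine (u t) - D.ritzMs m (u t)) + (D.ritzMs m (u t) - D.ms m (uH t)) := by abel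
    rw [Real.norm_of_nonneg (D.energyNorm_nonneg _), Real.norm_of_nonneg (D.energyNorm_nonneg _), e]
    exact (D.energyNorm_add_le _ _).trans
      (add_le_add ((D.energyNorm_add_le _ _).trans (by gcongr)) a1.2)

/-- The elliptic comparison is used for u and, inside the source, for ∂_t u, so one time derivative
less is required than for the energy error. -/
theorem l2_error_le (hT : 0 < T) {m : ℕ} {c : ℝ} (hc : 0 ≤ c) (hR : D.RitzClose m c)
    {f : ℝ → L2 Ω} {u₀ : H10 Ω} {v₀ : L2 Ω} {u : ℝ → H10 Ω}
    (hu : IsWeakSolution T D.a f u₀ v₀ u) {u1 : ℝ → H10 Ω} {u2 u3 f1 : ℝ → L2 Ω}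
    (d1 : IsWeakTimeDeriv T (fun t => val (u t)) (fun t => val (u1 t)))
    (d2 : IsWeakTimeDeriv T (fun t => val (u1 t)) u2) (d3 : IsWeakTimeDeriv T u2 u3)
    (df1 : IsWeakTimeDeriv T f f1) (iu1 : Integrable u1 (timeMeasure T))
    {uH : ℝ → H10 Ω} (hs : D.IsSemidiscrete T m f u₀ (D.l2Ms m v₀) uH) :
    ∃ n : ℝ≥0∞,
      n ≤ bochnerNorm T 1 (fun t => val (u1 t - D.ritzFine (u1 t))) +
        ENNReal.ofReal c * (bochnerNorm T 1 (fun t => D.invNorm (u3 t - f1 t)) +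
          bochnerNorm T 1 (fun t => D.energyNorm (u1 t))) ∧
      bochnerNorm T ⊤ (fun t => val (u t - D.ms m (uH t))) ≤
        bochnerNorm T ⊤ (fun t => val (u t - D.ritzFine (u t))) +
        ENNReal.ofReal c * (bochnerNorm T ⊤ (fun t => D.invNorm (u2 t - f t)) +
          bochnerNorm T ⊤ (fun t => D.energyNorm (u t))) + 2 * n := by
  obtain ⟨w1, q0, i0, i1⟩ := isWeakSolution_spec h.isOpen hT hu d1 d2 iu1
  have q1 := formL_eq_of_deriv w1 (df1.sub d3) q0
  have est := h.l2_comparison hT w1 d2.2.1 q0 i0 i1 hs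
  have hn := h.bochnerNorm_ritzMs_sub_le hc hR iu1 df1.2.1 d3.2.1 q1
  obtain ⟨N, hN⟩ : ∃ N, N = ∫ s, ‖val (D.ritzMs m (u1 s) - u1 s)‖ ∂(timeMeasure T) := ⟨_, rfl⟩
  have hN0 : 0 ≤ 2 * N :=
    mul_nonneg zero_le_two (hN ▸ integral_nonneg fun _ => norm_nonneg _)
  have h2N : ENNReal.ofReal (2 * N) = 2 * ENNReal.ofReal N := by
    rw [ENNReal.ofReal_mul zero_le_two, ENNReal.ofReal_ofNat]
  rw [← hN] at hn
  simp only [← hN] at est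
  refine ⟨ENNReal.ofReal N, hn, ?_⟩
  rw [← h2N]
  refine bochnerNorm_top_le hc hN0 (fun t => D.invNorm_nonneg _)
    (fun t => D.energyNorm_nonneg _) ?_
  filter_upwards [est, q0] with t a1 a2
  have a3 := (hR _ _ _ a2).2
  have e : val (u t - D.ms m (uH t)) = val (u t - D.ritzFine (u t)) +
      val (D.ritzFine (u t) - D.ritzMs m (u t)) + val (D.ritzMs m (u t) - D.ms m (uH t)) := by
    simp only [map_sub]; abel
  rw [e]
  exact (norm_add₃_le).trans (add_le_add (by gcongr) a1)

end Admissible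

end LOD

/-! ### Normalization of the constants and collection of terms. -/

namespace LOD

variable {d : ℕ} {Ω : Set (E d)} {D : LOD Ω}

theorem InterpStable.mono {CI CI' : ℝ} (h : D.InterpStable CI) (hC : CI ≤ CI') :
    D.InterpStable CI' := by
  have hH : 0 ≤ D.H := Real.iSup_nonneg fun _ => Metric.diam_nonneg
  refine ⟨fun K hK v => (h.1 K hK v).trans ?_, fun K hK w hw => (h.2 K hK w hw).trans ?_⟩
  · exact mul_le_mul_of_nonneg_right hC (wnorm_nonneg _ _ _)
  · exact mul_le_mul_of_nonneg_right (mul_le_mul_of_nonneg_right hC hH) (wnorm_nonneg _ _ _)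

theorem WeightedPoincare.mono {CP CP' : ℝ} (h : D.WeightedPoincare CP) (hC : CP ≤ CP') :
    D.WeightedPoincare CP' := fun v =>
  (h v).trans (mul_le_mul_of_nonneg_right hC (D.energyNorm_nonneg v))

end LOD

theorem energy_bookkeeping {κ τ δ n L₁ L₂ i₂ i₃ i₄ e₀ e₁ e₂ d₀ d₁ d₂ : ℝ≥0∞}
    (hn : n ≤ τ * d₂ + κ * δ * (i₄ + e₂)) (h₁ : L₁ ≤ d₁ + κ * δ * (i₃ + e₁) + 2 * n)
    (h₂ : L₂ ≤ d₀ + κ * δ * (i₂ + e₀) + 2 * n) :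
    L₁ + L₂ ≤ (4 * κ + 4 * τ + 2) * (δ * (i₂ + i₃ + i₄ + e₀ + e₁ + e₂) + (d₁ + d₀ + d₂)) := by
  calc L₁ + L₂ ≤ (d₁ + κ * δ * (i₃ + e₁) + 2 * (τ * d₂ + κ * δ * (i₄ + e₂))) +
        (d₀ + κ * δ * (i₂ + e₀) + 2 * (τ * d₂ + κ * δ * (i₄ + e₂))) := by
        gcongr
        · exact h₁.trans (by gcongr)
        · exact h₂.trans (by gcongr)
    -- In [0, ∞] there is no subtraction; adding exactly the terms missing on the left turns the
    -- inequality into a polynomial identity.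
    _ ≤ (d₁ + κ * δ * (i₃ + e₁) + 2 * (τ * d₂ + κ * δ * (i₄ + e₂))) +
        (d₀ + κ * δ * (i₂ + e₀) + 2 * (τ * d₂ + κ * δ * (i₄ + e₂))) +
        ((3 * κ + 4 * τ + 2) * δ * (i₂ + i₃ + e₀ + e₁) + (4 * τ + 2) * δ * (i₄ + e₂) +
          (4 * κ + 4 * τ + 1) * (d₁ + d₀) + (4 * κ + 2) * d₂) := le_self_add
    _ = _ := by ring

theorem l2_bookkeeping {κ τ δ n L i₂ i₃ e₀ e₁ d₀ d₁ : ℝ≥0∞}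
    (hn : n ≤ d₁ + κ * δ * (i₃ + e₁)) (h : L ≤ d₀ + κ * δ * (i₂ + e₀) + 2 * n) :
    L ≤ (4 * κ + 4 * τ + 2) * (δ * (i₂ + i₃ + e₀ + e₁) + (d₀ + d₁)) := by
  calc L ≤ d₀ + κ * δ * (i₂ + e₀) + 2 * (d₁ + κ * δ * (i₃ + e₁)) := h.trans (by gcongr)
    _ ≤ d₀ + κ * δ * (i₂ + e₀) + 2 * (d₁ + κ * δ * (i₃ + e₁)) +
        ((3 * κ + 4 * τ + 2) * δ * (i₂ + e₀) + (2 * κ + 4 * τ + 2) * δ * (i₃ + e₁) +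
          (4 * κ + 4 * τ + 1) * d₀ + (4 * κ + 4 * τ) * d₁) := le_self_add
    _ = _ := by ring

end WaveLOD

end

/-! ### The error estimates. -/

open WaveLOD

theorem theorem4p3 (d : ℕ) (hd : 0 < d) (Ω : Set (E d)) (hΩ : IsOpen Ω) (hΩc : IsConnected Ω)
    (hΩL : HasLipschitzBoundary Ω) (σ CI CP : ℝ) :
    ∃ γ : ℝ, 0 < γ ∧ γ < 1 ∧ ∀ T : ℝ, 0 < T → ∃ C : ℝ, 0 < C ∧
      ∀ D : LOD Ω, D.coarse.ShapeRegular σ → D.coarse.QuasiUniform σ → D.fine.ShapeRegular σ →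
        D.InterpStable CI → D.WeightedPoincare CP →
      ∀ m : ℕ, 1 ≤ m →
      ∀ (f : ℝ → L2 Ω) (u₀ : H10 Ω) (v₀ : L2 Ω) (u : ℝ → H10 Ω), MemLp f 2 (timeMeasure T) →
        IsWeakSolution T D.a f u₀ v₀ u →
      -- part (a)
      (∀ (u1 u2 : ℝ → H10 Ω) (u3 u4 f1 f2 : ℝ → L2 Ω),
        IsWeakTimeDeriv T (fun t => val (u t)) (fun t => val (u1 t)) →
        IsWeakTimeDeriv T (fun t => val (u1 t)) (fun t => val (u2 t)) →
        IsWeakTimeDeriv T (fun t => val (u2 t)) u3 → IsWeakTimeDeriv T u3 u4 →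
        IsWeakTimeDeriv T f f1 → IsWeakTimeDeriv T f1 f2 →
        MemLp u3 ∞ (timeMeasure T) → MemLp f1 ∞ (timeMeasure T) →
        MemLp u4 1 (timeMeasure T) → MemLp f2 1 (timeMeasure T) →
        MemLp u1 ∞ (timeMeasure T) → MemLp u2 1 (timeMeasure T) →
        ∀ v₀' : H10 Ω, val v₀' = v₀ →
        ∀ uH : ℝ → H10 Ω, D.IsSemidiscrete T m f u₀ (D.ritzMs m v₀') uH →
        ∀ ums1 : ℝ → L2 Ω, IsWeakTimeDeriv T (fun t => val (D.ms m (uH t))) ums1 →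
        bochnerNorm T ∞ (fun t => val (u1 t) - ums1 t) +
            bochnerNorm T ∞ (fun t => D.energyNorm (u t - D.ms m (uH t))) ≤
          ENNReal.ofReal C *
            (ENNReal.ofReal (D.H + (m : ℝ) ^ ((d : ℝ) / 2) * γ ^ m) *
              (bochnerNorm T ∞ (fun t => D.invNorm (val (u2 t) - f t)) +
                bochnerNorm T ∞ (fun t => D.invNorm (u3 t - f1 t)) +
                bochnerNorm T 1 (fun t => D.invNorm (u4 t - f2 t)) +
                bochnerNorm T ∞ (fun t => D.energyNorm (u t)) +
                bochnerNorm T ∞ (fun t => D.energyNorm (u1 t)) +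
                bochnerNorm T 1 (fun t => D.energyNorm (u2 t))) +
              (bochnerNorm T ∞ (fun t => val (u1 t - D.ritzFine (u1 t))) +
                bochnerNorm T ∞ (fun t => D.energyNorm (u t - D.ritzFine (u t))) +
                bochnerNorm T ∞ (fun t => val (u2 t - D.ritzFine (u2 t)))))) ∧
      -- part (b)
      (∀ (u1 : ℝ → H10 Ω) (u2 u3 f1 : ℝ → L2 Ω),
        IsWeakTimeDeriv T (fun t => val (u t)) (fun t => val (u1 t)) →
        IsWeakTimeDeriv T (fun t => val (u1 t)) u2 → IsWeakTimeDeriv T u2 u3 →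
        IsWeakTimeDeriv T f f1 →
        MemLp u2 ∞ (timeMeasure T) → MemLp u3 1 (timeMeasure T) → MemLp f1 1 (timeMeasure T) →
        MemLp u1 1 (timeMeasure T) →
        ∀ uH : ℝ → H10 Ω, D.IsSemidiscrete T m f u₀ (D.l2Ms m v₀) uH →
        bochnerNorm T ∞ (fun t => val (u t - D.ms m (uH t))) ≤
          ENNReal.ofReal C *
            (ENNReal.ofReal (D.H + (m : ℝ) ^ ((d : ℝ) / 2) * γ ^ m) *
              (bochnerNorm T ∞ (fun t => D.invNorm (u2 t - f t)) +
                bochnerNorm T 1 (fun t => D.invNorm (u3 t - f1 t)) +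
                bochnerNorm T ∞ (fun t => D.energyNorm (u t)) +
                bochnerNorm T 1 (fun t => D.energyNorm (u1 t))) +
              (bochnerNorm T ∞ (fun t => val (u t - D.ritzFine (u t))) +
                bochnerNorm T 1 (fun t => val (u1 t - D.ritzFine (u1 t)))))) := by
  -- The constants are enlarged to be at least one, which the admissibility structure demands and
  -- which costs nothing.
  have hI : (1 : ℝ) ≤ max CI 1 := le_max_right _ _
  have hP : (1 : ℝ) ≤ max CP 1 := le_max_right _ _
  obtain ⟨γ, hγ0, hγ1, r, hr0, hr⟩ := LOD.exists_rate d σ (max CI 1)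
  obtain ⟨k, hk⟩ : ∃ k, k = max CP 1 * LOD.interpConst d σ (max CI 1) * (1 + r) := ⟨_, rfl⟩
  have hk0 : 0 ≤ k := hk ▸ mul_nonneg (mul_nonneg (by linarith)
    (mul_nonneg (by linarith) (Real.sqrt_nonneg _))) (by linarith)
  -- In (a) the source enters both bounds with a factor 2, whence 4k and 4T; in (b) the
  -- discretization error of ∂_t u carries the factor 2. The rate is fixed before T.
  refine ⟨γ, hγ0, hγ1, fun T hT => ⟨4 * k + 4 * T + 2, by positivity, ?_⟩⟩
  intro D hshape hquasi hfine hinterp hpoin m hm f u₀ v₀ u _ hu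
  have h : LOD.Admissible D σ (max CI 1) (max CP 1) :=
    { pos := hd
      isOpen := hΩ
      nonempty := hΩc.nonempty
      regular := interior_closure_of_lipschitz hΩ hΩL
      shape := hshape
      quasi := hquasi
      fineShape := hfine
      interp := hinterp.mono (le_max_left _ _)
      poincare := hpoin.mono (le_max_left _ _)
      one_le_CI := hI
      one_le_CP := hP }
  obtain ⟨δ, hδ⟩ : ∃ δ, δ = D.H + (m : ℝ) ^ ((d : ℝ) / 2) * γ ^ m := ⟨_, rfl⟩
  have hγm : 0 < γ ^ m := pow_pos hγ0 m
  -- For m ≥ 1 the polynomial factor is at least one, so the pure exponential bound is already below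
  -- δ.
  have hm1 : (1 : ℝ) ≤ (m : ℝ) ^ ((d : ℝ) / 2) :=
    Real.one_le_rpow (by exact_mod_cast hm) (by positivity)
  have hHδ : D.H ≤ δ := by
    rw [hδ]; nlinarith
  have hγδ : γ ^ m ≤ δ := by
    rw [hδ]; nlinarith [h.H_pos]
  have hδ0 : 0 ≤ δ := hγm.le.trans hγδ
  have hR : D.RitzClose m (k * δ) := hk ▸
    h.ritzClose hHδ ((hr m).trans (mul_le_mul_of_nonneg_left hγδ hr0.le))
  have hC : ENNReal.ofReal (4 * k + 4 * T + 2) =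
      4 * ENNReal.ofReal k + 4 * ENNReal.ofReal T + 2 := by
    rw [ENNReal.ofReal_add (by positivity) zero_le_two, ENNReal.ofReal_add (by positivity)
      (by positivity), ENNReal.ofReal_mul (by norm_num), ENNReal.ofReal_mul (by norm_num)]
    simp
  rw [← hδ, hC]
  refine ⟨?_, ?_⟩
  · intro u1 u2 u3 u4 f1 f2 d1 d2 d3 d4 df1 df2 _ _ _ _ m1 m2 v₀' hv uH hs ums1 hums
    obtain ⟨n, e1, e2, e3⟩ := h.energy_error_le hT (mul_nonneg hk0 hδ0) hR hu d1 d2 d3 d4 df1 df2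
      (m1.integrable le_top) (m2.integrable le_rfl) hv hs hums
    rw [ENNReal.ofReal_mul hk0] at e1 e2 e3
    exact energy_bookkeeping e1 e2 e3
  · intro u1 u2 u3 f1 d1 d2 d3 df1 _ _ _ m1 uH hs
    obtain ⟨n, e1, e2⟩ := h.l2_error_le hT (mul_nonneg hk0 hδ0) hR hu d1 d2 d3 df1
      (m1.integrable le_rfl) hs
    rw [ENNReal.ofReal_mul hk0] at e1 e2
    exact l2_bookkeeping e1 e2
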